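/- All algebras are associative algebras over $\mathbb C$, not necessarily unital. An algebra $A$ is non-degenerate if $aA=0$ implies $a=0$ and $Aa=0$ implies $a=0$; it is idempotent if $A$ is spanned by products. $M(A)$ denotes the multiplier algebra, $\otimes$ the algebraic tensor product over $\mathbb C$, and $\iota$ an identity map. A *coproduct* on $A$ is a homomorphism $\Delta:A\to M(A\otimes A)$ such that $T_1(a\otimes b):=\Delta(a)(1\otimes b)$ and $T_2(c\otimes a):=(c\otimes 1)\Delta(a)$ lie in $A\otimes A$ for all $a,b,c\in A$, and such that $(c\otimes1\otimes1)(\Delta\otimes\iota)(\Delta(a)(1\otimes b))=(\iota\otimes\Delta)((c\otimes1)\Delta(a))(1\otimes1\otimes b)$. It is *full* if $A$ is the only subspace $V$ of $A$ with $T_1(A\otimes A)\subseteq V\otimes A$ and the only subspace $W$ with $T_2(A\otimes A)\subseteq A\otimes W$. A *counit* is a linear map $\varepsilon:A\to\mathbb C$ with $(\varepsilon\otimes\iota)T_1(a\otimes b)=ab$ and $(\iota\otimes\varepsilon)T_2(c\otimes a)=ca$. A *weak multiplier Hopf algebra* is a pair $(A,\Delta)$ of a non-degenerate idempotent algebra $A$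 and a full coproduct $\Delta$ on $A$ with a counit $\varepsilon$ such that there is an idempotent $E\in M(A\otimes A)$ with: 1. $T_1(A\otimes A)=E(A\otimes A)$ and $T_2(A\otimes A)=(A\otimes A)E$; 2. $(\Delta\otimes\iota)(E)=(\iota\otimes\Delta)(E)=(E\otimes1)(1\otimes E)=(1\otimes E)(E\otimes1)$, where $\Delta\otimes\iota$ and $\iota\otimes\Delta$ are extended to $M(A\otimes A)$ by requiring $(\Delta\otimes\iota)(1)=E\otimes1$ and $(\iota\otimes\Delta)(1)=1\otimes E$; 3. $\operatorname{Ker}T_i=(1-G_i)(A\otimes A)$ for $i=1,2$, where $G_1,G_2:A\otimes A\to A\otimes A$ are the linear maps determined by $(G_1\otimes\iota)(\Delta_{13}(a)(1\otimes b\otimes c))=\Delta_{13}(a)(1\otimes E)(1\otimes b\otimes c)$ and $(\iota\otimes G_2)((a\otimes b\otimes1)\Delta_{13}(c))=(a\otimes b\otimes1)(E\otimes1)\Delta_{13}(c)$. Let $R_1,R_2$ be the linear maps on $A\otimes A$ determined by $T_iR_iT_i=T_i$, $R_iT_iR_i=R_i$, $R_iT_i=G_i$, $T_1R_1(z)=Ez$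 and $T_2R_2(z)=zE$. The *antipode* is the linear map $S:A\to M(A)$ given by $S(a)b=(\varepsilon\otimes\iota)R_1(a\otimes b)$ and $bS(a)=(\iota\otimes\varepsilon)R_2(b\otimes a)$. The weak multiplier Hopf algebra is *regular* if $S$ is a bijective map from $A$ to itself. In the regular case the target map $\varepsilon_t:A\to M(A)$ is $\varepsilon_t(a)=\sum a_{(1)}S(a_{(2)})$, that is, $c\,\varepsilon_t(a)=\sum (ca_{(1)})S(a_{(2)})$ with $\sum ca_{(1)}\otimes a_{(2)}=(c\otimes1)\Delta(a)$ for $c\in A$. Let $A_t=\{x\in M(A): x\,\varepsilon_t(A)\subseteq\varepsilon_t(A),\ \varepsilon_t(A)\,x\subseteq\varepsilon_t(A)\}$ be the multiplier algebra of $\varepsilon_t(A)$ inside $M(A)$. For $a\in A$ and a linear functional $\omega$ on $A$, the multiplier $x=(\iota\otimes\omega)\Delta(a)\in M(A)$ is given by $xb=(\iota\otimes\omega)(\Delta(a)(b\otimes1))$ and $bx=(\iota\otimes\omega)((b\otimes1)\Delta(a))$. A *left integral* on $(A,\Delta)$ is a non-zero linear functional $\varphi$ on $A$ such that $(\iota\otimes\varphi)\Delta(a)\in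 A_t$ for all $a\in A$. A functional $\varphi$ is *faithful* if $a=0$ whenever $\varphi(ab)=0$ for all $b\in A$, and also whenever $\varphi(ba)=0$ for all $b\in A$. **Proposition.** Let $(A,\Delta)$ be a regular weak multiplier Hopf algebra and let $\varphi$ be a faithful left integral on it. Then there is an algebra automorphism $\sigma$ of $A$ such that $\varphi(ab)=\varphi(b\,\sigma(a))$ for all $a,b\in A$, and $\varphi(\sigma(a))=\varphi(a)$ for all $a\in A$. -/

import Mathlib

open scoped TensorProduct

noncomputable section

namespace WMHA

section Multipliers

variable {B C : Type*}
  [NonUnitalRing B] [Module ℂ B] [IsScalarTower ℂ B B] [SMulCommClass ℂ B B]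
  [NonUnitalRing C] [Module ℂ C] [IsScalarTower ℂ C C] [SMulCommClass ℂ C C]

/-- The product of `B` is non-degenerate. -/
def Nondegenerate (B : Type*) [NonUnitalRing B] : Prop :=
  (∀ a : B, (∀ b : B, a * b = 0) → a = 0) ∧ (∀ a : B, (∀ b : B, b * a = 0) → a = 0)

/-- The algebra `B` is idempotent: `B ^ 2 = B`, i.e. every element is a sum of products. -/
def Idempotent (B : Type*) [NonUnitalRing B] [Module ℂ B] : Prop :=
  Submodule.span ℂ {x : B | ∃ a b : B, x = a * b} = ⊤

variable (B) in
/-- The pairs of linear maps `b ↦ m b` and `b ↦ b m` of `B` such that `(a m) b = a (m b)`. -/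
def multiplierSubalgebra : Subalgebra ℂ (Module.End ℂ B × (Module.End ℂ B)ᵐᵒᵖ) where
  carrier := {m | ∀ a b : B, m.2.unop a * b = a * m.1 b}
  mul_mem' := by
    intro m n hm hn a b
    simp only [Set.mem_ofPred_eq] at hm hn
    simp [hn, hm]
  add_mem' := by
    intro m n hm hn a b
    simp only [Set.mem_ofPred_eq] at hm hn
    simp [hn, hm, add_mul, mul_add]
  algebraMap_mem' := by
    intro r a b
    simp [Prod.algebraMap_apply, MulOpposite.algebraMap_apply, Module.algebraMap_end_apply,
      smul_mul_assoc, mul_smul_comm]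

variable (B) in
/-- The multiplier algebra `M(B)`: a multiplier `m` is a pair of linear maps
`b ↦ m b` and `b ↦ b m` of `B` such that `(a m) b = a (m b)`. -/
def Multiplier : Type _ := multiplierSubalgebra B

instance : Ring (Multiplier B) := inferInstanceAs (Ring (multiplierSubalgebra B))

instance : Algebra ℂ (Multiplier B) := inferInstanceAs (Algebra ℂ (multiplierSubalgebra B))

namespace Multiplier

/-- The map `b ↦ m b`. -/
def left (m : Multiplier B) : B →ₗ[ℂ] B := m.1.1

/-- The map `b ↦ b m`. -/
def right (m : Multiplier B) : B →ₗ[ℂ] B := m.1.2.unop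

theorem right_apply_mul (m : Multiplier B) (a b : B) : m.right a * b = a * m.left b := m.2 a b

/-- The multiplier with given left and right actions. -/
def mk' (L R : B →ₗ[ℂ] B) (h : ∀ a b, R a * b = a * L b) : Multiplier B :=
  ⟨(L, MulOpposite.op R), h⟩

@[ext]
theorem ext {m n : Multiplier B} (h₁ : m.left = n.left) (h₂ : m.right = n.right) : m = n :=
  Subtype.ext (Prod.ext h₁ (MulOpposite.unop_injective h₂))

@[simp]
theorem left_mk' (L R : B →ₗ[ℂ] B) (h : ∀ a b, R a * b = a * L b) : (mk' L R h).left = L := rfl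

@[simp]
theorem right_mk' (L R : B →ₗ[ℂ] B) (h : ∀ a b, R a * b = a * L b) : (mk' L R h).right = R := rfl

@[simp]
theorem left_zero : (0 : Multiplier B).left = 0 := rfl

@[simp]
theorem right_zero : (0 : Multiplier B).right = 0 := rfl

@[simp]
theorem left_one : (1 : Multiplier B).left = LinearMap.id := rfl

@[simp]
theorem right_one : (1 : Multiplier B).right = LinearMap.id := rfl

@[simp]
theorem left_add (m n : Multiplier B) : (m + n).left = m.left + n.left := rfl

@[simp]
theorem right_add (m n : Multiplier B) : (m + n).right = m.right + n.right := rfl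

@[simp]
theorem left_smul (r : ℂ) (m : Multiplier B) : (r • m).left = r • m.left := rfl

@[simp]
theorem right_smul (r : ℂ) (m : Multiplier B) : (r • m).right = r • m.right := rfl

@[simp]
theorem left_mul (m n : Multiplier B) : (m * n).left = m.left ∘ₗ n.left := rfl

@[simp]
theorem right_mul (m n : Multiplier B) : (m * n).right = n.right ∘ₗ m.right := rfl

variable (B) in
/-- The canonical homomorphism `B → M(B)`. -/
def of : B →ₙₐ[ℂ] Multiplier B where
  toFun b := mk' (LinearMap.mulLeft ℂ b) (LinearMap.mulRight ℂ b) (by simp [mul_assoc])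
  map_smul' r b := ext (LinearMap.ext fun x => smul_mul_assoc r b x)
    (LinearMap.ext fun x => mul_smul_comm r x b)
  map_zero' := ext (LinearMap.ext fun x => zero_mul x) (LinearMap.ext fun x => mul_zero x)
  map_add' b c := ext (LinearMap.ext fun x => add_mul b c x) (LinearMap.ext fun x => mul_add x b c)
  map_mul' b c := ext (LinearMap.ext fun x => mul_assoc b c x)
    (LinearMap.ext fun x => (mul_assoc x b c).symm)

theorem map_compat (m : Multiplier B) (n : Multiplier C) (x y : B ⊗[ℂ] C) :
    TensorProduct.map m.right n.right x * y = x * TensorProduct.map m.left n.left y := by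
  induction x with
  | zero => simp
  | add x₁ x₂ h₁ h₂ => simp only [map_add, add_mul, h₁, h₂]
  | tmul a c =>
    induction y with
    | zero => simp
    | add y₁ y₂ h₁ h₂ => simp only [map_add, mul_add, h₁, h₂]
    | tmul b d => simp [right_apply_mul]

variable (B C) in
/-- The bilinear map `M(B) × M(C) → M(B ⊗ C)`, `(m, n) ↦ m ⊗ n`. -/
def tmul : Multiplier B →ₗ[ℂ] Multiplier C →ₗ[ℂ] Multiplier (B ⊗[ℂ] C) :=
  LinearMap.mk₂ ℂ
    (fun m n => mk' (TensorProduct.map m.left n.left) (TensorProduct.map m.right n.right)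
      (map_compat m n))
    (fun _ _ _ => ext (TensorProduct.map_add_left _ _ _) (TensorProduct.map_add_left _ _ _))
    (fun _ _ _ => ext (TensorProduct.map_smul_left _ _ _) (TensorProduct.map_smul_left _ _ _))
    (fun _ _ _ => ext (TensorProduct.map_add_right _ _ _) (TensorProduct.map_add_right _ _ _))
    (fun _ _ _ => ext (TensorProduct.map_smul_right _ _ _) (TensorProduct.map_smul_right _ _ _))

/-- Transport of multipliers along an isomorphism of algebras. -/
def transport (e : B ≃ₗ[ℂ] C) (he : ∀ x y, e (x * y) = e x * e y) :
    Multiplier B →ₗ[ℂ] Multiplier C where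
  toFun m := mk' (e.toLinearMap ∘ₗ m.left ∘ₗ e.symm.toLinearMap)
    (e.toLinearMap ∘ₗ m.right ∘ₗ e.symm.toLinearMap) (by
      intro a b
      have h := congrArg e (m.right_apply_mul (e.symm a) (e.symm b))
      simpa [he] using h)
  map_add' m n := ext (LinearMap.ext fun x => map_add e (m.left (e.symm x)) (n.left (e.symm x)))
    (LinearMap.ext fun x => map_add e (m.right (e.symm x)) (n.right (e.symm x)))
  map_smul' r m := ext (LinearMap.ext fun x => map_smul e r (m.left (e.symm x)))
    (LinearMap.ext fun x => map_smul e r (m.right (e.symm x)))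

/-- Let `γ : B → M(C)` be a homomorphism and let `e ∈ M(C)` be an idempotent with
`γ(B) C = e C` and `C γ(B) = C e`.  Then `γ` has a unique extension to a homomorphism
`M(B) → M(C)` that sends `1` to `e`.  The proposition `IsExtensionValue e γ m y` says that this
extension sends `m` to `y`. -/
def IsExtensionValue (e : Multiplier C) (γ : B →ₗ[ℂ] Multiplier C) (m : Multiplier B)
    (y : Multiplier C) : Prop :=
  e * y = y ∧ y * e = y ∧ (∀ b : B, y * γ b = γ (m.left b)) ∧ (∀ b : B, γ b * y = γ (m.right b))

end Multiplier

theorem assoc_mul (B : Type*)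
    [NonUnitalRing B] [Module ℂ B] [IsScalarTower ℂ B B] [SMulCommClass ℂ B B]
    (x y : (B ⊗[ℂ] B) ⊗[ℂ] B) :
    TensorProduct.assoc ℂ B B B (x * y)
      = TensorProduct.assoc ℂ B B B x * TensorProduct.assoc ℂ B B B y := by
  induction x with
  | zero => simp
  | add x₁ x₂ h₁ h₂ => simp only [map_add, add_mul, h₁, h₂]
  | tmul p c =>
    induction p with
    | zero => simp
    | add p₁ p₂ h₁ h₂ => simp only [TensorProduct.add_tmul, map_add, add_mul, h₁, h₂]
    | tmul a b =>
      induction y with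
      | zero => simp
      | add y₁ y₂ h₁ h₂ => simp only [map_add, mul_add, h₁, h₂]
      | tmul q c' =>
        induction q with
        | zero => simp
        | add q₁ q₂ h₁ h₂ => simp only [TensorProduct.add_tmul, map_add, mul_add, h₁, h₂]
        | tmul a' b' => simp

end Multipliers

section Slices

variable {A : Type*} [AddCommGroup A] [Module ℂ A]

/-- The slice map `ω ⊗ ι : A ⊗ A → A`. -/
def sliceLeft (ω : A →ₗ[ℂ] ℂ) : A ⊗[ℂ] A →ₗ[ℂ] A :=
  (TensorProduct.lid ℂ A).toLinearMap ∘ₗ ω.rTensor A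

/-- The slice map `ι ⊗ ω : A ⊗ A → A`. -/
def sliceRight (ω : A →ₗ[ℂ] ℂ) : A ⊗[ℂ] A →ₗ[ℂ] A :=
  (TensorProduct.rid ℂ A).toLinearMap ∘ₗ ω.lTensor A

/-- The map `T` acting on the first and the third leg. -/
def leg13 (T : A ⊗[ℂ] A →ₗ[ℂ] A ⊗[ℂ] A) : A ⊗[ℂ] (A ⊗[ℂ] A) →ₗ[ℂ] A ⊗[ℂ] (A ⊗[ℂ] A) :=
  (TensorProduct.leftComm ℂ A A A).toLinearMap ∘ₗ T.lTensor A ∘ₗ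
    (TensorProduct.leftComm ℂ A A A).toLinearMap

/-- The map `T` acting on the first two legs. -/
def leg12 (T : A ⊗[ℂ] A →ₗ[ℂ] A ⊗[ℂ] A) : A ⊗[ℂ] (A ⊗[ℂ] A) →ₗ[ℂ] A ⊗[ℂ] (A ⊗[ℂ] A) :=
  (TensorProduct.assoc ℂ A A A).toLinearMap ∘ₗ T.rTensor A ∘ₗ
    (TensorProduct.assoc ℂ A A A).symm.toLinearMap

/-- The map `T` acting on the last two legs. -/
def leg23 (T : A ⊗[ℂ] A →ₗ[ℂ] A ⊗[ℂ] A) : A ⊗[ℂ] (A ⊗[ℂ] A) →ₗ[ℂ] A ⊗[ℂ] (A ⊗[ℂ] A) :=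
  T.lTensor A

end Slices

variable (A : Type*) [NonUnitalRing A] [Module ℂ A] [IsScalarTower ℂ A A] [SMulCommClass ℂ A A]

/-- A coproduct on `A`, i.e. a homomorphism `Δ : A → M(A ⊗ A)` such that `Δ(a)(1 ⊗ b)` and
`(c ⊗ 1)Δ(a)` lie in `A ⊗ A`, which is coassociative.  The canonical maps `T₁` and `T₂`
(determined by `Δ` when the product of `A` is non-degenerate) record these elements of `A ⊗ A`. -/
structure Coproduct where
  /-- the homomorphism `Δ` -/
  Δ : A →ₙₐ[ℂ] Multiplier (A ⊗[ℂ] A)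
  /-- `T₁ (a ⊗ b) = Δ(a)(1 ⊗ b)` -/
  T₁ : A ⊗[ℂ] A →ₗ[ℂ] A ⊗[ℂ] A
  /-- `T₂ (c ⊗ a) = (c ⊗ 1)Δ(a)` -/
  T₂ : A ⊗[ℂ] A →ₗ[ℂ] A ⊗[ℂ] A
  T₁_spec : ∀ a b : A, Multiplier.of (A ⊗[ℂ] A) (T₁ (a ⊗ₜ b))
    = Δ a * Multiplier.tmul A A 1 (Multiplier.of A b)
  T₂_spec : ∀ c a : A, Multiplier.of (A ⊗[ℂ] A) (T₂ (c ⊗ₜ a))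
    = Multiplier.tmul A A (Multiplier.of A c) 1 * Δ a
  /-- `(c ⊗ 1 ⊗ 1)(Δ ⊗ ι)(Δ(a)(1 ⊗ b)) = (ι ⊗ Δ)((c ⊗ 1)Δ(a))(1 ⊗ 1 ⊗ b)` -/
  coassoc : ∀ a b c : A, leg12 T₂ (c ⊗ₜ T₁ (a ⊗ₜ b))
    = leg23 T₁ (TensorProduct.assoc ℂ A A A (T₂ (c ⊗ₜ a) ⊗ₜ b))

variable {A}

namespace Coproduct

variable (D : Coproduct A)

/-- The coproduct is full: its legs are all of `A`. -/
def IsFull : Prop :=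
  (∀ V : Submodule ℂ A,
    (∀ a b : A, D.T₁ (a ⊗ₜ b) ∈ LinearMap.range (V.subtype.rTensor A)) → V = ⊤) ∧
  (∀ W : Submodule ℂ A,
    (∀ c a : A, D.T₂ (c ⊗ₜ a) ∈ LinearMap.range (W.subtype.lTensor A)) → W = ⊤)

/-- A counit: `(ε ⊗ ι)(Δ(a)(1 ⊗ b)) = a b` and `(ι ⊗ ε)((c ⊗ 1)Δ(a)) = c a`. -/
def IsCounit (ε : A →ₗ[ℂ] ℂ) : Prop :=
  (∀ a b : A, sliceLeft ε (D.T₁ (a ⊗ₜ b)) = a * b) ∧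
  (∀ c a : A, sliceRight ε (D.T₂ (c ⊗ₜ a)) = c * a)

/-- The map `Δ ⊗ ι : A ⊗ A → M(A ⊗ A ⊗ A)`, `p ⊗ q ↦ Δ(p) ⊗ q`. -/
def ΔI : A ⊗[ℂ] A →ₗ[ℂ] Multiplier (A ⊗[ℂ] (A ⊗[ℂ] A)) :=
  Multiplier.transport (TensorProduct.assoc ℂ A A A) (assoc_mul A) ∘ₗ
    TensorProduct.lift ((Multiplier.tmul (A ⊗[ℂ] A) A).compl₁₂
      (D.Δ : A →ₗ[ℂ] Multiplier (A ⊗[ℂ] A)) (Multiplier.of A : A →ₗ[ℂ] Multiplier A))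

/-- The map `ι ⊗ Δ : A ⊗ A → M(A ⊗ A ⊗ A)`, `p ⊗ q ↦ p ⊗ Δ(q)`. -/
def IΔ : A ⊗[ℂ] A →ₗ[ℂ] Multiplier (A ⊗[ℂ] (A ⊗[ℂ] A)) :=
  TensorProduct.lift ((Multiplier.tmul A (A ⊗[ℂ] A)).compl₁₂
    (Multiplier.of A : A →ₗ[ℂ] Multiplier A) (D.Δ : A →ₗ[ℂ] Multiplier (A ⊗[ℂ] A)))

end Coproduct

/-- For `E ∈ M(A ⊗ A)`, the multiplier `E ⊗ 1` of `A ⊗ A ⊗ A`. -/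
def tensorOne (E : Multiplier (A ⊗[ℂ] A)) : Multiplier (A ⊗[ℂ] (A ⊗[ℂ] A)) :=
  Multiplier.transport (TensorProduct.assoc ℂ A A A) (assoc_mul A)
    (Multiplier.tmul (A ⊗[ℂ] A) A E 1)

/-- For `E ∈ M(A ⊗ A)`, the multiplier `1 ⊗ E` of `A ⊗ A ⊗ A`. -/
def oneTensor (E : Multiplier (A ⊗[ℂ] A)) : Multiplier (A ⊗[ℂ] (A ⊗[ℂ] A)) :=
  Multiplier.tmul A (A ⊗[ℂ] A) 1 E

variable (A) in
/-- A weak multiplier Hopf algebra: a non-degenerate idempotent algebra `A` with a full coproduct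
`Δ` and a counit `ε`, such that the ranges and the kernels of the canonical maps `T₁` and `T₂` are
governed by an idempotent `E ∈ M(A ⊗ A)`.  The data `ε`, `E`, `G₁` and `G₂` are uniquely
determined by `Δ`. -/
structure WeakMultiplierHopfAlgebra extends Coproduct A where
  nondegenerate : Nondegenerate A
  idempotent : Idempotent A
  full : toCoproduct.IsFull
  /-- the counit -/
  ε : A →ₗ[ℂ] ℂ
  counit : toCoproduct.IsCounit ε
  /-- the canonical idempotent -/
  E : Multiplier (A ⊗[ℂ] A)
  E_idem : E * E = E
  /-- `T₁ (A ⊗ A) = E (A ⊗ A)` -/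
  range_T₁ : LinearMap.range T₁ = LinearMap.range E.left
  /-- `T₂ (A ⊗ A) = (A ⊗ A) E` -/
  range_T₂ : LinearMap.range T₂ = LinearMap.range E.right
  /-- `(E ⊗ 1)(1 ⊗ E) = (1 ⊗ E)(E ⊗ 1)` -/
  E_comm : tensorOne E * oneTensor E = oneTensor E * tensorOne E
  /-- `(Δ ⊗ ι)(E) = (E ⊗ 1)(1 ⊗ E)`, where `Δ ⊗ ι` is extended to `M(A ⊗ A)` such that
  `(Δ ⊗ ι)(1) = E ⊗ 1` -/
  ΔI_E : Multiplier.IsExtensionValue (tensorOne E) toCoproduct.ΔI E (tensorOne E * oneTensor E)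
  /-- `(ι ⊗ Δ)(E) = (E ⊗ 1)(1 ⊗ E)`, where `ι ⊗ Δ` is extended to `M(A ⊗ A)` such that
  `(ι ⊗ Δ)(1) = 1 ⊗ E` -/
  IΔ_E : Multiplier.IsExtensionValue (oneTensor E) toCoproduct.IΔ E (tensorOne E * oneTensor E)
  /-- the projection of `A ⊗ A` determining the kernel of `T₁` -/
  G₁ : A ⊗[ℂ] A →ₗ[ℂ] A ⊗[ℂ] A
  /-- the projection of `A ⊗ A` determining the kernel of `T₂` -/
  G₂ : A ⊗[ℂ] A →ₗ[ℂ] A ⊗[ℂ] A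
  /-- `(G₁ ⊗ ι)(Δ₁₃(a)(1 ⊗ b ⊗ c)) = Δ₁₃(a)(1 ⊗ E)(1 ⊗ b ⊗ c)` -/
  G₁_spec : ∀ a b c : A, leg12 G₁ (leg13 T₁ (a ⊗ₜ (b ⊗ₜ c))) = leg13 T₁ (a ⊗ₜ E.left (b ⊗ₜ c))
  /-- `(ι ⊗ G₂)((a ⊗ b ⊗ 1)Δ₁₃(c)) = (a ⊗ b ⊗ 1)(E ⊗ 1)Δ₁₃(c)` -/
  G₂_spec : ∀ a b c : A, leg23 G₂ (leg13 T₂ (a ⊗ₜ (b ⊗ₜ c)))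
    = leg13 T₂ (TensorProduct.assoc ℂ A A A (E.right (a ⊗ₜ b) ⊗ₜ c))
  /-- `Ker T₁ = (1 - G₁)(A ⊗ A)` -/
  ker_T₁ : LinearMap.ker T₁ = LinearMap.range (LinearMap.id - G₁)
  /-- `Ker T₂ = (1 - G₂)(A ⊗ A)` -/
  ker_T₂ : LinearMap.ker T₂ = LinearMap.range (LinearMap.id - G₂)

namespace WeakMultiplierHopfAlgebra

variable (H : WeakMultiplierHopfAlgebra A)

/-- `R₁` is the generalized inverse of `T₁` such that `T₁ R₁` is the projection `E` on the range
of `T₁` and `1 - R₁ T₁` is the projection `1 - G₁` on the kernel of `T₁`. -/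
def IsGeneralizedInverse₁ (R₁ : A ⊗[ℂ] A →ₗ[ℂ] A ⊗[ℂ] A) : Prop :=
  H.T₁ ∘ₗ R₁ = H.E.left ∧ R₁ ∘ₗ H.T₁ = H.G₁ ∧ R₁ ∘ₗ H.T₁ ∘ₗ R₁ = R₁

/-- `R₂` is the generalized inverse of `T₂` such that `T₂ R₂` is the projection `z ↦ z E` on the
range of `T₂` and `1 - R₂ T₂` is the projection `1 - G₂` on the kernel of `T₂`. -/
def IsGeneralizedInverse₂ (R₂ : A ⊗[ℂ] A →ₗ[ℂ] A ⊗[ℂ] A) : Prop :=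
  H.T₂ ∘ₗ R₂ = H.E.right ∧ R₂ ∘ₗ H.T₂ = H.G₂ ∧ R₂ ∘ₗ H.T₂ ∘ₗ R₂ = R₂

/-- `S : A → M(A)` is the antipode: `S(a) b = (ε ⊗ ι)(R₁(a ⊗ b))` and
`b S(a) = (ι ⊗ ε)(R₂(b ⊗ a))`, i.e. in Sweedler notation
`R₁(a ⊗ b) = ∑ a₍₁₎ ⊗ S(a₍₂₎) b` and `R₂(b ⊗ a) = ∑ b S(a₍₁₎) ⊗ a₍₂₎`. -/
def IsAntipode (S : A →ₗ[ℂ] Multiplier A) : Prop :=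
  ∃ R₁ R₂ : A ⊗[ℂ] A →ₗ[ℂ] A ⊗[ℂ] A,
    H.IsGeneralizedInverse₁ R₁ ∧ H.IsGeneralizedInverse₂ R₂ ∧
    ∀ a b : A, (S a).left b = sliceLeft H.ε (R₁ (a ⊗ₜ b)) ∧
      (S a).right b = sliceRight H.ε (R₂ (b ⊗ₜ a))

end WeakMultiplierHopfAlgebra

variable (A) in
/-- A weak multiplier Hopf algebra is regular if its antipode is a bijective map from `A` to
itself. -/
structure RegularWeakMultiplierHopfAlgebra extends WeakMultiplierHopfAlgebra A where
  /-- the antipode -/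
  S : A ≃ₗ[ℂ] A
  antipode : toWeakMultiplierHopfAlgebra.IsAntipode
    ((Multiplier.of A : A →ₗ[ℂ] Multiplier A) ∘ₗ S.toLinearMap)

namespace RegularWeakMultiplierHopfAlgebra

variable (H : RegularWeakMultiplierHopfAlgebra A)

/-- `x = ε_t(a) = ∑ a₍₁₎ S(a₍₂₎)`, where `ε_t : A → M(A)` is the target map.  The equality is made
precise by multiplying with elements `c` of `A` from the left:
`c x = ∑ (c a₍₁₎) S(a₍₂₎)`, where `∑ c a₍₁₎ ⊗ a₍₂₎ = (c ⊗ 1)Δ(a)`. -/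
def IsTargetValue (a : A) (x : Multiplier A) : Prop :=
  ∀ c : A, x.right c = LinearMap.mul' ℂ A (H.S.toLinearMap.lTensor A (H.T₂ (c ⊗ₜ a)))

/-- The image `ε_t(A)` of the target map. -/
def targetImage : Set (Multiplier A) := {x | ∃ a : A, H.IsTargetValue a x}

/-- The algebra `A_t`, i.e. the multiplier algebra of `ε_t(A)` as it sits in `M(A)`. -/
def targetMultipliers : Set (Multiplier A) :=
  {x | ∀ y ∈ H.targetImage, x * y ∈ H.targetImage ∧ y * x ∈ H.targetImage}

/-- `x = (ι ⊗ ω)Δ(a)`, i.e. `b x = (ι ⊗ ω)((b ⊗ 1)Δ(a))` and `x b = (ι ⊗ ω)(Δ(a)(b ⊗ 1))`. -/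
def IsSliceRight (ω : A →ₗ[ℂ] ℂ) (a : A) (x : Multiplier A) : Prop :=
  ∀ b : A, x.right b = sliceRight ω (H.T₂ (b ⊗ₜ a)) ∧
    ∃ z : A ⊗[ℂ] A, Multiplier.of (A ⊗[ℂ] A) z
        = H.Δ a * Multiplier.tmul A A (Multiplier.of A b) 1 ∧
      x.left b = sliceRight ω z

/-- The functional `φ` is left invariant: `(ι ⊗ φ)Δ(a) ∈ A_t` for all `a ∈ A`. -/
def IsLeftInvariant (φ : A →ₗ[ℂ] ℂ) : Prop :=
  ∀ a : A, ∃ x ∈ H.targetMultipliers, H.IsSliceRight φ a x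

/-- A left integral is a non-zero left invariant functional. -/
def IsLeftIntegral (φ : A →ₗ[ℂ] ℂ) : Prop := φ ≠ 0 ∧ H.IsLeftInvariant φ

end RegularWeakMultiplierHopfAlgebra

/-- A functional `ω` on `A` is faithful if `a = 0` whenever `ω(a b) = 0` for all `b`, and also
whenever `ω(b a) = 0` for all `b`. -/
def IsFaithful (ω : A →ₗ[ℂ] ℂ) : Prop :=
  (∀ a : A, (∀ b : A, ω (a * b) = 0) → a = 0) ∧ (∀ a : A, (∀ b : A, ω (b * a) = 0) → a = 0)

end WMHA

end

/-! Write `ψ = φ ∘ S`. The automorphism exists because the three families of functionals `φ(a ·)`,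
`ψ(k ·)` and `φ(· a')`, with `a`, `k`, `a'` running through `A`, coincide. Faithfulness then turns
the equality of the first and the last family into a bijection `σ` with `φ(a b) = φ(b σ(a))`;
uniqueness makes it linear and multiplicative, and since `A` is spanned by products, `φ ∘ σ = φ`
follows from `φ(σ(x)σ(y)) = φ(y σ(x)) = φ(x y)`.

The comparison with `ψ` rests on the strong form of left invariance, `(ι ⊗ φ)((1 ⊗ a)Δ(b)) = S((ι ⊗
φ)(Δ(a)(1 ⊗ b)))` (`sliceRight_mulLeft_T₂`). As `S` reverses products and flips the coproduct
(`S_mul_rev`, `T₁_S`, `T₂_S`), `ψ` has the mirrored property (`sliceLeft_mulRight_T₁`). Evaluating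
`ψ ⊗ φ` on `(S(p) ⊗ a)Δ(b)` and on `(p ⊗ 1)Δ(b)(1 ⊗ q)`, once through each invariance, gives `φ(a'
b) = ψ(k b)` and `φ(b a') = ψ(k b)` with explicit slices `a'` and `k` of coproducts (`apply_mul_eq`,
`mul_apply_eq`). Fullness of `Δ` and faithfulness of `φ` make each kind of slice exhaust `A`.

Strong invariance itself comes from `Δ(x) = (x ⊗ 1)E` for `x = (ι ⊗ φ)Δ(p)`, combined with `∑ S(a₁)
a₂ S(a₃) = S(a)`. Most of the work is the theory of the antipode: the formulas `R₁(a ⊗ b) = ∑ a₁ ⊗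
S(a₂)b` and `R₂(b ⊗ a) = ∑ bS(a₁) ⊗ a₂`, the source and target maps, and the two reversal properties
of `S`. Sweedler sums have no direct meaning without a unit, so every identity is covered by
multiplying one leg by an element of `A` and cancelling it afterwards by non-degeneracy. -/

open scoped TensorProduct

noncomputable section

set_option linter.unusedSectionVars false

namespace WMHA

/-- Left multiplication by an element. -/
local notation "𝓛" => LinearMap.mulLeft ℂ
/-- Right multiplication by an element. -/
local notation "𝓡" => LinearMap.mulRight ℂ

/-! ### Separating families of maps remain separating after tensoring -/

section Separation

variable {ι M N : Type*} {P : ι → Type*} [AddCommGroup M] [Module ℂ M] [AddCommGroup N] [Module ℂ N]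
  [∀ i, AddCommGroup (P i)] [∀ i, Module ℂ (P i)]

/-- In coordinates along a basis of `N` the claim reduces to the hypothesis on `M`. This is what
allows a covering factor in one leg of a tensor to be cancelled. -/
theorem eq_zero_of_rTensor (f : ∀ i, M →ₗ[ℂ] P i) (hf : ∀ m, (∀ i, f i m = 0) → m = 0)
    (z : M ⊗[ℂ] N) (hz : ∀ i, (f i).rTensor N z = 0) : z = 0 := by
  classical
  let b := Module.Basis.ofVectorSpace ℂ N
  apply (TensorProduct.equivFinsuppOfBasisRight b).injective
  rw [map_zero]
  ext j
  rw [Finsupp.zero_apply]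
  apply hf
  intro i
  have key : ∀ z : M ⊗[ℂ] N, TensorProduct.equivFinsuppOfBasisRight b ((f i).rTensor N z) j
      = f i (TensorProduct.equivFinsuppOfBasisRight b z j) := by
    intro z
    induction z with
    | zero => simp
    | add x y hx hy => simp [hx, hy]
    | tmul m n => simp
  rw [← key, hz, map_zero, Finsupp.zero_apply]

theorem eq_zero_of_lTensor (f : ∀ i, M →ₗ[ℂ] P i) (hf : ∀ m, (∀ i, f i m = 0) → m = 0)
    (z : N ⊗[ℂ] M) (hz : ∀ i, (f i).lTensor N z = 0) : z = 0 := by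
  apply (TensorProduct.comm ℂ N M).injective
  rw [map_zero]
  refine eq_zero_of_rTensor f hf _ fun i => ?_
  rw [LinearMap.rTensor_comm, hz, map_zero]

theorem eq_of_rTensor (f : ∀ i, M →ₗ[ℂ] P i) (hf : ∀ m, (∀ i, f i m = 0) → m = 0)
    {z w : M ⊗[ℂ] N} (h : ∀ i, (f i).rTensor N z = (f i).rTensor N w) : z = w :=
  sub_eq_zero.1 (eq_zero_of_rTensor f hf _ fun i => by rw [map_sub, h, sub_self])

theorem eq_of_lTensor (f : ∀ i, M →ₗ[ℂ] P i) (hf : ∀ m, (∀ i, f i m = 0) → m = 0)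
    {z w : N ⊗[ℂ] M} (h : ∀ i, (f i).lTensor N z = (f i).lTensor N w) : z = w :=
  sub_eq_zero.1 (eq_zero_of_lTensor f hf _ fun i => by rw [map_sub, h, sub_self])

theorem rTensor_lTensor_comm {M' N' : Type*} [AddCommGroup M'] [Module ℂ M'] [AddCommGroup N']
    [Module ℂ N'] (f : M →ₗ[ℂ] M') (g : N →ₗ[ℂ] N') (z : M ⊗[ℂ] N) :
    f.rTensor N' (g.lTensor M z) = g.lTensor M' (f.rTensor N z) := by
  rw [← LinearMap.comp_apply, ← LinearMap.comp_apply, LinearMap.rTensor_comp_lTensor,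
    LinearMap.lTensor_comp_rTensor]

end Separation

/-! ### Multiplication and cancellation in single legs of `A ⊗ A` -/

section OneSided

variable {A : Type*} [NonUnitalRing A] [Module ℂ A] [IsScalarTower ℂ A A] [SMulCommClass ℂ A A]

section

variable {f g : A →ₗ[ℂ] A} (x y : A ⊗[ℂ] A)

theorem lTensor_mul_left (hf : ∀ a b, f (a * b) = f a * b) :
    f.lTensor A (x * y) = f.lTensor A x * y := by
  induction x with
  | zero => simp
  | add x₁ x₂ h₁ h₂ => simp only [map_add, add_mul, h₁, h₂]
  | tmul a c =>
    induction y with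
    | zero => simp
    | add y₁ y₂ h₁ h₂ => simp only [map_add, mul_add, h₁, h₂]
    | tmul b d => simp [hf]

theorem rTensor_mul_right (hf : ∀ a b, f (a * b) = a * f b) :
    f.rTensor A (x * y) = x * f.rTensor A y := by
  induction x with
  | zero => simp
  | add x₁ x₂ h₁ h₂ => simp only [map_add, add_mul, h₁, h₂]
  | tmul a c =>
    induction y with
    | zero => simp
    | add y₁ y₂ h₁ h₂ => simp only [map_add, mul_add, h₁, h₂]
    | tmul b d => simp [hf]

theorem lTensor_mul_right (hf : ∀ a b, f (a * b) = a * f b) :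
    f.lTensor A (x * y) = x * f.lTensor A y := by
  induction x with
  | zero => simp
  | add x₁ x₂ h₁ h₂ => simp only [map_add, add_mul, h₁, h₂]
  | tmul a c =>
    induction y with
    | zero => simp
    | add y₁ y₂ h₁ h₂ => simp only [map_add, mul_add, h₁, h₂]
    | tmul b d => simp [hf]

theorem rTensor_mul_compat (h : ∀ a b, g a * b = a * f b) :
    g.rTensor A x * y = x * f.rTensor A y := by
  induction x with
  | zero => simp
  | add x₁ x₂ h₁ h₂ => simp only [map_add, add_mul, h₁, h₂]
  | tmul a c =>
    induction y with
    | zero => simp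
    | add y₁ y₂ h₁ h₂ => simp only [map_add, mul_add, h₁, h₂]
    | tmul b d => simp [h]

theorem lTensor_mul_compat (h : ∀ a b, g a * b = a * f b) :
    g.lTensor A x * y = x * f.lTensor A y := by
  induction x with
  | zero => simp
  | add x₁ x₂ h₁ h₂ => simp only [map_add, add_mul, h₁, h₂]
  | tmul a c =>
    induction y with
    | zero => simp
    | add y₁ y₂ h₁ h₂ => simp only [map_add, mul_add, h₁, h₂]
    | tmul b d => simp [h]

end

theorem tmul_mul_eq (a b : A) (y : A ⊗[ℂ] A) :
    (a ⊗ₜ b) * y = (𝓛 a).rTensor A ((𝓛 b).lTensor A y) := by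
  induction y with
  | zero => simp
  | add y₁ y₂ h₁ h₂ => simp only [map_add, mul_add, h₁, h₂]
  | tmul c d => simp

theorem mul_tmul_eq (a b : A) (y : A ⊗[ℂ] A) :
    y * (a ⊗ₜ b) = (𝓡 a).rTensor A ((𝓡 b).lTensor A y) := by
  induction y with
  | zero => simp
  | add y₁ y₂ h₁ h₂ => simp only [map_add, add_mul, h₁, h₂]
  | tmul c d => simp

namespace Nondegenerate

variable {N : Type*} [AddCommGroup N] [Module ℂ N] (hA : Nondegenerate A)
include hA

theorem eq_of_mul_right {a b : A} (h : ∀ c, a * c = b * c) : a = b :=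
  sub_eq_zero.1 (hA.1 _ fun c => by rw [sub_mul, h, sub_self])

theorem eq_of_mul_left {a b : A} (h : ∀ c, c * a = c * b) : a = b :=
  sub_eq_zero.1 (hA.2 _ fun c => by rw [mul_sub, h, sub_self])

theorem eq_of_rTensor_mulLeft {z w : A ⊗[ℂ] N}
    (h : ∀ c, (𝓛 c).rTensor N z = (𝓛 c).rTensor N w) : z = w :=
  eq_of_rTensor (fun c : A => 𝓛 c) hA.2 h

theorem eq_of_rTensor_mulRight {z w : A ⊗[ℂ] N}
    (h : ∀ c, (𝓡 c).rTensor N z = (𝓡 c).rTensor N w) : z = w :=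
  eq_of_rTensor (fun c : A => 𝓡 c) hA.1 h

theorem eq_of_lTensor_mulLeft {z w : N ⊗[ℂ] A}
    (h : ∀ c, (𝓛 c).lTensor N z = (𝓛 c).lTensor N w) : z = w :=
  eq_of_lTensor (fun c : A => 𝓛 c) hA.2 h

theorem eq_of_lTensor_mulRight {z w : N ⊗[ℂ] A}
    (h : ∀ c, (𝓡 c).lTensor N z = (𝓡 c).lTensor N w) : z = w :=
  eq_of_lTensor (fun c : A => 𝓡 c) hA.1 h

theorem tensor_eq_of_mul_right {x x' : A ⊗[ℂ] A} (h : ∀ y, x * y = x' * y) : x = x' := by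
  refine hA.eq_of_rTensor_mulRight fun a => hA.eq_of_lTensor_mulRight fun b => ?_
  rw [← rTensor_lTensor_comm, ← rTensor_lTensor_comm, ← mul_tmul_eq, ← mul_tmul_eq, h]

theorem tensor_eq_of_mul_left {x x' : A ⊗[ℂ] A} (h : ∀ y, y * x = y * x') : x = x' := by
  refine hA.eq_of_rTensor_mulLeft fun a => hA.eq_of_lTensor_mulLeft fun b => ?_
  rw [← rTensor_lTensor_comm, ← rTensor_lTensor_comm, ← tmul_mul_eq, ← tmul_mul_eq, h]

end Nondegenerate

end OneSided

/-! ### Reversal of the legs, with values in the opposite algebra -/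

section Reversal

variable (A : Type*) [AddCommGroup A] [Module ℂ A]

/-- `a ⊗ b ↦ bᵒᵖ ⊗ aᵒᵖ`. -/
def rev₂ : A ⊗[ℂ] A ≃ₗ[ℂ] Aᵐᵒᵖ ⊗[ℂ] Aᵐᵒᵖ :=
  TensorProduct.comm ℂ A A ≪≫ₗ
    TensorProduct.congr (MulOpposite.opLinearEquiv ℂ) (MulOpposite.opLinearEquiv ℂ)

/-- `a ⊗ b ⊗ c ↦ cᵒᵖ ⊗ bᵒᵖ ⊗ aᵒᵖ`. -/
def rev₃ : A ⊗[ℂ] (A ⊗[ℂ] A) ≃ₗ[ℂ] Aᵐᵒᵖ ⊗[ℂ] (Aᵐᵒᵖ ⊗[ℂ] Aᵐᵒᵖ) :=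
  TensorProduct.comm ℂ A (A ⊗[ℂ] A) ≪≫ₗ
    TensorProduct.congr (rev₂ A) (MulOpposite.opLinearEquiv ℂ) ≪≫ₗ
      TensorProduct.assoc ℂ Aᵐᵒᵖ Aᵐᵒᵖ Aᵐᵒᵖ

variable {A}

@[simp]
theorem rev₂_tmul (a b : A) : rev₂ A (a ⊗ₜ b) = MulOpposite.op b ⊗ₜ MulOpposite.op a := rfl

@[simp]
theorem rev₃_tmul (a b c : A) : rev₃ A (a ⊗ₜ (b ⊗ₜ c))
    = MulOpposite.op c ⊗ₜ (MulOpposite.op b ⊗ₜ MulOpposite.op a) := rfl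

/-- The operator on `Aᵒᵖ ⊗ Aᵒᵖ` that corresponds to `X` under the reversal of the legs. -/
def conjRev (X : A ⊗[ℂ] A →ₗ[ℂ] A ⊗[ℂ] A) : Aᵐᵒᵖ ⊗[ℂ] Aᵐᵒᵖ →ₗ[ℂ] Aᵐᵒᵖ ⊗[ℂ] Aᵐᵒᵖ :=
  (rev₂ A).toLinearMap ∘ₗ X ∘ₗ (rev₂ A).symm.toLinearMap

theorem conjRev_apply (X : A ⊗[ℂ] A →ₗ[ℂ] A ⊗[ℂ] A) (z : Aᵐᵒᵖ ⊗[ℂ] Aᵐᵒᵖ) :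
    conjRev X z = rev₂ A (X ((rev₂ A).symm z)) := rfl

@[simp]
theorem conjRev_rev₂ (X : A ⊗[ℂ] A →ₗ[ℂ] A ⊗[ℂ] A) (z : A ⊗[ℂ] A) :
    conjRev X (rev₂ A z) = rev₂ A (X z) := by
  simp [conjRev_apply]

theorem conjRev_tmul (X : A ⊗[ℂ] A →ₗ[ℂ] A ⊗[ℂ] A) (a b : Aᵐᵒᵖ) :
    conjRev X (a ⊗ₜ b) = rev₂ A (X (b.unop ⊗ₜ a.unop)) := rfl

@[simp]
theorem leg12_tmul (X : A ⊗[ℂ] A →ₗ[ℂ] A ⊗[ℂ] A) (a b c : A) :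
    leg12 X (a ⊗ₜ (b ⊗ₜ c)) = TensorProduct.assoc ℂ A A A (X (a ⊗ₜ b) ⊗ₜ c) := rfl

@[simp]
theorem leg23_tmul (X : A ⊗[ℂ] A →ₗ[ℂ] A ⊗[ℂ] A) (a : A) (z : A ⊗[ℂ] A) :
    leg23 X (a ⊗ₜ z) = a ⊗ₜ X z := rfl

@[simp]
theorem leg13_tmul (X : A ⊗[ℂ] A →ₗ[ℂ] A ⊗[ℂ] A) (a b c : A) :
    leg13 X (a ⊗ₜ (b ⊗ₜ c)) = TensorProduct.leftComm ℂ A A A (b ⊗ₜ X (a ⊗ₜ c)) := rfl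

theorem triple_ext {P : Type*} [AddCommGroup P] [Module ℂ P] {f g : A ⊗[ℂ] (A ⊗[ℂ] A) →ₗ[ℂ] P}
    (h : ∀ a b c : A, f (a ⊗ₜ (b ⊗ₜ c)) = g (a ⊗ₜ (b ⊗ₜ c))) : f = g :=
  TensorProduct.ext_threefold' h

theorem leg12_conjRev (X : A ⊗[ℂ] A →ₗ[ℂ] A ⊗[ℂ] A) (w : A ⊗[ℂ] (A ⊗[ℂ] A)) :
    leg12 (conjRev X) (rev₃ A w) = rev₃ A (leg23 X w) := by
  revert w
  refine LinearMap.congr_fun (f := leg12 (conjRev X) ∘ₗ (rev₃ A).toLinearMap)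
    (g := (rev₃ A).toLinearMap ∘ₗ leg23 X) (triple_ext fun a b c => ?_)
  simp only [LinearMap.comp_apply, LinearEquiv.coe_coe, rev₃_tmul, leg12_tmul, leg23_tmul,
    conjRev_tmul, MulOpposite.unop_op]
  generalize X (b ⊗ₜ c) = z
  induction z with
  | zero => simp
  | add x y hx hy => simp only [map_add, TensorProduct.add_tmul, TensorProduct.tmul_add, hx, hy]
  | tmul p q => simp

theorem leg23_conjRev (X : A ⊗[ℂ] A →ₗ[ℂ] A ⊗[ℂ] A) (w : A ⊗[ℂ] (A ⊗[ℂ] A)) :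
    leg23 (conjRev X) (rev₃ A w) = rev₃ A (leg12 X w) := by
  revert w
  refine LinearMap.congr_fun (f := leg23 (conjRev X) ∘ₗ (rev₃ A).toLinearMap)
    (g := (rev₃ A).toLinearMap ∘ₗ leg12 X) (triple_ext fun a b c => ?_)
  simp only [LinearMap.comp_apply, LinearEquiv.coe_coe, rev₃_tmul, leg12_tmul, leg23_tmul,
    conjRev_tmul, MulOpposite.unop_op]
  generalize X (a ⊗ₜ b) = z
  induction z with
  | zero => simp
  | add x y hx hy => simp only [map_add, TensorProduct.add_tmul, TensorProduct.tmul_add, hx, hy]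
  | tmul p q => simp

theorem leg13_conjRev (X : A ⊗[ℂ] A →ₗ[ℂ] A ⊗[ℂ] A) (w : A ⊗[ℂ] (A ⊗[ℂ] A)) :
    leg13 (conjRev X) (rev₃ A w) = rev₃ A (leg13 X w) := by
  revert w
  refine LinearMap.congr_fun (f := leg13 (conjRev X) ∘ₗ (rev₃ A).toLinearMap)
    (g := (rev₃ A).toLinearMap ∘ₗ leg13 X) (triple_ext fun a b c => ?_)
  simp only [LinearMap.comp_apply, LinearEquiv.coe_coe, rev₃_tmul, leg13_tmul,
    conjRev_tmul, MulOpposite.unop_op]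
  generalize X (a ⊗ₜ c) = z
  induction z with
  | zero => simp
  | add x y hx hy => simp only [map_add, TensorProduct.tmul_add, hx, hy]
  | tmul p q => simp

theorem rev₂_rTensor (f : A →ₗ[ℂ] A) (z : A ⊗[ℂ] A) : rev₂ A (f.rTensor A z)
    = ((MulOpposite.opLinearEquiv ℂ).conj f).lTensor Aᵐᵒᵖ (rev₂ A z) := by
  induction z with
  | zero => simp
  | add x y hx hy => simp only [map_add, hx, hy]
  | tmul p q => simp [LinearEquiv.conj_apply]

theorem rev₂_lTensor (f : A →ₗ[ℂ] A) (z : A ⊗[ℂ] A) : rev₂ A (f.lTensor A z)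
    = ((MulOpposite.opLinearEquiv ℂ).conj f).rTensor Aᵐᵒᵖ (rev₂ A z) := by
  induction z with
  | zero => simp
  | add x y hx hy => simp only [map_add, hx, hy]
  | tmul p q => simp [LinearEquiv.conj_apply]

/-- The functional on `Aᵒᵖ` that corresponds to `ω`. -/
def opFunctional (ω : A →ₗ[ℂ] ℂ) : Aᵐᵒᵖ →ₗ[ℂ] ℂ :=
  ω ∘ₗ (MulOpposite.opLinearEquiv ℂ).symm.toLinearMap

@[simp]
theorem opFunctional_apply (ω : A →ₗ[ℂ] ℂ) (a : Aᵐᵒᵖ) : opFunctional ω a = ω a.unop := rfl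

@[simp]
theorem sliceLeft_tmul (ω : A →ₗ[ℂ] ℂ) (a b : A) : sliceLeft ω (a ⊗ₜ b) = ω a • b := by
  simp [sliceLeft]

@[simp]
theorem sliceRight_tmul (ω : A →ₗ[ℂ] ℂ) (a b : A) : sliceRight ω (a ⊗ₜ b) = ω b • a := by
  simp [sliceRight]

theorem sliceLeft_rev₂ (ω : A →ₗ[ℂ] ℂ) (z : A ⊗[ℂ] A) :
    sliceLeft (opFunctional ω) (rev₂ A z) = MulOpposite.op (sliceRight ω z) := by
  induction z with
  | zero => simp
  | add x y hx hy => simp only [map_add, hx, hy, MulOpposite.op_add]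
  | tmul p q => simp

theorem sliceRight_rev₂ (ω : A →ₗ[ℂ] ℂ) (z : A ⊗[ℂ] A) :
    sliceRight (opFunctional ω) (rev₂ A z) = MulOpposite.op (sliceLeft ω z) := by
  induction z with
  | zero => simp
  | add x y hx hy => simp only [map_add, hx, hy, MulOpposite.op_add]
  | tmul p q => simp

end Reversal

section ReversalMul

variable {A : Type*} [NonUnitalRing A] [Module ℂ A] [IsScalarTower ℂ A A] [SMulCommClass ℂ A A]

theorem rev₂_mul (x y : A ⊗[ℂ] A) : rev₂ A (x * y) = rev₂ A y * rev₂ A x := by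
  induction x with
  | zero => simp
  | add x₁ x₂ h₁ h₂ => simp only [map_add, add_mul, mul_add, h₁, h₂]
  | tmul a c =>
    induction y with
    | zero => simp
    | add y₁ y₂ h₁ h₂ => simp only [map_add, mul_add, add_mul, h₁, h₂]
    | tmul b d => simp

theorem conj_mulLeft (a : A) :
    (MulOpposite.opLinearEquiv ℂ).conj (𝓛 a) = 𝓡 (MulOpposite.op a) := by
  ext x
  simp [LinearEquiv.conj_apply]

theorem conj_mulRight (a : A) :
    (MulOpposite.opLinearEquiv ℂ).conj (𝓡 a) = 𝓛 (MulOpposite.op a) := by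
  ext x
  simp [LinearEquiv.conj_apply]

end ReversalMul

/-! ### The canonical maps as operators, and their mirror symmetry -/

/-- The canonical maps of a regular weak multiplier Hopf algebra, as linear maps on `A ⊗ A`,
together with the relations between them.  The fields come in pairs which are exchanged by passing
to the opposite algebra and reversing the legs of the tensor products. -/
structure CanonicalMaps (A : Type*) [NonUnitalRing A] [Module ℂ A] [IsScalarTower ℂ A A]
    [SMulCommClass ℂ A A] where
  (T₁ T₂ EL ER G₁ G₂ R₁ R₂ : A ⊗[ℂ] A →ₗ[ℂ] A ⊗[ℂ] A)
  /-- left multiplication by `Δ(a)` -/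
  DL : A →ₗ[ℂ] A ⊗[ℂ] A →ₗ[ℂ] A ⊗[ℂ] A
  /-- right multiplication by `Δ(a)` -/
  DR : A →ₗ[ℂ] A ⊗[ℂ] A →ₗ[ℂ] A ⊗[ℂ] A
  ε : A →ₗ[ℂ] ℂ
  S : A ≃ₗ[ℂ] A
  nondeg : Nondegenerate A
  idem : Idempotent A
  coassoc : ∀ w, leg12 T₂ (leg23 T₁ w) = leg23 T₁ (leg12 T₂ w)
  -- Fullness in dual form: a proper subspace lies in the kernel of a non-zero functional.
  full₁ : ∀ h : A →ₗ[ℂ] ℂ, (∀ z, h.rTensor A (T₁ z) = 0) → h = 0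
  full₂ : ∀ h : A →ₗ[ℂ] ℂ, (∀ z, h.lTensor A (T₂ z) = 0) → h = 0
  counit₁ : ∀ a b, sliceLeft ε (T₁ (a ⊗ₜ b)) = a * b
  counit₂ : ∀ a b, sliceRight ε (T₂ (a ⊗ₜ b)) = a * b
  T₁_mul : ∀ a b y, T₁ (a ⊗ₜ b) * y = DL a ((𝓛 b).lTensor A y)
  mul_T₂ : ∀ a b y, y * T₂ (b ⊗ₜ a) = DR a ((𝓡 b).rTensor A y)
  mul_T₁ : ∀ a b y, y * T₁ (a ⊗ₜ b) = (𝓡 b).lTensor A (DR a y)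
  T₂_mul : ∀ a b y, T₂ (b ⊗ₜ a) * y = (𝓛 b).rTensor A (DL a y)
  DL_mul : ∀ a b z, DL (a * b) z = DL a (DL b z)
  DR_mul : ∀ a b z, DR (a * b) z = DR b (DR a z)
  DR_mul_eq : ∀ a x y, DR a x * y = x * DL a y
  ER_mul_eq : ∀ x y, ER x * y = x * EL y
  EL_EL : ∀ z, EL (EL z) = EL z
  ER_ER : ∀ z, ER (ER z) = ER z
  EL_T₁ : ∀ z, EL (T₁ z) = T₁ z
  ER_T₂ : ∀ z, ER (T₂ z) = T₂ z
  EL_comm : ∀ w, leg12 EL (leg23 EL w) = leg23 EL (leg12 EL w)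
  ER_comm : ∀ w, leg12 ER (leg23 ER w) = leg23 ER (leg12 ER w)
  -- This and the next three fields carry the axiom on `(Δ ⊗ ι)(E)` and `(ι ⊗ Δ)(E)`: multiplying by
  -- `E` before or after a coproduct amounts to the same, on either side.
  EL_leg_T₂ : ∀ w, leg23 EL (leg12 T₂ w) = leg12 T₂ (leg23 EL w)
  ER_leg_T₁ : ∀ w, leg12 ER (leg23 T₁ w) = leg23 T₁ (leg12 ER w)
  EL_leg_T₁ : ∀ w, leg12 EL (leg23 T₁ w) = leg23 T₁ (leg12 EL w)
  ER_leg_T₂ : ∀ w, leg23 ER (leg12 T₂ w) = leg12 T₂ (leg23 ER w)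
  G₁_spec : ∀ w, leg12 G₁ (leg13 T₁ w) = leg13 T₁ (leg23 EL w)
  G₂_spec : ∀ w, leg23 G₂ (leg13 T₂ w) = leg13 T₂ (leg12 ER w)
  T₁_R₁ : ∀ z, T₁ (R₁ z) = EL z
  T₂_R₂ : ∀ z, T₂ (R₂ z) = ER z
  R₁_T₁ : ∀ z, R₁ (T₁ z) = G₁ z
  R₂_T₂ : ∀ z, R₂ (T₂ z) = G₂ z
  R₁_T₁_R₁ : ∀ z, R₁ (T₁ (R₁ z)) = R₁ z
  R₂_T₂_R₂ : ∀ z, R₂ (T₂ (R₂ z)) = R₂ z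
  S_mul : ∀ a b, S a * b = sliceLeft ε (R₁ (a ⊗ₜ b))
  mul_S : ∀ a b, b * S a = sliceRight ε (R₂ (b ⊗ₜ a))

variable {A : Type*} [NonUnitalRing A] [Module ℂ A] [IsScalarTower ℂ A A] [SMulCommClass ℂ A A]

theorem Idempotent.op (hA : Idempotent A) : Idempotent Aᵐᵒᵖ := by
  have h := congrArg (Submodule.map (MulOpposite.opLinearEquiv ℂ : A ≃ₗ[ℂ] Aᵐᵒᵖ).toLinearMap) hA
  rw [Submodule.map_span, Submodule.map_top, LinearEquiv.range] at h
  rw [Idempotent, ← h]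
  congr 1
  ext x
  constructor
  · rintro ⟨a, b, rfl⟩
    exact ⟨b.unop * a.unop, ⟨_, _, rfl⟩, rfl⟩
  · rintro ⟨_, ⟨a, b, rfl⟩, rfl⟩
    exact ⟨MulOpposite.op b, MulOpposite.op a, rfl⟩

theorem Nondegenerate.op (hA : Nondegenerate A) : Nondegenerate Aᵐᵒᵖ := by
  constructor
  · intro a h
    exact MulOpposite.unop_injective
      (hA.2 a.unop fun b => congrArg MulOpposite.unop (h (MulOpposite.op b)))
  · intro a h
    exact MulOpposite.unop_injective
      (hA.1 a.unop fun b => congrArg MulOpposite.unop (h (MulOpposite.op b)))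

theorem lTensor_of_rev₂ (h : Aᵐᵒᵖ →ₗ[ℂ] ℂ) (z : A ⊗[ℂ] A)
    (hz : h.rTensor Aᵐᵒᵖ (rev₂ A z) = 0) :
    (h ∘ₗ (MulOpposite.opLinearEquiv ℂ).toLinearMap).lTensor A z = 0 := by
  have key : ∀ z : A ⊗[ℂ] A, h.rTensor Aᵐᵒᵖ (rev₂ A z)
      = TensorProduct.congr (LinearEquiv.refl ℂ ℂ) (MulOpposite.opLinearEquiv ℂ)
        (TensorProduct.comm ℂ A ℂ
        ((h ∘ₗ (MulOpposite.opLinearEquiv ℂ).toLinearMap).lTensor A z)) := by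
    intro z
    induction z with
    | zero => simp
    | add x y hx hy => simp only [map_add, hx, hy]
    | tmul p q => simp
  rw [key] at hz
  simpa using hz

theorem rTensor_of_rev₂ (h : Aᵐᵒᵖ →ₗ[ℂ] ℂ) (z : A ⊗[ℂ] A)
    (hz : h.lTensor Aᵐᵒᵖ (rev₂ A z) = 0) :
    (h ∘ₗ (MulOpposite.opLinearEquiv ℂ).toLinearMap).rTensor A z = 0 := by
  have key : ∀ z : A ⊗[ℂ] A, h.lTensor Aᵐᵒᵖ (rev₂ A z)
      = TensorProduct.congr (MulOpposite.opLinearEquiv ℂ) (LinearEquiv.refl ℂ ℂ)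
        (TensorProduct.comm ℂ ℂ A
        ((h ∘ₗ (MulOpposite.opLinearEquiv ℂ).toLinearMap).rTensor A z)) := by
    intro z
    induction z with
    | zero => simp
    | add x y hx hy => simp only [map_add, hx, hy]
    | tmul p q => simp
  rw [key] at hz
  simpa using hz

theorem comp_op_eq_zero (h : Aᵐᵒᵖ →ₗ[ℂ] ℂ)
    (h0 : h ∘ₗ (MulOpposite.opLinearEquiv ℂ : A ≃ₗ[ℂ] Aᵐᵒᵖ).toLinearMap = 0) : h = 0 :=
  LinearMap.ext fun x => LinearMap.congr_fun h0 x.unop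

/-- `conjRev` as a linear map. -/
def conjRevHom : (A ⊗[ℂ] A →ₗ[ℂ] A ⊗[ℂ] A) →ₗ[ℂ]
    (Aᵐᵒᵖ ⊗[ℂ] Aᵐᵒᵖ →ₗ[ℂ] Aᵐᵒᵖ ⊗[ℂ] Aᵐᵒᵖ) :=
  ((rev₂ A).conj).toLinearMap

theorem conjRevHom_rev₂ (X : A ⊗[ℂ] A →ₗ[ℂ] A ⊗[ℂ] A) (z : A ⊗[ℂ] A) :
    conjRevHom X (rev₂ A z) = rev₂ A (X z) :=
  conjRev_rev₂ X z

theorem forall_rev₂ {p : Aᵐᵒᵖ ⊗[ℂ] Aᵐᵒᵖ → Prop} (h : ∀ z, p (rev₂ A z)) (z) : p z := by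
  simpa using h ((rev₂ A).symm z)

theorem forall_rev₃ {p : Aᵐᵒᵖ ⊗[ℂ] (Aᵐᵒᵖ ⊗[ℂ] Aᵐᵒᵖ) → Prop} (h : ∀ z, p (rev₃ A z)) (z) :
    p z := by
  simpa using h ((rev₃ A).symm z)

theorem forall_op {p : Aᵐᵒᵖ → Prop} (h : ∀ a : A, p (MulOpposite.op a)) (a) : p a := h a.unop

namespace CanonicalMaps

/-- The canonical maps of the opposite algebra with the opposite coproduct. -/
def op (H : CanonicalMaps A) : CanonicalMaps Aᵐᵒᵖ where
  T₁ := conjRev H.T₂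
  T₂ := conjRev H.T₁
  EL := conjRev H.ER
  ER := conjRev H.EL
  G₁ := conjRev H.G₂
  G₂ := conjRev H.G₁
  R₁ := conjRev H.R₂
  R₂ := conjRev H.R₁
  DL := conjRevHom ∘ₗ H.DR ∘ₗ (MulOpposite.opLinearEquiv ℂ).symm.toLinearMap
  DR := conjRevHom ∘ₗ H.DL ∘ₗ (MulOpposite.opLinearEquiv ℂ).symm.toLinearMap
  ε := opFunctional H.ε
  S := (MulOpposite.opLinearEquiv ℂ).symm ≪≫ₗ H.S ≪≫ₗ MulOpposite.opLinearEquiv ℂ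
  nondeg := H.nondeg.op
  idem := H.idem.op
  coassoc := forall_rev₃ fun w => by
    rw [leg23_conjRev, leg12_conjRev, leg12_conjRev, leg23_conjRev, H.coassoc]
  full₁ h hz := comp_op_eq_zero _ <| H.full₂ _ fun z =>
    lTensor_of_rev₂ h _ (by rw [← conjRev_rev₂]; exact hz _)
  full₂ h hz := comp_op_eq_zero _ <| H.full₁ _ fun z =>
    rTensor_of_rev₂ h _ (by rw [← conjRev_rev₂]; exact hz _)
  counit₁ a b := by rw [conjRev_tmul, sliceLeft_rev₂, H.counit₂]; rfl
  counit₂ a b := by rw [conjRev_tmul, sliceRight_rev₂, H.counit₁]; rfl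
  T₁_mul := forall_op fun a => forall_op fun b => forall_rev₂ fun y => by
    rw [conjRev_tmul, ← rev₂_mul, ← conj_mulRight, ← rev₂_rTensor]
    simp only [LinearMap.comp_apply, conjRevHom_rev₂, MulOpposite.unop_op, H.mul_T₂]
    rfl
  mul_T₂ := forall_op fun a => forall_op fun b => forall_rev₂ fun y => by
    rw [conjRev_tmul, ← rev₂_mul, ← conj_mulLeft, ← rev₂_lTensor]
    simp only [LinearMap.comp_apply, conjRevHom_rev₂, MulOpposite.unop_op, H.T₁_mul]
    rfl
  mul_T₁ := forall_op fun a => forall_op fun b => forall_rev₂ fun y => by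
    simp only [LinearMap.comp_apply, conjRevHom_rev₂]
    rw [conjRev_tmul, ← rev₂_mul, ← conj_mulLeft, ← rev₂_rTensor]
    simp only [MulOpposite.unop_op, H.T₂_mul]
    rfl
  T₂_mul := forall_op fun a => forall_op fun b => forall_rev₂ fun y => by
    simp only [LinearMap.comp_apply, conjRevHom_rev₂]
    rw [conjRev_tmul, ← rev₂_mul, ← conj_mulRight, ← rev₂_lTensor]
    simp only [MulOpposite.unop_op, H.mul_T₁]
    rfl
  DL_mul := forall_op fun a => forall_op fun b => forall_rev₂ fun y => by
    simp only [LinearMap.comp_apply, conjRevHom_rev₂]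
    exact congrArg _ (H.DR_mul b a y)
  DR_mul := forall_op fun a => forall_op fun b => forall_rev₂ fun y => by
    simp only [LinearMap.comp_apply, conjRevHom_rev₂]
    exact congrArg _ (H.DL_mul b a y)
  DR_mul_eq := forall_op fun a => forall_rev₂ fun x => forall_rev₂ fun y => by
    simp only [LinearMap.comp_apply, conjRevHom_rev₂, ← rev₂_mul]
    exact congrArg _ (H.DR_mul_eq a y x).symm
  ER_mul_eq := forall_rev₂ fun x => forall_rev₂ fun y => by
    rw [conjRev_rev₂, conjRev_rev₂, ← rev₂_mul, ← rev₂_mul, H.ER_mul_eq]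
  EL_EL := forall_rev₂ fun z => by simp only [conjRev_rev₂, H.ER_ER]
  ER_ER := forall_rev₂ fun z => by simp only [conjRev_rev₂, H.EL_EL]
  EL_T₁ := forall_rev₂ fun z => by simp only [conjRev_rev₂, H.ER_T₂]
  ER_T₂ := forall_rev₂ fun z => by simp only [conjRev_rev₂, H.EL_T₁]
  EL_comm := forall_rev₃ fun w => by simp only [leg12_conjRev, leg23_conjRev, H.ER_comm]
  ER_comm := forall_rev₃ fun w => by simp only [leg12_conjRev, leg23_conjRev, H.EL_comm]
  EL_leg_T₂ := forall_rev₃ fun w => by simp only [leg12_conjRev, leg23_conjRev, H.ER_leg_T₁]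
  ER_leg_T₁ := forall_rev₃ fun w => by simp only [leg12_conjRev, leg23_conjRev, H.EL_leg_T₂]
  EL_leg_T₁ := forall_rev₃ fun w => by simp only [leg12_conjRev, leg23_conjRev, H.ER_leg_T₂]
  ER_leg_T₂ := forall_rev₃ fun w => by simp only [leg12_conjRev, leg23_conjRev, H.EL_leg_T₁]
  G₁_spec := forall_rev₃ fun w => by
    simp only [leg12_conjRev, leg23_conjRev, leg13_conjRev, H.G₂_spec]
  G₂_spec := forall_rev₃ fun w => by
    simp only [leg12_conjRev, leg23_conjRev, leg13_conjRev, H.G₁_spec]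
  T₁_R₁ := forall_rev₂ fun z => by simp only [conjRev_rev₂, H.T₂_R₂]
  T₂_R₂ := forall_rev₂ fun z => by simp only [conjRev_rev₂, H.T₁_R₁]
  R₁_T₁ := forall_rev₂ fun z => by simp only [conjRev_rev₂, H.R₂_T₂]
  R₂_T₂ := forall_rev₂ fun z => by simp only [conjRev_rev₂, H.R₁_T₁]
  R₁_T₁_R₁ := forall_rev₂ fun z => by simp only [conjRev_rev₂, H.R₂_T₂_R₂]
  R₂_T₂_R₂ := forall_rev₂ fun z => by simp only [conjRev_rev₂, H.R₁_T₁_R₁]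
  S_mul := forall_op fun a => forall_op fun b => by
    rw [conjRev_tmul, sliceLeft_rev₂, MulOpposite.unop_op, MulOpposite.unop_op, ← H.mul_S]
    rfl
  mul_S := forall_op fun a => forall_op fun b => by
    rw [conjRev_tmul, sliceRight_rev₂, MulOpposite.unop_op, MulOpposite.unop_op, ← H.S_mul]
    rfl

end CanonicalMaps

/-- To prove an identity between linear maps on `A ⊗ A`, evaluate on pure tensors. -/
theorem tensor_induction {M N P : Type*} [AddCommGroup M] [Module ℂ M] [AddCommGroup N]
    [Module ℂ N] [AddCommGroup P] [Module ℂ P] {f g : M ⊗[ℂ] N →ₗ[ℂ] P}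
    (h : ∀ a b, f (a ⊗ₜ b) = g (a ⊗ₜ b)) (z : M ⊗[ℂ] N) : f z = g z :=
  LinearMap.congr_fun (TensorProduct.ext' h) z

section OneSidedCompat

variable (c : A) (x y : A ⊗[ℂ] A)

theorem rTensor_mulRight_mul : (𝓡 c).rTensor A x * y = x * (𝓛 c).rTensor A y :=
  rTensor_mul_compat x y fun a b => mul_assoc a c b

theorem lTensor_mulRight_mul : (𝓡 c).lTensor A x * y = x * (𝓛 c).lTensor A y :=
  lTensor_mul_compat x y fun a b => mul_assoc a c b

end OneSidedCompat

section RightLinear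

variable (hA : Nondegenerate A) {X : A ⊗[ℂ] A →ₗ[ℂ] A ⊗[ℂ] A}
include hA

theorem rTensor_mulRight_of_mul (hX : ∀ x y, X (x * y) = X x * y) (c : A) (z : A ⊗[ℂ] A) :
    X ((𝓡 c).rTensor A z) = (𝓡 c).rTensor A (X z) := by
  refine hA.tensor_eq_of_mul_right fun y => ?_
  rw [← hX, rTensor_mulRight_mul, rTensor_mulRight_mul, hX]

theorem lTensor_mulRight_of_mul (hX : ∀ x y, X (x * y) = X x * y) (c : A) (z : A ⊗[ℂ] A) :
    X ((𝓡 c).lTensor A z) = (𝓡 c).lTensor A (X z) := by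
  refine hA.tensor_eq_of_mul_right fun y => ?_
  rw [← hX, lTensor_mulRight_mul, lTensor_mulRight_mul, hX]

end RightLinear

/-! ### Linearity of the canonical maps over one leg -/

namespace CanonicalMaps

variable (H : CanonicalMaps A)

theorem DL_tensor_mul (a : A) (x y : A ⊗[ℂ] A) : H.DL a (x * y) = H.DL a x * y := by
  refine H.nondeg.tensor_eq_of_mul_left fun w => ?_
  rw [← H.DR_mul_eq, ← mul_assoc, ← mul_assoc, H.DR_mul_eq]

theorem DR_tensor_mul (a : A) (x y : A ⊗[ℂ] A) : H.DR a (x * y) = x * H.DR a y := by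
  refine H.nondeg.tensor_eq_of_mul_right fun w => ?_
  rw [H.DR_mul_eq, mul_assoc, mul_assoc, H.DR_mul_eq]

theorem EL_mul (x y : A ⊗[ℂ] A) : H.EL (x * y) = H.EL x * y := by
  refine H.nondeg.tensor_eq_of_mul_left fun w => ?_
  rw [← H.ER_mul_eq, ← mul_assoc, ← mul_assoc, H.ER_mul_eq]

theorem EL_mulRight₁ (c : A) (z : A ⊗[ℂ] A) :
    H.EL ((𝓡 c).rTensor A z) = (𝓡 c).rTensor A (H.EL z) :=
  rTensor_mulRight_of_mul H.nondeg H.EL_mul c z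

theorem EL_mulRight₂ (c : A) (z : A ⊗[ℂ] A) :
    H.EL ((𝓡 c).lTensor A z) = (𝓡 c).lTensor A (H.EL z) :=
  lTensor_mulRight_of_mul H.nondeg H.EL_mul c z

theorem DL_mulRight₁ (a c : A) (z : A ⊗[ℂ] A) :
    H.DL a ((𝓡 c).rTensor A z) = (𝓡 c).rTensor A (H.DL a z) :=
  rTensor_mulRight_of_mul H.nondeg (H.DL_tensor_mul a) c z

theorem mulRight_T₁ (a b c : A) : (𝓡 c).rTensor A (H.T₁ (a ⊗ₜ b)) = H.DL a (c ⊗ₜ b) := by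
  refine H.nondeg.tensor_eq_of_mul_right fun y => ?_
  rw [rTensor_mulRight_mul, H.T₁_mul, ← H.DL_tensor_mul,
    tmul_mul_eq, rTensor_lTensor_comm]

theorem mulLeft_T₂ (a b c : A) : (𝓛 c).lTensor A (H.T₂ (b ⊗ₜ a)) = H.DR a (b ⊗ₜ c) := by
  refine H.nondeg.tensor_eq_of_mul_left fun y => ?_
  rw [← lTensor_mulRight_mul, H.mul_T₂, ← H.DR_tensor_mul,
    mul_tmul_eq]

theorem mulLeft_T₁ (a b c : A) :
    (𝓛 c).rTensor A (H.T₁ (a ⊗ₜ b)) = (𝓡 b).lTensor A (H.T₂ (c ⊗ₜ a)) := by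
  refine H.nondeg.tensor_eq_of_mul_left fun y => ?_
  rw [← rTensor_mulRight_mul, H.mul_T₁,
    ← lTensor_mul_right _ _ fun a c => mul_assoc a c b, H.mul_T₂]

/-- After covering the first leg by `b`, the factor `Δ(a)` becomes an element of the range of `T₂`,
on which right multiplication by `E` is the identity. -/
theorem DL_EL (a : A) (z : A ⊗[ℂ] A) : H.DL a (H.EL z) = H.DL a z := by
  refine H.nondeg.eq_of_rTensor_mulLeft fun b => ?_
  rw [← H.T₂_mul, ← H.T₂_mul, ← H.ER_mul_eq, H.ER_T₂]

theorem EL_DL (a : A) (z : A ⊗[ℂ] A) : H.EL (H.DL a z) = H.DL a z := by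
  refine tensor_induction (f := H.EL ∘ₗ H.DL a) (fun c b => ?_) z
  rw [LinearMap.comp_apply, ← H.mulRight_T₁, H.EL_mulRight₁, H.EL_T₁]

theorem DR_ER (a : A) (z : A ⊗[ℂ] A) : H.DR a (H.ER z) = H.DR a z := by
  refine H.nondeg.tensor_eq_of_mul_right fun y => ?_
  rw [H.DR_mul_eq, H.DR_mul_eq, H.ER_mul_eq, H.EL_DL]

theorem DL_T₁ (a : A) (z : A ⊗[ℂ] A) : H.DL a (H.T₁ z) = H.T₁ ((𝓛 a).rTensor A z) := by
  refine tensor_induction (f := H.DL a ∘ₗ H.T₁) (g := H.T₁ ∘ₗ (𝓛 a).rTensor A) (fun q r => ?_) z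
  refine H.nondeg.tensor_eq_of_mul_right fun y => ?_
  simp only [LinearMap.comp_apply, LinearMap.rTensor_tmul, LinearMap.mulLeft_apply]
  rw [← H.DL_tensor_mul, H.T₁_mul, H.T₁_mul, H.DL_mul]

theorem DR_T₂ (a : A) (z : A ⊗[ℂ] A) : H.DR a (H.T₂ z) = H.T₂ ((𝓡 a).lTensor A z) := by
  refine tensor_induction (f := H.DR a ∘ₗ H.T₂) (g := H.T₂ ∘ₗ (𝓡 a).lTensor A) (fun q r => ?_) z
  refine H.nondeg.tensor_eq_of_mul_left fun y => ?_
  simp only [LinearMap.comp_apply, LinearMap.lTensor_tmul, LinearMap.mulRight_apply]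
  rw [← H.DR_tensor_mul, H.mul_T₂, H.mul_T₂, H.DR_mul]

theorem T₁_mulRight (c : A) (z : A ⊗[ℂ] A) :
    H.T₁ ((𝓡 c).lTensor A z) = (𝓡 c).lTensor A (H.T₁ z) := by
  refine tensor_induction (f := H.T₁ ∘ₗ (𝓡 c).lTensor A) (g := (𝓡 c).lTensor A ∘ₗ H.T₁)
    (fun q r => ?_) z
  refine H.nondeg.tensor_eq_of_mul_right fun y => ?_
  simp only [LinearMap.comp_apply, LinearMap.lTensor_tmul, LinearMap.mulRight_apply]
  rw [lTensor_mulRight_mul, H.T₁_mul, H.T₁_mul,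
    LinearMap.mulLeft_mul, LinearMap.lTensor_comp_apply]

theorem R₁_EL (z : A ⊗[ℂ] A) : H.R₁ (H.EL z) = H.R₁ z := by rw [← H.T₁_R₁, H.R₁_T₁_R₁]

theorem G₁_R₁ (z : A ⊗[ℂ] A) : H.G₁ (H.R₁ z) = H.R₁ z := by rw [← H.R₁_T₁, H.R₁_T₁_R₁]

/-! ### Left colinear maps -/

/-- `a ↦ (ι ⊗ ι ⊗ ω)(Δ₁₃(a)(1 ⊗ z))`. -/
def slice13 (ω : A →ₗ[ℂ] ℂ) (z : A ⊗[ℂ] A) : A →ₗ[ℂ] A ⊗[ℂ] A :=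
  (sliceRight ω).lTensor A ∘ₗ leg13 H.T₁ ∘ₗ (TensorProduct.mk ℂ A (A ⊗[ℂ] A)).flip z

theorem slice13_tmul (ω : A →ₗ[ℂ] ℂ) (b d a : A) :
    H.slice13 ω (b ⊗ₜ d) a = sliceRight ω (H.T₁ (a ⊗ₜ d)) ⊗ₜ b := by
  simp only [slice13, LinearMap.comp_apply, LinearMap.flip_apply, TensorProduct.mk_apply,
    leg13_tmul]
  generalize H.T₁ (a ⊗ₜ d) = z
  induction z with
  | zero => simp
  | add x y hx hy => simp only [map_add, TensorProduct.add_tmul, TensorProduct.tmul_add, hx, hy]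
  | tmul p q => simp [TensorProduct.smul_tmul]

theorem lTensor_sliceRight_assoc (ω : A →ₗ[ℂ] ℂ) (z : A ⊗[ℂ] A) (q : A) :
    (sliceRight ω).lTensor A (TensorProduct.assoc ℂ A A A (z ⊗ₜ q)) = ω q • z := by
  induction z with
  | zero => simp
  | add x y hx hy => simp only [map_add, TensorProduct.add_tmul, smul_add, hx, hy]
  | tmul p r => simp

/-- `G₁` is specified only through `Δ₁₃`; slicing the third leg by `ω` turns the specification into
a statement about actual elements of `A ⊗ A`. -/
theorem G₁_slice13 (ω : A →ₗ[ℂ] ℂ) (b d a : A) :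
    H.G₁ (H.slice13 ω (b ⊗ₜ d) a) = H.slice13 ω (H.EL (b ⊗ₜ d)) a := by
  have h := congrArg ((sliceRight ω).lTensor A) (H.G₁_spec (a ⊗ₜ (b ⊗ₜ d)))
  rw [leg23_tmul] at h
  rw [slice13_tmul, slice13]
  simp only [LinearMap.comp_apply, LinearMap.flip_apply, TensorProduct.mk_apply]
  rw [← h, leg13_tmul]
  generalize H.T₁ (a ⊗ₜ d) = z
  induction z with
  | zero => simp
  | add x y hx hy => simp only [map_add, TensorProduct.add_tmul, TensorProduct.tmul_add, hx, hy]
  | tmul p q =>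
    simp only [sliceRight_tmul, TensorProduct.leftComm_tmul, leg12_tmul, ← TensorProduct.smul_tmul',
      map_smul, lTensor_sliceRight_assoc]

/-- Coassociativity with the third leg sliced: applying `Δ` to `(ι ⊗ ω)(Δ(a)(1 ⊗ d))` only splits
off `a₁`. -/
theorem T₂_sliceRight_T₁ (ω : A →ₗ[ℂ] ℂ) (a c d : A) :
    H.T₂ (c ⊗ₜ sliceRight ω (H.T₁ (a ⊗ₜ d)))
      = (sliceRight ω ∘ₗ H.T₁ ∘ₗ (TensorProduct.mk ℂ A A).flip d).lTensor A (H.T₂ (c ⊗ₜ a)) := by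
  have h := congrArg ((sliceRight ω).lTensor A) (H.coassoc (c ⊗ₜ (a ⊗ₜ d)))
  rw [leg23_tmul, leg12_tmul] at h
  have h₁ : ∀ w : A ⊗[ℂ] A, (sliceRight ω).lTensor A (leg12 H.T₂ (c ⊗ₜ w))
      = H.T₂ (c ⊗ₜ sliceRight ω w) := by
    intro w
    induction w with
    | zero => simp
    | add x y hx hy => simp only [map_add, TensorProduct.tmul_add, hx, hy]
    | tmul p q => rw [leg12_tmul, lTensor_sliceRight_assoc, sliceRight_tmul,
        TensorProduct.tmul_smul, map_smul]
  rw [← h₁, h]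
  generalize H.T₂ (c ⊗ₜ a) = z
  induction z with
  | zero => simp
  | add x y hx hy => simp only [map_add, TensorProduct.add_tmul, hx, hy]
  | tmul p q => simp

theorem T₂_slice13 (ω : A →ₗ[ℂ] ℂ) (z : A ⊗[ℂ] A) (a c : A) :
    leg12 H.T₂ (c ⊗ₜ H.slice13 ω z a) = (H.slice13 ω z).lTensor A (H.T₂ (c ⊗ₜ a)) := by
  induction z with
  | zero => simp [slice13]
  | add x y hx hy =>
    have : H.slice13 ω (x + y) = H.slice13 ω x + H.slice13 ω y := by
      ext a
      simp [slice13]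
    rw [this, LinearMap.add_apply, TensorProduct.tmul_add, map_add, hx, hy, LinearMap.lTensor_add,
      LinearMap.add_apply]
  | tmul b d =>
    rw [slice13_tmul, leg12_tmul, T₂_sliceRight_T₁]
    generalize H.T₂ (c ⊗ₜ a) = z
    induction z with
    | zero => simp
    | add x y hx hy => simp only [map_add, TensorProduct.add_tmul, hx, hy]
    | tmul p q => simp [slice13_tmul]

/-- By fullness the left legs of the elements `Δ(a)(1 ⊗ d)` span `A`, so a linear map is determined
by its values on them. -/
theorem eq_zero_of_slice_T₁ {W : Type*} [AddCommGroup W] [Module ℂ W] (D : A →ₗ[ℂ] W)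
    (hD : ∀ ω a d, D (sliceRight ω (H.T₁ (a ⊗ₜ d))) = 0) : D = 0 := by
  ext p
  rw [LinearMap.zero_apply, ← Module.forall_dual_apply_eq_zero_iff ℂ]
  intro l
  have : l ∘ₗ D = 0 := by
    refine H.full₁ _ fun z => ?_
    refine tensor_induction (f := (l ∘ₗ D).rTensor A ∘ₗ H.T₁) (g := 0) (fun a d => ?_) z
    refine eq_zero_of_lTensor (fun ω : Module.Dual ℂ A => ω)
      (fun m hm => (Module.forall_dual_apply_eq_zero_iff ℂ m).1 hm) _ fun ω => ?_
    have key : ∀ w : A ⊗[ℂ] A, ω.lTensor ℂ ((l ∘ₗ D).rTensor A w)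
        = l (D (sliceRight ω w)) ⊗ₜ 1 := by
      intro w
      induction w with
      | zero => simp
      | add x y hx hy => simp only [map_add, TensorProduct.add_tmul, hx, hy]
      | tmul p q =>
        simp only [LinearMap.rTensor_tmul, LinearMap.lTensor_tmul, sliceRight_tmul, map_smul,
          LinearMap.comp_apply, TensorProduct.smul_tmul]
        rw [smul_eq_mul, mul_one]
    rw [LinearMap.comp_apply, key, hD, map_zero, TensorProduct.zero_tmul]
  exact LinearMap.congr_fun this p

/-- By fullness it suffices to test on slices `(ι ⊗ ω)(Δ(a)(1 ⊗ d))`. There `G₁` acts as `E` on the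
variables `b ⊗ d`, which the coproduct of `a` does not touch. -/
theorem G₁_leg_T₂ (w : A ⊗[ℂ] (A ⊗[ℂ] A)) :
    leg23 H.G₁ (leg12 H.T₂ w) = leg12 H.T₂ (leg23 H.G₁ w) := by
  refine LinearMap.congr_fun (f := leg23 H.G₁ ∘ₗ leg12 H.T₂) (g := leg12 H.T₂ ∘ₗ leg23 H.G₁)
    (triple_ext fun c p b => ?_) w
  suffices h : (leg23 H.G₁ ∘ₗ leg12 H.T₂ - leg12 H.T₂ ∘ₗ leg23 H.G₁)
      ∘ₗ TensorProduct.mk ℂ A (A ⊗[ℂ] A) c ∘ₗ (TensorProduct.mk ℂ A A).flip b = 0 by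
    exact sub_eq_zero.1 (LinearMap.congr_fun h p)
  refine H.eq_zero_of_slice_T₁ _ fun ω a d => sub_eq_zero.2 ?_
  simp only [LinearMap.comp_apply, TensorProduct.mk_apply, LinearMap.flip_apply, leg23_tmul]
  rw [← H.slice13_tmul ω b d a, H.T₂_slice13, H.G₁_slice13, H.T₂_slice13, leg23,
    ← LinearMap.lTensor_comp_apply]
  congr 2
  ext v
  exact H.G₁_slice13 ω b d v

/-- A generalized inverse inherits colinearity from `T₁` once its two projections `T₁R₁ = E` and
`R₁T₁ = G₁` are colinear. -/
theorem R₁_leg_T₂ (w : A ⊗[ℂ] (A ⊗[ℂ] A)) :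
    leg23 H.R₁ (leg12 H.T₂ w) = leg12 H.T₂ (leg23 H.R₁ w) := by
  have hc : ∀ (X Y : A ⊗[ℂ] A →ₗ[ℂ] A ⊗[ℂ] A) (w), leg23 X (leg23 Y w) = leg23 (X ∘ₗ Y) w :=
    fun X Y w => (LinearMap.lTensor_comp_apply A X Y w).symm
  have h₁ : H.R₁ = H.R₁ ∘ₗ H.EL := LinearMap.ext fun z => (H.R₁_EL z).symm
  have h₂ : H.EL = H.T₁ ∘ₗ H.R₁ := LinearMap.ext fun z => (H.T₁_R₁ z).symm
  have h₃ : H.G₁ = H.R₁ ∘ₗ H.T₁ := LinearMap.ext fun z => (H.R₁_T₁ z).symm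
  have h₄ : H.R₁ = H.G₁ ∘ₗ H.R₁ := LinearMap.ext fun z => (H.G₁_R₁ z).symm
  calc leg23 H.R₁ (leg12 H.T₂ w) = leg23 H.R₁ (leg23 H.EL (leg12 H.T₂ w)) := by rw [hc, ← h₁]
    _ = leg23 H.R₁ (leg12 H.T₂ (leg23 H.T₁ (leg23 H.R₁ w))) := by rw [H.EL_leg_T₂, hc, ← h₂]
    _ = leg12 H.T₂ (leg23 H.G₁ (leg23 H.R₁ w)) := by rw [H.coassoc, hc, ← h₃, H.G₁_leg_T₂]
    _ = leg12 H.T₂ (leg23 H.R₁ w) := by rw [hc, ← h₄]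

/-- A left colinear map is recovered from its slice by the counit: `X(a ⊗ v) = ∑ a₁ ⊗ (ε ⊗ ι)X(a₂ ⊗
v)`. For `X` equal to `R₁`, `E` and `G₁` this yields the Sweedler formulas with `S`, `ε_t` and
`ε_s`. -/
theorem mulLeft_of_leg_T₂ {X : A ⊗[ℂ] A →ₗ[ℂ] A ⊗[ℂ] A}
    (hX : ∀ w, leg23 X (leg12 H.T₂ w) = leg12 H.T₂ (leg23 X w)) (a v c : A) :
    (𝓛 c).rTensor A (X (a ⊗ₜ v))
      = (sliceLeft H.ε ∘ₗ X ∘ₗ (TensorProduct.mk ℂ A A).flip v).lTensor A (H.T₂ (c ⊗ₜ a)) := by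
  have h := congrArg ((sliceLeft H.ε).lTensor A) (hX (c ⊗ₜ (a ⊗ₜ v)))
  have h₁ : ∀ w : A ⊗[ℂ] A, (sliceLeft H.ε).lTensor A (leg12 H.T₂ (c ⊗ₜ w))
      = (𝓛 c).rTensor A w := by
    intro w
    induction w with
    | zero => simp
    | add x y hx hy => simp only [map_add, TensorProduct.tmul_add, hx, hy]
    | tmul p q =>
      rw [leg12_tmul, LinearMap.rTensor_tmul, LinearMap.mulLeft_apply, ← H.counit₂]
      generalize H.T₂ (c ⊗ₜ p) = z
      induction z with
      | zero => simp
      | add x y hx hy => simp only [map_add, TensorProduct.add_tmul, hx, hy]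
      | tmul p q => simp [TensorProduct.smul_tmul]
  rw [leg23_tmul, h₁, leg12_tmul] at h
  rw [← h]
  generalize H.T₂ (c ⊗ₜ a) = z
  induction z with
  | zero => simp
  | add x y hx hy => simp only [map_add, TensorProduct.add_tmul, hx, hy]
  | tmul p q => simp

end CanonicalMaps

/-! ### Multipliers, and the source and target maps -/

namespace Multiplier

/-- The linear map `m ↦ m b`. -/
def leftAt (b : A) : Multiplier A →ₗ[ℂ] A where
  toFun m := m.left b
  map_add' _ _ := rfl
  map_smul' _ _ := rfl

/-- The linear map `m ↦ b m`. -/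
def rightAt (b : A) : Multiplier A →ₗ[ℂ] A where
  toFun m := m.right b
  map_add' _ _ := rfl
  map_smul' _ _ := rfl

@[simp]
theorem leftAt_apply (b : A) (m : Multiplier A) : leftAt b m = m.left b := rfl

@[simp]
theorem rightAt_apply (b : A) (m : Multiplier A) : rightAt b m = m.right b := rfl

theorem left_apply_mul (hA : Nondegenerate A) (m : Multiplier A) (a b : A) :
    m.left (a * b) = m.left a * b :=
  hA.eq_of_mul_left fun c => by
    rw [← right_apply_mul, ← mul_assoc, ← mul_assoc, right_apply_mul]

theorem right_mul_apply (hA : Nondegenerate A) (m : Multiplier A) (a b : A) :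
    m.right (a * b) = a * m.right b :=
  hA.eq_of_mul_right fun c => by
    rw [right_apply_mul, mul_assoc, mul_assoc, right_apply_mul]

theorem ext_left (hA : Nondegenerate A) {m n : Multiplier A} (h : ∀ b, m.left b = n.left b) :
    m = n :=
  ext (LinearMap.ext h) <| LinearMap.ext fun a => hA.eq_of_mul_right fun c => by
    rw [right_apply_mul, right_apply_mul, h]

theorem ext_right (hA : Nondegenerate A) {m n : Multiplier A} (h : ∀ b, m.right b = n.right b) :
    m = n :=
  ext (LinearMap.ext fun a => hA.eq_of_mul_left fun c => by
    rw [← right_apply_mul, ← right_apply_mul, h]) (LinearMap.ext h)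

theorem rTensor_right_mul (m : Multiplier A) (x y : A ⊗[ℂ] A) :
    m.right.rTensor A x * y = x * m.left.rTensor A y :=
  rTensor_mul_compat x y m.right_apply_mul

theorem lTensor_right_mul (m : Multiplier A) (x y : A ⊗[ℂ] A) :
    m.right.lTensor A x * y = x * m.left.lTensor A y :=
  lTensor_mul_compat x y m.right_apply_mul

/-- The multiplier of the opposite algebra with the same action. -/
def op (m : Multiplier A) : Multiplier Aᵐᵒᵖ :=
  mk' ((MulOpposite.opLinearEquiv ℂ).conj m.right) ((MulOpposite.opLinearEquiv ℂ).conj m.left)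
    fun a b => congrArg MulOpposite.op (m.right_apply_mul b.unop a.unop).symm

theorem left_op (m : Multiplier A) : m.op.left = (MulOpposite.opLinearEquiv ℂ).conj m.right := rfl

@[simp]
theorem op_left_op (m : Multiplier A) (a : A) :
    m.op.left (MulOpposite.op a) = MulOpposite.op (m.right a) := rfl

@[simp]
theorem op_right_op (m : Multiplier A) (a : A) :
    m.op.right (MulOpposite.op a) = MulOpposite.op (m.left a) := rfl

end Multiplier

namespace CanonicalMaps

variable (H : CanonicalMaps A)

theorem sliceLeft_T₁ (z : A ⊗[ℂ] A) : sliceLeft H.ε (H.T₁ z) = LinearMap.mul' ℂ A z :=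
  tensor_induction (f := sliceLeft H.ε ∘ₗ H.T₁) (fun a b => by simp [H.counit₁]) z

theorem sliceRight_T₂ (z : A ⊗[ℂ] A) : sliceRight H.ε (H.T₂ z) = LinearMap.mul' ℂ A z :=
  tensor_induction (f := sliceRight H.ε ∘ₗ H.T₂) (fun a b => by simp [H.counit₂]) z

theorem sliceLeft_R₁ (z : A ⊗[ℂ] A) :
    sliceLeft H.ε (H.R₁ z) = LinearMap.mul' ℂ A (H.S.toLinearMap.rTensor A z) :=
  tensor_induction (f := sliceLeft H.ε ∘ₗ H.R₁) (g := LinearMap.mul' ℂ A ∘ₗ _)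
    (fun a b => by simp [H.S_mul]) z

theorem sliceRight_R₂ (z : A ⊗[ℂ] A) :
    sliceRight H.ε (H.R₂ z) = LinearMap.mul' ℂ A (H.S.toLinearMap.lTensor A z) :=
  tensor_induction (f := sliceRight H.ε ∘ₗ H.R₂) (g := LinearMap.mul' ℂ A ∘ₗ _)
    (fun a b => by simp [H.mul_S]) z

theorem sliceLeft_EL (z : A ⊗[ℂ] A) :
    sliceLeft H.ε (H.EL z) = LinearMap.mul' ℂ A (H.R₁ z) := by
  rw [← H.T₁_R₁, H.sliceLeft_T₁]

theorem sliceRight_ER (z : A ⊗[ℂ] A) :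
    sliceRight H.ε (H.ER z) = LinearMap.mul' ℂ A (H.R₂ z) := by
  rw [← H.T₂_R₂, H.sliceRight_T₂]

theorem sliceLeft_G₁ (z : A ⊗[ℂ] A) : sliceLeft H.ε (H.G₁ z)
    = LinearMap.mul' ℂ A (H.S.toLinearMap.rTensor A (H.T₁ z)) := by
  rw [← H.R₁_T₁, H.sliceLeft_R₁]

theorem sliceRight_G₂ (z : A ⊗[ℂ] A) : sliceRight H.ε (H.G₂ z)
    = LinearMap.mul' ℂ A (H.S.toLinearMap.lTensor A (H.T₂ z)) := by
  rw [← H.R₂_T₂, H.sliceRight_R₂]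

/-- `(c ⊗ 1) R₁(a ⊗ b) = ∑ c a₍₁₎ ⊗ S(a₍₂₎) b`. -/
theorem mulLeft_R₁ (a b c : A) : (𝓛 c).rTensor A (H.R₁ (a ⊗ₜ b))
    = (𝓡 b ∘ₗ H.S.toLinearMap).lTensor A (H.T₂ (c ⊗ₜ a)) := by
  rw [H.mulLeft_of_leg_T₂ H.R₁_leg_T₂]
  congr 2
  ext x
  simp [H.S_mul]

/-- `R₂(b ⊗ a) (1 ⊗ c) = ∑ b S(a₍₁₎) ⊗ a₍₂₎ c`. -/
theorem mulRight_R₂ (a b c : A) : (𝓡 c).lTensor A (H.R₂ (b ⊗ₜ a))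
    = (𝓛 b ∘ₗ H.S.toLinearMap).rTensor A (H.T₁ (a ⊗ₜ c)) := by
  apply (rev₂ A).injective
  rw [rev₂_lTensor, rev₂_rTensor, conj_mulRight]
  exact H.op.mulLeft_R₁ (MulOpposite.op a) (MulOpposite.op b) (MulOpposite.op c)

theorem mul'_mulRight (c : A) (z : A ⊗[ℂ] A) :
    LinearMap.mul' ℂ A ((𝓡 c).lTensor A z) = LinearMap.mul' ℂ A z * c :=
  tensor_induction (f := LinearMap.mul' ℂ A ∘ₗ _) (g := 𝓡 c ∘ₗ LinearMap.mul' ℂ A)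
    (fun a b => by simp [mul_assoc]) z

theorem mul'_mulLeft (c : A) (z : A ⊗[ℂ] A) :
    LinearMap.mul' ℂ A ((𝓛 c).rTensor A z) = c * LinearMap.mul' ℂ A z :=
  tensor_induction (f := LinearMap.mul' ℂ A ∘ₗ _) (g := 𝓛 c ∘ₗ LinearMap.mul' ℂ A)
    (fun a b => by simp [mul_assoc]) z

/-- The target map `ε_t(a) = ∑ a₍₁₎ S(a₍₂₎)`. -/
def et : A →ₗ[ℂ] Multiplier A where
  toFun a := Multiplier.mk' (sliceLeft H.ε ∘ₗ H.EL ∘ₗ TensorProduct.mk ℂ A A a)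
    (sliceRight H.ε ∘ₗ H.G₂ ∘ₗ (TensorProduct.mk ℂ A A).flip a) fun b c => by
      simp only [LinearMap.comp_apply, LinearMap.flip_apply, TensorProduct.mk_apply]
      -- Both `b(ε_t(a)c)` and `(bε_t(a))c` equal `∑ b a₁ S(a₂) c`, the product of the legs of `(b ⊗
      -- 1)R₁(a ⊗ c)`.
      rw [sliceLeft_EL, sliceRight_G₂, ← mul'_mulLeft, mulLeft_R₁, LinearMap.lTensor_comp_apply,
        mul'_mulRight]
  map_add' a b := by
    ext x <;> simp
  map_smul' r a := by
    ext x <;> simp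

/-- The source map `ε_s(a) = ∑ S(a₍₁₎) a₍₂₎`. -/
def es : A →ₗ[ℂ] Multiplier A where
  toFun a := Multiplier.mk' (sliceLeft H.ε ∘ₗ H.G₁ ∘ₗ TensorProduct.mk ℂ A A a)
    (sliceRight H.ε ∘ₗ H.ER ∘ₗ (TensorProduct.mk ℂ A A).flip a) fun b c => by
      simp only [LinearMap.comp_apply, LinearMap.flip_apply, TensorProduct.mk_apply]
      rw [sliceLeft_G₁, sliceRight_ER, ← mul'_mulRight, mulRight_R₂, LinearMap.rTensor_comp_apply,
        mul'_mulLeft]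
  map_add' a b := by
    ext x <;> simp
  map_smul' r a := by
    ext x <;> simp

theorem et_left (a b : A) : (H.et a).left b = sliceLeft H.ε (H.EL (a ⊗ₜ b)) := rfl

theorem et_right (a b : A) : (H.et a).right b = sliceRight H.ε (H.G₂ (b ⊗ₜ a)) := rfl

theorem es_left (a b : A) : (H.es a).left b = sliceLeft H.ε (H.G₁ (a ⊗ₜ b)) := rfl

theorem op_et (a : A) : H.op.et (MulOpposite.op a) = (H.es a).op :=
  Multiplier.ext (LinearMap.ext fun _ => sliceLeft_rev₂ _ _)
    (LinearMap.ext fun _ => sliceRight_rev₂ _ _)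

theorem op_es (a : A) : H.op.es (MulOpposite.op a) = (H.et a).op :=
  Multiplier.ext (LinearMap.ext fun _ => sliceLeft_rev₂ _ _)
    (LinearMap.ext fun _ => sliceRight_rev₂ _ _)

theorem et_right_eq (a b : A) : (H.et a).right b
    = LinearMap.mul' ℂ A (H.S.toLinearMap.lTensor A (H.T₂ (b ⊗ₜ a))) := by
  rw [et_right, sliceRight_G₂]

theorem es_left_eq (a b : A) : (H.es a).left b
    = LinearMap.mul' ℂ A (H.S.toLinearMap.rTensor A (H.T₁ (a ⊗ₜ b))) := by
  rw [es_left, sliceLeft_G₁]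

/-- `(c ⊗ 1) E (a ⊗ b) = ∑ c a₍₁₎ ⊗ ε_t(a₍₂₎) b`. -/
theorem mulLeft_EL (a b c : A) : (𝓛 c).rTensor A (H.EL (a ⊗ₜ b))
    = (Multiplier.leftAt b ∘ₗ H.et).lTensor A (H.T₂ (c ⊗ₜ a)) :=
  H.mulLeft_of_leg_T₂ H.EL_leg_T₂ a b c

theorem mulLeft_G₁ (a b c : A) : (𝓛 c).rTensor A (H.G₁ (a ⊗ₜ b))
    = (Multiplier.leftAt b ∘ₗ H.es).lTensor A (H.T₂ (c ⊗ₜ a)) :=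
  H.mulLeft_of_leg_T₂ H.G₁_leg_T₂ a b c

theorem conj_rightAt_comp_et (b : A) :
    (MulOpposite.opLinearEquiv ℂ).conj (Multiplier.rightAt b ∘ₗ H.et)
      = Multiplier.leftAt (MulOpposite.op b) ∘ₗ H.op.es :=
  LinearMap.ext fun a => (congrArg (fun m => m.left (MulOpposite.op b)) (H.op_es a.unop)).symm

/-- `G₂(b ⊗ a) (1 ⊗ c) = ∑ b ε_t(a₍₁₎) ⊗ a₍₂₎ c`. -/
theorem mulRight_G₂ (a b c : A) : (𝓡 c).lTensor A (H.G₂ (b ⊗ₜ a))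
    = (Multiplier.rightAt b ∘ₗ H.et).rTensor A (H.T₁ (a ⊗ₜ c)) := by
  apply (rev₂ A).injective
  rw [rev₂_lTensor, rev₂_rTensor, conj_mulRight, conj_rightAt_comp_et]
  exact H.op.mulLeft_G₁ (MulOpposite.op a) (MulOpposite.op b) (MulOpposite.op c)

/-- `∑ S(a₍₁₎) a₍₂₎ S(a₍₃₎) = S(a)`. -/
theorem mul'_S_EL (a b : A) :
    LinearMap.mul' ℂ A (H.S.toLinearMap.rTensor A (H.EL (a ⊗ₜ b))) = H.S a * b := by
  rw [← H.T₁_R₁, ← H.sliceLeft_G₁, H.G₁_R₁, H.S_mul]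

theorem mul'_S_ER (a b : A) :
    LinearMap.mul' ℂ A (H.S.toLinearMap.lTensor A (H.ER (b ⊗ₜ a))) = b * H.S a := by
  have h := H.op.mul'_S_EL (MulOpposite.op a) (MulOpposite.op b)
  have key : ∀ z : A ⊗[ℂ] A, LinearMap.mul' ℂ Aᵐᵒᵖ (H.op.S.toLinearMap.rTensor Aᵐᵒᵖ (rev₂ A z))
      = MulOpposite.op (LinearMap.mul' ℂ A (H.S.toLinearMap.lTensor A z)) := by
    intro z
    induction z with
    | zero => simp
    | add x y hx hy => simp only [map_add, hx, hy, MulOpposite.op_add]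
    | tmul p q => rfl
  exact MulOpposite.op_injective ((key _).symm.trans h)

/-- `∑ a₍₁₎ S(a₍₂₎) a₍₃₎ = a`. -/
theorem mul'_et_T₁ (z : A ⊗[ℂ] A) :
    LinearMap.mul' ℂ A (H.R₁ (H.T₁ z)) = LinearMap.mul' ℂ A z := by
  rw [← sliceLeft_EL, H.EL_T₁, sliceLeft_T₁]

end CanonicalMaps

/-! ### Source and target multipliers -/

/-- Operators that commute on overlapping pairs of legs still commute after the unshared first leg
is sliced off. With `X = E` and `Y` equal to `E` or `T₁`, this shows how multiplication by `ε_t(a)`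
interacts with `E` and `Δ`. -/
theorem rTensor_slice_comm {X Y : A ⊗[ℂ] A →ₗ[ℂ] A ⊗[ℂ] A}
    (h : ∀ w, leg12 X (leg23 Y w) = leg23 Y (leg12 X w)) (ω : A →ₗ[ℂ] ℂ) (a : A) (z : A ⊗[ℂ] A) :
    (sliceLeft ω ∘ₗ X ∘ₗ TensorProduct.mk ℂ A A a).rTensor A (Y z)
      = Y ((sliceLeft ω ∘ₗ X ∘ₗ TensorProduct.mk ℂ A A a).rTensor A z) := by
  set s : A ⊗[ℂ] (A ⊗[ℂ] A) →ₗ[ℂ] A ⊗[ℂ] A :=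
    (TensorProduct.lid ℂ (A ⊗[ℂ] A)).toLinearMap ∘ₗ ω.rTensor (A ⊗[ℂ] A) with hs
  have h₁ : ∀ w, s (leg23 Y w) = Y (s w) := fun w =>
    tensor_induction (f := s ∘ₗ leg23 Y) (g := Y ∘ₗ s) (fun p q => by simp [hs]) w
  have h₂ : ∀ w, s (leg12 X (a ⊗ₜ w))
      = (sliceLeft ω ∘ₗ X ∘ₗ TensorProduct.mk ℂ A A a).rTensor A w := fun w =>
    tensor_induction (f := s ∘ₗ leg12 X ∘ₗ TensorProduct.mk ℂ A (A ⊗[ℂ] A) a) (fun p q => by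
      simp only [LinearMap.comp_apply, TensorProduct.mk_apply, leg12_tmul, LinearMap.rTensor_tmul]
      generalize X (a ⊗ₜ p) = z
      induction z with
      | zero => simp
      | add x y hx hy => simp only [map_add, TensorProduct.add_tmul, hx, hy]
      | tmul p q => simp [hs, TensorProduct.smul_tmul']) w
  rw [← h₂, ← h₂, ← h₁, ← h, leg23_tmul]

theorem Multiplier.mulLeft_right_apply (m : Multiplier A) (b : A) :
    𝓛 (m.right b) = 𝓛 b ∘ₗ m.left :=
  LinearMap.ext fun c => m.right_apply_mul b c

theorem Multiplier.mulRight_comp_left (hA : Nondegenerate A) (m : Multiplier A) (b : A) :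
    𝓡 b ∘ₗ m.left = m.left ∘ₗ 𝓡 b :=
  LinearMap.ext fun c => (m.left_apply_mul hA c b).symm

namespace CanonicalMaps

variable (H : CanonicalMaps A)

/-- `Δ(x b) = (x ⊗ 1) Δ(b)` and `Δ(b x) = Δ(b) (x ⊗ 1)`. -/
structure IsTarget (x : Multiplier A) : Prop where
  DL_left : ∀ b z, H.DL (x.left b) z = x.left.rTensor A (H.DL b z)
  DL_right : ∀ b z, H.DL (x.right b) z = H.DL b (x.left.rTensor A z)

/-- `Δ(y b) = (1 ⊗ y) Δ(b)` and `Δ(b y) = Δ(b) (1 ⊗ y)`. -/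
structure IsSource (y : Multiplier A) : Prop where
  DL_left : ∀ b z, H.DL (y.left b) z = y.left.lTensor A (H.DL b z)
  DL_right : ∀ b z, H.DL (y.right b) z = H.DL b (y.left.lTensor A z)

theorem op_DL_rev₂ (a : A) (z : A ⊗[ℂ] A) :
    H.op.DL (MulOpposite.op a) (rev₂ A z) = rev₂ A (H.DR a z) := conjRevHom_rev₂ _ _

theorem op_T₁_rev₂ (z : A ⊗[ℂ] A) : H.op.T₁ (rev₂ A z) = rev₂ A (H.T₂ z) := conjRev_rev₂ _ _

theorem op_T₂_rev₂ (z : A ⊗[ℂ] A) : H.op.T₂ (rev₂ A z) = rev₂ A (H.T₁ z) := conjRev_rev₂ _ _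

theorem op_EL_rev₂ (z : A ⊗[ℂ] A) : H.op.EL (rev₂ A z) = rev₂ A (H.ER z) := conjRev_rev₂ _ _

section IsTarget

variable {H} {x : Multiplier A} (hx : H.IsTarget x)
include hx

theorem IsTarget.DR_right (b : A) (z : A ⊗[ℂ] A) :
    H.DR (x.right b) z = x.right.rTensor A (H.DR b z) := by
  refine H.nondeg.tensor_eq_of_mul_right fun w => ?_
  rw [H.DR_mul_eq, hx.DL_right, ← H.DR_mul_eq, Multiplier.rTensor_right_mul]

theorem IsTarget.DR_left (b : A) (z : A ⊗[ℂ] A) :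
    H.DR (x.left b) z = H.DR b (x.right.rTensor A z) := by
  refine H.nondeg.tensor_eq_of_mul_right fun w => ?_
  rw [H.DR_mul_eq, hx.DL_left, H.DR_mul_eq, Multiplier.rTensor_right_mul]

theorem IsTarget.op : H.op.IsSource x.op where
  DL_left := forall_op fun b => forall_rev₂ fun z => by
    rw [Multiplier.op_left_op, op_DL_rev₂, hx.DR_right, rev₂_rTensor, op_DL_rev₂, x.left_op]
  DL_right := forall_op fun b => forall_rev₂ fun z => by
    rw [Multiplier.op_right_op, op_DL_rev₂, hx.DR_left, x.left_op, ← rev₂_rTensor, op_DL_rev₂]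

theorem IsTarget.T₁_left (b c : A) :
    H.T₁ (x.left b ⊗ₜ c) = x.left.rTensor A (H.T₁ (b ⊗ₜ c)) := by
  refine H.nondeg.eq_of_rTensor_mulRight fun d => ?_
  rw [H.mulRight_T₁, hx.DL_left, ← H.mulRight_T₁, ← LinearMap.rTensor_comp_apply,
    ← LinearMap.rTensor_comp_apply, x.mulRight_comp_left H.nondeg]

theorem IsTarget.T₁_right (b c : A) :
    H.T₁ (x.right b ⊗ₜ c) = x.right.rTensor A (H.T₁ (b ⊗ₜ c)) := by
  refine H.nondeg.tensor_eq_of_mul_left fun w => ?_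
  rw [H.mul_T₁, hx.DR_right, ← rTensor_lTensor_comm, ← H.mul_T₁,
    rTensor_mul_right _ _ (x.right_mul_apply H.nondeg)]

theorem IsTarget.T₂_right (b c : A) :
    H.T₂ (c ⊗ₜ x.right b) = x.right.rTensor A (H.T₂ (c ⊗ₜ b)) := by
  refine H.nondeg.eq_of_lTensor_mulLeft fun d => ?_
  rw [H.mulLeft_T₂, hx.DR_right, ← H.mulLeft_T₂, rTensor_lTensor_comm]

theorem IsTarget.T₂_left (b c : A) : H.T₂ (c ⊗ₜ x.left b) = H.T₂ (x.right c ⊗ₜ b) := by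
  refine H.nondeg.eq_of_lTensor_mulLeft fun d => ?_
  rw [H.mulLeft_T₂, hx.DR_left, H.mulLeft_T₂, LinearMap.rTensor_tmul]

theorem IsTarget.T₁_rTensor_left (z : A ⊗[ℂ] A) :
    H.T₁ (x.left.rTensor A z) = x.left.rTensor A (H.T₁ z) :=
  tensor_induction (f := H.T₁ ∘ₗ x.left.rTensor A) (g := x.left.rTensor A ∘ₗ H.T₁) hx.T₁_left z

/-- `(A ⊗ A)E` is the range of `T₂`, hence spanned by the elements `(c ⊗ 1)Δ(b)`; if all `Δ(b)` kill
`z`, so does `wE` for every `w`. -/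
theorem eq_zero_of_DL {z : A ⊗[ℂ] A} (h : ∀ b, H.DL b z = 0) : H.EL z = 0 := by
  refine H.nondeg.tensor_eq_of_mul_left fun w => ?_
  rw [← H.ER_mul_eq, ← H.T₂_R₂, mul_zero]
  refine tensor_induction (f := 𝓡 z ∘ₗ H.T₂) (g := 0) (fun a b => ?_) _
  simp [H.T₂_mul, h]

/-- Two absorption identities: `E(x ⊗ 1)E = (x ⊗ 1)E`, because `x ⊗ 1` preserves the range of `T₁`;
and `E(x ⊗ 1)E = E(x ⊗ 1)`, because `Δ(b)(x ⊗ 1)E = Δ(bx)E = Δ(bx) = Δ(b)(x ⊗ 1)`. -/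
theorem IsTarget.EL_rTensor_left (z : A ⊗[ℂ] A) :
    H.EL (x.left.rTensor A z) = x.left.rTensor A (H.EL z) := by
  have h₁ : H.EL (x.left.rTensor A (H.EL z)) = x.left.rTensor A (H.EL z) := by
    rw [← H.T₁_R₁ z, ← hx.T₁_rTensor_left, H.EL_T₁]
  rw [← h₁, ← sub_eq_zero, ← map_sub]
  refine eq_zero_of_DL hx fun b => ?_
  rw [map_sub, ← hx.DL_right, ← hx.DL_right, H.DL_EL, sub_self]

theorem IsTarget.ER_rTensor_right (z : A ⊗[ℂ] A) :
    H.ER (x.right.rTensor A z) = x.right.rTensor A (H.ER z) := by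
  refine H.nondeg.tensor_eq_of_mul_right fun w => ?_
  rw [H.ER_mul_eq, Multiplier.rTensor_right_mul, Multiplier.rTensor_right_mul, H.ER_mul_eq,
    hx.EL_rTensor_left]

end IsTarget

section IsSource

variable {H} {y : Multiplier A}

theorem isSource_of_op (hy : H.op.IsTarget y.op) : H.IsSource y := by
  have h₁ : ∀ b z, H.DR (y.right b) z = y.right.lTensor A (H.DR b z) := fun b z =>
    (rev₂ A).injective <| by
      rw [← op_DL_rev₂, ← y.op_left_op, hy.DL_left, op_DL_rev₂, y.left_op, ← rev₂_lTensor]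
  have h₂ : ∀ b z, H.DR (y.left b) z = H.DR b (y.right.lTensor A z) := fun b z =>
    (rev₂ A).injective <| by
      rw [← op_DL_rev₂, ← y.op_right_op, hy.DL_right, y.left_op, ← rev₂_lTensor, op_DL_rev₂]
  constructor
  · intro b z
    refine H.nondeg.tensor_eq_of_mul_left fun w => ?_
    rw [← H.DR_mul_eq, h₂, H.DR_mul_eq, Multiplier.lTensor_right_mul]
  · intro b z
    refine H.nondeg.tensor_eq_of_mul_left fun w => ?_
    rw [← H.DR_mul_eq, h₁, ← H.DR_mul_eq, Multiplier.lTensor_right_mul]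

variable (hy : H.IsSource y)
include hy

theorem IsSource.DR_right (b : A) (z : A ⊗[ℂ] A) :
    H.DR (y.right b) z = y.right.lTensor A (H.DR b z) := by
  refine H.nondeg.tensor_eq_of_mul_right fun w => ?_
  rw [H.DR_mul_eq, hy.DL_right, ← H.DR_mul_eq, Multiplier.lTensor_right_mul]

theorem IsSource.DR_left (b : A) (z : A ⊗[ℂ] A) :
    H.DR (y.left b) z = H.DR b (y.right.lTensor A z) := by
  refine H.nondeg.tensor_eq_of_mul_right fun w => ?_
  rw [H.DR_mul_eq, hy.DL_left, H.DR_mul_eq, Multiplier.lTensor_right_mul]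

theorem IsSource.op : H.op.IsTarget y.op where
  DL_left := forall_op fun b => forall_rev₂ fun z => by
    rw [Multiplier.op_left_op, op_DL_rev₂, hy.DR_right, rev₂_lTensor, op_DL_rev₂, y.left_op]
  DL_right := forall_op fun b => forall_rev₂ fun z => by
    rw [Multiplier.op_right_op, op_DL_rev₂, hy.DR_left, y.left_op, ← rev₂_lTensor, op_DL_rev₂]

theorem IsSource.T₁_left (b c : A) :
    H.T₁ (y.left b ⊗ₜ c) = y.left.lTensor A (H.T₁ (b ⊗ₜ c)) := by
  apply (rev₂ A).injective
  rw [rev₂_lTensor, ← op_T₂_rev₂, ← op_T₂_rev₂]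
  exact hy.op.T₂_right (MulOpposite.op b) (MulOpposite.op c)

theorem IsSource.T₂_left (b c : A) :
    H.T₂ (c ⊗ₜ y.left b) = y.left.lTensor A (H.T₂ (c ⊗ₜ b)) := by
  apply (rev₂ A).injective
  rw [rev₂_lTensor, ← op_T₁_rev₂, ← op_T₁_rev₂]
  exact hy.op.T₁_right (MulOpposite.op b) (MulOpposite.op c)

end IsSource

theorem EL_rTensor_et_left (a : A) (z : A ⊗[ℂ] A) :
    (H.et a).left.rTensor A (H.EL z) = H.EL ((H.et a).left.rTensor A z) :=
  rTensor_slice_comm H.EL_comm H.ε a z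

theorem T₁_rTensor_et_left (a : A) (z : A ⊗[ℂ] A) :
    (H.et a).left.rTensor A (H.T₁ z) = H.T₁ ((H.et a).left.rTensor A z) :=
  rTensor_slice_comm H.EL_leg_T₁ H.ε a z

/-- `ε_t(a) ⊗ 1` commutes with `T₁` and with `E`. The first gives the left rule; for the right rule
`Ez` is written as `T₁R₁z`, where `Δ(b)T₁` is `T₁` after multiplication by `b` in the first leg. -/
theorem isTarget_et (a : A) : H.IsTarget (H.et a) where
  DL_left b z := by
    refine tensor_induction (f := H.DL _) (g := (H.et a).left.rTensor A ∘ₗ H.DL b) (fun p q => ?_) z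
    rw [LinearMap.comp_apply, ← H.mulRight_T₁, ← H.mulRight_T₁, ← LinearMap.rTensor_tmul,
      ← T₁_rTensor_et_left, ← LinearMap.rTensor_comp_apply,
      ← LinearMap.rTensor_comp_apply, Multiplier.mulRight_comp_left H.nondeg]
  DL_right b z := by
    rw [← H.DL_EL, ← H.T₁_R₁, H.DL_T₁, Multiplier.mulLeft_right_apply,
      LinearMap.rTensor_comp_apply, ← H.DL_T₁, ← H.T₁_rTensor_et_left, H.T₁_R₁,
      EL_rTensor_et_left, H.DL_EL]

theorem isSource_es (a : A) : H.IsSource (H.es a) :=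
  isSource_of_op (by rw [← op_et]; exact H.op.isTarget_et _)

end CanonicalMaps

/-! ### The antipode reverses products -/

theorem Idempotent.range_mul' (hA : Idempotent A) : LinearMap.range (LinearMap.mul' ℂ A) = ⊤ := by
  rw [eq_top_iff, ← hA, Submodule.span_le]
  rintro _ ⟨a, b, rfl⟩
  exact ⟨a ⊗ₜ b, by simp⟩

theorem Multiplier.op_injective : Function.Injective (Multiplier.op : Multiplier A → _) := by
  intro m n h
  refine Multiplier.ext (LinearMap.ext fun b => ?_) (LinearMap.ext fun b => ?_)
  · exact MulOpposite.op_injective (congrArg (fun m => m.right (MulOpposite.op b)) h)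
  · exact MulOpposite.op_injective (congrArg (fun m => m.left (MulOpposite.op b)) h)

namespace CanonicalMaps

variable (H : CanonicalMaps A)

/-- Fullness of the right leg: Sweedler identities in `a₂` with a covered `a₁` beside them can be
stripped of the first leg. -/
theorem ext_T₂ {W : Type*} [AddCommGroup W] [Module ℂ W] {f g : A →ₗ[ℂ] W}
    (h : ∀ a b, f.lTensor A (H.T₂ (a ⊗ₜ b)) = g.lTensor A (H.T₂ (a ⊗ₜ b))) : f = g := by
  rw [← sub_eq_zero]
  ext p
  rw [LinearMap.zero_apply, ← Module.forall_dual_apply_eq_zero_iff ℂ]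
  intro l
  have : l ∘ₗ (f - g) = 0 := by
    refine H.full₂ _ fun z => ?_
    refine tensor_induction (f := (l ∘ₗ (f - g)).lTensor A ∘ₗ H.T₂) (g := 0) (fun a b => ?_) z
    rw [LinearMap.comp_apply, LinearMap.lTensor_comp_apply, LinearMap.lTensor_sub,
      LinearMap.sub_apply, h, sub_self, map_zero, LinearMap.zero_apply]
  exact LinearMap.congr_fun this p

theorem ER_mulLeft₂ (c : A) (z : A ⊗[ℂ] A) :
    H.ER ((𝓛 c).lTensor A z) = (𝓛 c).lTensor A (H.ER z) := by
  refine H.nondeg.tensor_eq_of_mul_right fun y => ?_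
  rw [H.ER_mul_eq, ← lTensor_mul_left _ _ (fun a b => (mul_assoc c a b).symm),
    ← lTensor_mul_left _ _ (fun a b => (mul_assoc c a b).symm), H.ER_mul_eq]

/-- `(u ⊗ v) E (b ⊗ 1) = ∑ u b₍₁₎ ⊗ v ε_t(b₍₂₎)`. -/
theorem mulRight_ER₁ (u v b : A) : (𝓡 b).rTensor A (H.ER (u ⊗ₜ v))
    = (Multiplier.rightAt v ∘ₗ H.et).lTensor A (H.T₂ (u ⊗ₜ b)) := by
  refine H.nondeg.eq_of_lTensor_mulRight fun c => ?_
  have h : (𝓡 c).lTensor A ((𝓡 b).rTensor A (H.ER (u ⊗ₜ v))) = H.ER (u ⊗ₜ v) * (b ⊗ₜ c) := by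
    rw [mul_tmul_eq, rTensor_lTensor_comm]
  rw [h, H.ER_mul_eq, tmul_mul_eq, rTensor_lTensor_comm, H.mulLeft_EL,
    ← LinearMap.lTensor_comp_apply, ← LinearMap.lTensor_comp_apply]
  congr 2
  ext a
  exact ((H.et a).right_apply_mul v c).symm

/-- `ε_t(v b) = ε_t(v ε_t(b))`. -/
theorem et_mul (v b : A) : H.et (v * b) = H.et ((H.et b).right v) := by
  refine Multiplier.ext_left H.nondeg fun y => ?_
  set Φ := (Multiplier.leftAt y ∘ₗ H.et).lTensor A with hΦ
  have h₂ : Multiplier.leftAt y ∘ₗ H.et ∘ₗ 𝓛 v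
      = Multiplier.leftAt y ∘ₗ H.et ∘ₗ Multiplier.rightAt v ∘ₗ H.et := by
    refine H.ext_T₂ fun u b' => ?_
    -- `Φ ∘ T₂` sends `c ⊗ p` to `(c ⊗ 1)E(p ⊗ y)`, so multiplying `p` by `b'` on the right only
    -- multiplies the first leg.
    have h₁ : ∀ w, Φ (H.DR b' (H.T₂ w)) = (𝓡 b').rTensor A (Φ (H.T₂ w)) := fun w => by
      refine tensor_induction (f := Φ ∘ₗ H.DR b' ∘ₗ H.T₂) (g := (𝓡 b').rTensor A ∘ₗ Φ ∘ₗ H.T₂)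
        (fun c p => ?_) w
      simp only [LinearMap.comp_apply]
      rw [H.DR_T₂, LinearMap.lTensor_tmul, hΦ, ← H.mulLeft_EL, ← H.mulLeft_EL,
        LinearMap.mulRight_apply, ← LinearMap.rTensor_comp_apply, ← LinearMap.mulRight_apply ℂ,
        ← LinearMap.rTensor_tmul, H.EL_mulRight₁, ← LinearMap.rTensor_comp_apply]
      congr 2
      ext x
      simp [mul_assoc]
    -- With `T₂R₂(u ⊗ v) = (u ⊗ v)E` the two sides become `∑ u b₁ ⊗ ε_t(v b₂)y` and `∑ u b₁ ⊗ ε_t(v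
    -- ε_t(b₂))y`, for `b = b'`.
    have h₃ := h₁ (H.R₂ (u ⊗ₜ v))
    rw [H.T₂_R₂, H.DR_ER, ← H.mulLeft_T₂, hΦ, rTensor_lTensor_comm, H.mulRight_ER₁,
      ← LinearMap.lTensor_comp_apply, ← LinearMap.lTensor_comp_apply] at h₃
    exact h₃
  exact LinearMap.congr_fun h₂ b

/-- The map `p ⊗ q ↦ p ε_t(q)`. -/
def mulEt : A ⊗[ℂ] A →ₗ[ℂ] A := LinearMap.mul' ℂ A ∘ₗ H.S.toLinearMap.lTensor A ∘ₗ H.T₂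

theorem mulEt_apply (z : A ⊗[ℂ] A) :
    H.mulEt z = LinearMap.mul' ℂ A (H.S.toLinearMap.lTensor A (H.T₂ z)) := rfl

theorem mulEt_tmul (p q : A) : H.mulEt (p ⊗ₜ q) = (H.et q).right p := (H.et_right_eq q p).symm

theorem mulEt_R₂ (c b : A) : H.mulEt (H.R₂ (c ⊗ₜ b)) = c * H.S b := by
  rw [mulEt_apply, H.T₂_R₂, H.mul'_S_ER]

theorem mulEt_mulLeft (c : A) (z : A ⊗[ℂ] A) : H.mulEt ((𝓛 c).rTensor A z) = c * H.mulEt z :=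
  tensor_induction (f := H.mulEt ∘ₗ (𝓛 c).rTensor A) (g := 𝓛 c ∘ₗ H.mulEt) (fun p q => by
    simp [mulEt_tmul, Multiplier.right_mul_apply H.nondeg]) z

/-- The left side is `∑ pS(a₁)ε_t(a₂q)`. By `et_mul` one may replace `q` by `ε_t(q)`, which then
passes through `T₂` and `E` to the first leg as a target multiplier. -/
theorem mulEt_mulRight_R₂ (p a q : A) :
    H.mulEt ((𝓡 q).lTensor A (H.R₂ (p ⊗ₜ a))) = (H.et q).right p * H.S a := by
  have h₁ : ∀ z, H.mulEt ((𝓡 q).lTensor A z) = H.mulEt ((H.et q).right.lTensor A z) := fun z =>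
    tensor_induction (f := H.mulEt ∘ₗ (𝓡 q).lTensor A)
      (g := H.mulEt ∘ₗ (H.et q).right.lTensor A)
      (fun r s => by simp [mulEt_tmul, H.et_mul]) z
  have h₂ : ∀ z, H.T₂ ((H.et q).right.lTensor A z) = (H.et q).right.rTensor A (H.T₂ z) := fun z =>
    tensor_induction (f := H.T₂ ∘ₗ (H.et q).right.lTensor A)
      (g := (H.et q).right.rTensor A ∘ₗ H.T₂)
      (fun r s => (H.isTarget_et q).T₂_right s r) z
  rw [h₁, mulEt_apply, h₂, H.T₂_R₂, ← (H.isTarget_et q).ER_rTensor_right, LinearMap.rTensor_tmul,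
    mul'_S_ER]

/-- The antipode is anti-multiplicative. -/
theorem S_mul_rev (a b : A) : H.S (a * b) = H.S b * H.S a := by
  refine H.nondeg.eq_of_mul_left fun c => ?_
  -- Formally `∑ p q₁ S(a q₂) = p ε_t(q) S(a)` for `w = p ⊗ q`, obtained without yet splitting `S(a
  -- q₂)`.
  have h : ∀ w, LinearMap.mul' ℂ A (H.S.toLinearMap.lTensor A ((𝓛 a).lTensor A (H.T₂ w)))
      = H.mulEt w * H.S a := fun w => by
    refine tensor_induction
      (f := LinearMap.mul' ℂ A ∘ₗ H.S.toLinearMap.lTensor A ∘ₗ (𝓛 a).lTensor A ∘ₗ H.T₂)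
      (g := 𝓡 (H.S a) ∘ₗ H.mulEt) (fun p q => ?_) w
    simp only [LinearMap.comp_apply, LinearMap.mulRight_apply]
    rw [H.mulLeft_T₂, ← H.DR_ER, ← H.T₂_R₂, H.DR_T₂, ← mulEt_apply, mulEt_mulRight_R₂, mulEt_tmul]
  -- For this `w`, `T₂w = (c ⊗ b)E`, so the left side collapses to `cS(ab)`, and the right side to
  -- `cS(b)S(a)`.
  have h₁ := h (H.R₂ (c ⊗ₜ b))
  rw [H.T₂_R₂, ← H.ER_mulLeft₂, LinearMap.lTensor_tmul, LinearMap.mulLeft_apply, mul'_S_ER,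
    mulEt_R₂] at h₁
  rw [h₁, mul_assoc]

theorem S_symm_mul_rev (a b : A) : H.S.symm (a * b) = H.S.symm b * H.S.symm a := by
  apply H.S.injective
  simp [S_mul_rev]

/-- The extension of the antipode to the multiplier algebra. -/
def SM (x : Multiplier A) : Multiplier A :=
  Multiplier.mk' (H.S.toLinearMap ∘ₗ x.right ∘ₗ H.S.symm.toLinearMap)
    (H.S.toLinearMap ∘ₗ x.left ∘ₗ H.S.symm.toLinearMap) fun a b => by
      obtain ⟨a, rfl⟩ := H.S.surjective a
      obtain ⟨b, rfl⟩ := H.S.surjective b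
      simp [← S_mul_rev, x.right_apply_mul]

@[simp]
theorem SM_right_S (x : Multiplier A) (a : A) : (H.SM x).right (H.S a) = H.S (x.left a) := by
  simp [SM]

theorem range_mulEt : LinearMap.range H.mulEt = ⊤ := by
  rw [eq_top_iff, ← H.idem, Submodule.span_le]
  rintro _ ⟨a, b, rfl⟩
  exact ⟨H.R₂ (a ⊗ₜ H.S.symm b), by simp [mulEt_R₂]⟩

/-- The elements `c ε_t(y)` span `A`. -/
theorem ext_et_right {W : Type*} [AddCommGroup W] [Module ℂ W] {f g : A →ₗ[ℂ] W}
    (h : ∀ c y, f ((H.et y).right c) = g ((H.et y).right c)) : f = g := by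
  ext a
  obtain ⟨z, rfl⟩ := LinearMap.range_eq_top.1 H.range_mulEt a
  refine tensor_induction (f := f ∘ₗ H.mulEt) (g := g ∘ₗ H.mulEt) (fun c y => ?_) z
  simp [mulEt_tmul, h]

/-- The elements `ε_t(y) c` span `A`. -/
theorem ext_et_left {W : Type*} [AddCommGroup W] [Module ℂ W] {f g : A →ₗ[ℂ] W}
    (h : ∀ c y, f ((H.et y).left c) = g ((H.et y).left c)) : f = g := by
  ext a
  obtain ⟨z, rfl⟩ := LinearMap.range_eq_top.1 H.idem.range_mul' a
  rw [← H.mul'_et_T₁, ← H.sliceLeft_EL]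
  exact tensor_induction (f := f ∘ₗ sliceLeft H.ε ∘ₗ H.EL) (g := g ∘ₗ sliceLeft H.ε ∘ₗ H.EL)
    (fun c y => h y c) _

/-- Since `Δ(yb) = (1 ⊗ y)Δ(b)`, the multiplier `y` enters `∑ b₁S(b₂)` inside the antipode and
leaves it on the right. -/
theorem IsSource.et_left {y : Multiplier A} (hy : H.IsSource y) (b : A) :
    H.et (y.left b) = H.et b * H.SM y := by
  refine Multiplier.ext_right H.nondeg fun p => ?_
  rw [Multiplier.right_mul, LinearMap.comp_apply, et_right_eq, et_right_eq, hy.T₂_left]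
  refine tensor_induction
    (f := LinearMap.mul' ℂ A ∘ₗ H.S.toLinearMap.lTensor A ∘ₗ y.left.lTensor A)
    (g := (H.SM y).right ∘ₗ LinearMap.mul' ℂ A ∘ₗ H.S.toLinearMap.lTensor A) (fun u v => ?_) _
  simp [Multiplier.right_mul_apply H.nondeg]

theorem IsTarget.et_left {x : Multiplier A} (hx : H.IsTarget x) (b : A) :
    H.et (x.left b) = x * H.et b := by
  refine Multiplier.ext_right H.nondeg fun p => ?_
  rw [Multiplier.right_mul, LinearMap.comp_apply, et_right_eq, et_right_eq, hx.T₂_left]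

theorem mulEt_S_T₁ (a y : A) :
    H.mulEt (H.S.toLinearMap.rTensor A (H.T₁ (a ⊗ₜ y))) = (H.et y).left (H.S a) := by
  refine H.nondeg.eq_of_mul_left fun c => ?_
  rw [← mulEt_mulLeft, ← LinearMap.rTensor_comp_apply, ← H.mulRight_R₂, mulEt_mulRight_R₂,
    Multiplier.right_apply_mul]

/-- `ε_t(S(a)) = S(ε_s(a))`. -/
theorem et_S (a : A) : H.et (H.S a) = H.SM (H.es a) := by
  -- Both sides are `∑ ε_t(S(a₁)a₂y)`: on the left through `ε_t(y)S(a) = ∑ S(a₁)ε_t(a₂y)` and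
  -- `et_mul`, on the right as `ε_t(ε_s(a)y)`.
  have h : ∀ y, H.et y * H.et (H.S a) = H.et y * H.SM (H.es a) := fun y => by
    rw [← (H.isTarget_et y).et_left, ← (H.isSource_es a).et_left, ← mulEt_S_T₁, es_left_eq]
    generalize H.S.toLinearMap.rTensor A (H.T₁ (a ⊗ₜ y)) = z
    exact tensor_induction (f := H.et ∘ₗ H.mulEt) (g := H.et ∘ₗ LinearMap.mul' ℂ A)
      (fun p q => by simp [mulEt_tmul, et_mul]) z
  refine Multiplier.ext_right H.nondeg fun b => LinearMap.congr_fun (H.ext_et_right ?_) b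
  exact fun c y => congrArg (fun m => m.right c) (h y)

theorem SM_op (x : Multiplier A) : H.op.SM x.op = (H.SM x).op := rfl

/-- `ε_s(S(a)) = S(ε_t(a))`. -/
theorem es_S (a : A) : H.es (H.S a) = H.SM (H.et a) := by
  apply Multiplier.op_injective
  rw [← op_et, ← SM_op, ← op_es]
  exact H.op.et_S (MulOpposite.op a)


/-! ### The elements `Δ(a)(b ⊗ 1)` and the range they span -/

/-- `T₃(b ⊗ a) = Δ(a)(b ⊗ 1)`. -/
def T₃ : A ⊗[ℂ] A →ₗ[ℂ] A ⊗[ℂ] A :=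
  H.S.symm.toLinearMap.rTensor A ∘ₗ H.R₂ ∘ₗ H.S.toLinearMap.rTensor A

theorem mulRight_T₃ (a b c : A) : (𝓡 c).lTensor A (H.T₃ (b ⊗ₜ a)) = H.DL a (b ⊗ₜ c) := by
  rw [T₃, LinearMap.comp_apply, LinearMap.comp_apply, LinearMap.rTensor_tmul,
    ← rTensor_lTensor_comm, mulRight_R₂, ← LinearMap.rTensor_comp_apply, ← H.mulRight_T₁]
  congr 2
  ext x
  simp [S_symm_mul_rev]

theorem EL_T₃ (z : A ⊗[ℂ] A) : H.EL (H.T₃ z) = H.T₃ z := by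
  refine tensor_induction (f := H.EL ∘ₗ H.T₃) (fun b a => ?_) z
  refine H.nondeg.eq_of_lTensor_mulRight fun c => ?_
  rw [LinearMap.comp_apply, ← H.EL_mulRight₂, mulRight_T₃, H.EL_DL]

/-- The identity `E(y ⊗ 1) = E(1 ⊗ S(y))`: both factors enter `(c ⊗ 1)E(v ⊗ q) = ∑ cv₁ ⊗ ε_t(v₂)q`
as `ε_t(v₂)S(y)`. -/
theorem IsSource.EL_left {y : Multiplier A} (hy : H.IsSource y) (v q : A) :
    H.EL (y.left v ⊗ₜ q) = H.EL (v ⊗ₜ (H.SM y).left q) := by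
  refine H.nondeg.eq_of_rTensor_mulLeft fun c => ?_
  rw [H.mulLeft_EL, H.mulLeft_EL, hy.T₂_left, ← LinearMap.lTensor_comp_apply]
  congr 2
  ext b
  simp [hy.et_left]

theorem et_left_eq (a b : A) : (H.et a).left b = LinearMap.mul' ℂ A (H.R₁ (a ⊗ₜ b)) := by
  rw [et_left, sliceLeft_EL]

theorem mulRight_G₂_S (v x c : A) :
    (𝓡 c).lTensor A (H.S.symm.toLinearMap.rTensor A (H.G₂ (H.S v ⊗ₜ x)))
      = (Multiplier.leftAt v ∘ₗ H.es ∘ₗ H.S.symm.toLinearMap).rTensor A (H.T₁ (x ⊗ₜ c)) := by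
  rw [← rTensor_lTensor_comm, H.mulRight_G₂, ← LinearMap.rTensor_comp_apply]
  congr 2
  ext p
  obtain ⟨p, rfl⟩ := H.S.surjective p
  simp [et_S]

theorem T₃_S_symm_T₂ (z : A ⊗[ℂ] A) :
    H.T₃ (H.S.symm.toLinearMap.rTensor A (H.T₂ (H.S.toLinearMap.rTensor A z)))
      = H.S.symm.toLinearMap.rTensor A (H.G₂ (H.S.toLinearMap.rTensor A z)) := by
  have h : ∀ w, H.S.toLinearMap.rTensor A (H.S.symm.toLinearMap.rTensor A w) = w := fun w =>
    tensor_induction (f := H.S.toLinearMap.rTensor A ∘ₗ H.S.symm.toLinearMap.rTensor A)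
      (g := LinearMap.id) (fun a b => by simp) w
  rw [T₃, LinearMap.comp_apply, LinearMap.comp_apply, h, H.R₂_T₂]

/-- `E (v ⊗ x) = (S⁻¹ ⊗ ι) G₂(S(v) ⊗ x)`. -/
theorem EL_eq_G₂ (v x : A) :
    H.EL (v ⊗ₜ x) = H.S.symm.toLinearMap.rTensor A (H.G₂ (H.S v ⊗ₜ x)) := by
  have h := H.T₃_S_symm_T₂ (v ⊗ₜ x)
  rw [LinearMap.rTensor_tmul] at h
  change _ = H.S.symm.toLinearMap.rTensor A (H.G₂ (H.S v ⊗ₜ x)) at h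
  -- The right side is a value of `T₃`, hence fixed by `E`; so both sides may be compared after
  -- applying `E`.
  rw [← h, ← EL_T₃, h]
  refine H.nondeg.eq_of_lTensor_mulRight fun c => ?_
  -- Covered by `c`, the right side is `E` applied to `∑ ε_s(S⁻¹(x₁))v ⊗ x₂c`. Moving the source
  -- element across `E` produces `ε_t(x₁)`, and `∑ ε_t(x₁)x₂c = xc`.
  rw [← H.EL_mulRight₂, ← H.EL_mulRight₂, mulRight_G₂_S, LinearMap.lTensor_tmul,
    LinearMap.mulRight_apply, ← LinearMap.mul'_apply (R := ℂ), ← H.mul'_et_T₁]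
  refine tensor_induction (f := H.EL ∘ₗ TensorProduct.mk ℂ A A v ∘ₗ LinearMap.mul' ℂ A ∘ₗ H.R₁)
    (g := H.EL ∘ₗ (Multiplier.leftAt v ∘ₗ H.es ∘ₗ H.S.symm.toLinearMap).rTensor A)
    (fun p q => ?_) _
  simp [(H.isSource_es _).EL_left, ← et_S, et_left_eq]

/-- Regularity makes the elements `Δ(a)(b ⊗ 1)` span all of `E(A ⊗ A)`, so statements about `Ez` can
be checked on them. -/
theorem exists_T₃ (z : A ⊗[ℂ] A) : ∃ w, H.T₃ w = H.EL z := by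
  refine ⟨_, (H.T₃_S_symm_T₂ z).trans ?_⟩
  exact tensor_induction (f := H.S.symm.toLinearMap.rTensor A ∘ₗ H.G₂ ∘ₗ H.S.toLinearMap.rTensor A)
    (fun v x => (H.EL_eq_G₂ v x).symm) z

end CanonicalMaps

/-! ### The pentagon equation and the coproduct of `S(a)` -/

section Legs

variable {X Y Z : A ⊗[ℂ] A →ₗ[ℂ] A ⊗[ℂ] A} (h : ∀ z, X (Y z) = Z z) (w : A ⊗[ℂ] (A ⊗[ℂ] A))
include h

theorem leg12_leg12 : leg12 X (leg12 Y w) = leg12 Z w := by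
  refine LinearMap.congr_fun (f := leg12 X ∘ₗ leg12 Y) (triple_ext fun a b c => ?_) w
  rw [LinearMap.comp_apply, leg12_tmul, leg12_tmul, ← h]
  simp [leg12]

theorem leg23_leg23 : leg23 X (leg23 Y w) = leg23 Z w := by
  refine LinearMap.congr_fun (f := leg23 X ∘ₗ leg23 Y) (triple_ext fun a b c => ?_) w
  rw [LinearMap.comp_apply, leg23_tmul, leg23_tmul, leg23_tmul, ← h]

theorem leg13_leg13 : leg13 X (leg13 Y w) = leg13 Z w := by
  refine LinearMap.congr_fun (f := leg13 X ∘ₗ leg13 Y) (triple_ext fun a b c => ?_) w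
  have h' : ∀ z : A ⊗[ℂ] A, TensorProduct.leftComm ℂ A A A (TensorProduct.leftComm ℂ A A A
      (b ⊗ₜ z)) = b ⊗ₜ z := fun z =>
    tensor_induction (f := (TensorProduct.leftComm ℂ A A A).toLinearMap ∘ₗ
      (TensorProduct.leftComm ℂ A A A).toLinearMap ∘ₗ TensorProduct.mk ℂ A (A ⊗[ℂ] A) b)
      (g := TensorProduct.mk ℂ A (A ⊗[ℂ] A) b) (fun p q => by simp) z
  rw [LinearMap.comp_apply, leg13_tmul, leg13_tmul, ← h]
  simp [leg13, h']

end Legs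

theorem rTensor_assoc (f : A →ₗ[ℂ] A) (z : A ⊗[ℂ] A) (c : A) :
    f.rTensor (A ⊗[ℂ] A) (TensorProduct.assoc ℂ A A A (z ⊗ₜ c))
      = TensorProduct.assoc ℂ A A A (f.rTensor A z ⊗ₜ c) := by
  induction z with
  | zero => simp
  | add x y hx hy => simp only [map_add, TensorProduct.add_tmul, hx, hy]
  | tmul p q => simp

theorem lTensor_rTensor_assoc (f : A →ₗ[ℂ] A) (z : A ⊗[ℂ] A) (c : A) :
    (f.rTensor A).lTensor A (TensorProduct.assoc ℂ A A A (z ⊗ₜ c))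
      = TensorProduct.assoc ℂ A A A (f.lTensor A z ⊗ₜ c) := by
  induction z with
  | zero => simp
  | add x y hx hy => simp only [map_add, TensorProduct.add_tmul, hx, hy]
  | tmul p q => simp

theorem rTensor_leftComm (f : A →ₗ[ℂ] A) (b : A) (z : A ⊗[ℂ] A) :
    f.rTensor (A ⊗[ℂ] A) (TensorProduct.leftComm ℂ A A A (b ⊗ₜ z))
      = TensorProduct.leftComm ℂ A A A (b ⊗ₜ f.rTensor A z) := by
  induction z with
  | zero => simp
  | add x y hx hy => simp only [map_add, TensorProduct.tmul_add, hx, hy]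
  | tmul p q => simp

namespace CanonicalMaps

variable (H : CanonicalMaps A)

/-- Coassociativity: both sides are the twofold coproduct of `a` applied to `z`, namely `∑ da₁ ⊗
Δ(a₂)z`. -/
theorem mulLeft_leg12_leg13 (a d : A) (z : A ⊗[ℂ] A) :
    (𝓛 d).rTensor (A ⊗[ℂ] A) (leg12 H.T₁ (leg13 H.T₁ (a ⊗ₜ z)))
      = (H.DL.flip z).lTensor A (H.T₂ (d ⊗ₜ a)) := by
  induction z with
  | zero => simp
  | add x y hx hy => simp only [map_add, TensorProduct.tmul_add, hx, hy, LinearMap.lTensor_add,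
      LinearMap.add_apply]
  | tmul p q =>
    have h := congrArg (((𝓡 p).rTensor A).lTensor A) (H.coassoc (d ⊗ₜ (a ⊗ₜ q)))
    rw [leg23_tmul, leg12_tmul] at h
    have h₁ : ∀ w : A ⊗[ℂ] A, ((𝓡 p).rTensor A).lTensor A (leg12 H.T₂ (d ⊗ₜ w))
        = (𝓛 d).rTensor (A ⊗[ℂ] A) (leg12 H.T₁ (TensorProduct.leftComm ℂ A A A (p ⊗ₜ w))) := by
      intro w
      induction w with
      | zero => simp
      | add x y hx hy => simp only [map_add, TensorProduct.tmul_add, hx, hy]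
      | tmul r s =>
        rw [TensorProduct.leftComm_tmul, leg12_tmul, leg12_tmul, lTensor_rTensor_assoc,
          rTensor_assoc, mulLeft_T₁]
    rw [leg13_tmul, ← h₁, h]
    generalize H.T₂ (d ⊗ₜ a) = t
    induction t with
    | zero => simp
    | add x y hx hy => simp only [map_add, TensorProduct.add_tmul, hx, hy]
    | tmul u v => simp [mulRight_T₁]

/-- The pentagon equation. -/
theorem pentagon (w : A ⊗[ℂ] (A ⊗[ℂ] A)) :
    leg12 H.T₁ (leg13 H.T₁ (leg23 H.T₁ w)) = leg23 H.T₁ (leg12 H.T₁ w) := by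
  refine LinearMap.congr_fun (f := leg12 H.T₁ ∘ₗ leg13 H.T₁ ∘ₗ leg23 H.T₁)
    (g := leg23 H.T₁ ∘ₗ leg12 H.T₁) (triple_ext fun a b c => ?_) w
  simp only [LinearMap.comp_apply]
  refine H.nondeg.eq_of_rTensor_mulLeft fun d => ?_
  rw [leg23_tmul, mulLeft_leg12_leg13, leg12_tmul, leg23, rTensor_lTensor_comm, rTensor_assoc,
    mulLeft_T₁]
  generalize H.T₂ (d ⊗ₜ a) = t
  induction t with
  | zero => simp
  | add x y hx hy => simp only [map_add, TensorProduct.add_tmul, hx, hy]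
  | tmul u v => simp [DL_T₁]

/-- As `G₁(a ⊗ b) = ∑ a₁ ⊗ ε_s(a₂)b`, this expresses the rule `Δ(ε_s(v)b) = (1 ⊗ ε_s(v))Δ(b)`. -/
theorem G₁_leg_T₁ (w : A ⊗[ℂ] (A ⊗[ℂ] A)) :
    leg13 H.G₁ (leg23 H.T₁ w) = leg23 H.T₁ (leg12 H.G₁ w) := by
  refine LinearMap.congr_fun (f := leg13 H.G₁ ∘ₗ leg23 H.T₁)
    (g := leg23 H.T₁ ∘ₗ leg12 H.G₁) (triple_ext fun a b c => ?_) w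
  simp only [LinearMap.comp_apply]
  refine H.nondeg.eq_of_rTensor_mulLeft fun d => ?_
  have h : ∀ z, (𝓛 d).rTensor (A ⊗[ℂ] A) (leg13 H.G₁ (a ⊗ₜ z))
      = (((LinearMap.lTensorHom A ∘ₗ
        (LinearMap.mk₂ ℂ (fun (m : Multiplier A) (b : A) => m.left b) (by simp) (by simp) (by simp)
          (by simp))) ∘ₗ H.es).flip z).lTensor A (H.T₂ (d ⊗ₜ a)) := by
    intro z
    induction z with
    | zero => simp
    | add x y hx hy => simp only [map_add, TensorProduct.tmul_add, hx, hy, LinearMap.lTensor_add,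
        LinearMap.add_apply]
    | tmul p q =>
      rw [leg13_tmul, rTensor_leftComm, mulLeft_G₁]
      generalize H.T₂ (d ⊗ₜ a) = t
      induction t with
      | zero => simp
      | add x y hx hy => simp only [map_add, TensorProduct.tmul_add, hx, hy]
      | tmul u v => rfl
  rw [leg23_tmul, h, leg12_tmul, leg23, rTensor_lTensor_comm, rTensor_assoc, mulLeft_G₁]
  generalize H.T₂ (d ⊗ₜ a) = t
  induction t with
  | zero => simp
  | add x y hx hy => simp only [map_add, TensorProduct.add_tmul, hx, hy]
  | tmul u v =>
    simp only [LinearMap.lTensor_tmul, LinearMap.comp_apply, LinearMap.flip_apply,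
      TensorProduct.assoc_tmul, Multiplier.leftAt_apply, (H.isSource_es v).T₁_left]
    rfl

/-- The pentagon equation solved for `R₁`. The projections left over by the generalized inverses are
harmless: those of the form `T₁R₁` become `E`, and those of the form `R₁T₁` act trivially on `Q`. -/
theorem leg_R₁ (w : A ⊗[ℂ] (A ⊗[ℂ] A)) :
    leg23 H.T₁ (leg12 H.R₁ (leg23 H.R₁ w)) = leg13 H.R₁ (leg12 H.R₁ (leg23 H.EL w)) := by
  set Q := leg23 H.T₁ (leg12 H.R₁ (leg23 H.R₁ w)) with hQ
  have h₁ : leg12 H.T₁ (leg13 H.T₁ Q) = leg12 H.EL (leg23 H.EL w) := by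
    rw [hQ, H.pentagon, leg12_leg12 H.T₁_R₁, ← H.EL_leg_T₁, leg23_leg23 H.T₁_R₁]
  have h₂ : leg13 H.R₁ (leg12 H.R₁ (leg12 H.T₁ (leg13 H.T₁ Q))) = Q := by
    rw [leg12_leg12 H.R₁_T₁, H.G₁_spec, leg13_leg13 H.R₁_T₁, hQ, leg23_leg23 H.EL_T₁,
      H.G₁_leg_T₁, leg12_leg12 H.G₁_R₁]
  rw [← h₂, h₁, leg12_leg12 H.R₁_EL]

/-- The map `b ⊗ c ↦ ∑ S(a₍₂₎) b ⊗ S(a₍₁₎) c`. -/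
def flipR₁ (a : A) : A ⊗[ℂ] A →ₗ[ℂ] A ⊗[ℂ] A :=
  (LinearMap.mul' ℂ A).lTensor A ∘ₗ (TensorProduct.assoc ℂ A A A).toLinearMap ∘ₗ
    ((TensorProduct.comm ℂ A A).toLinearMap ∘ₗ H.S.toLinearMap.rTensor A ∘ₗ H.R₁ ∘ₗ
      TensorProduct.mk ℂ A A a).rTensor A

theorem lTensor_mul'_assoc (z : A ⊗[ℂ] A) (c : A) :
    (LinearMap.mul' ℂ A).lTensor A (TensorProduct.assoc ℂ A A A (z ⊗ₜ c))
      = (𝓡 c).lTensor A z := by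
  induction z with
  | zero => simp
  | add x y hx hy => simp only [map_add, TensorProduct.add_tmul, hx, hy]
  | tmul p q => simp

theorem flipR₁_tmul (a b c : A) : H.flipR₁ a (b ⊗ₜ c)
    = (𝓡 c).lTensor A (TensorProduct.comm ℂ A A (H.S.toLinearMap.rTensor A (H.R₁ (a ⊗ₜ b)))) := by
  rw [← lTensor_mul'_assoc]
  rfl

/-- The counit applied to the first leg of `leg_R₁` turns `R₁` into left multiplication by the
antipode: once on one side, giving `Δ(S(a))Ez`, and twice on the other. -/
theorem DL_S_eq_flipR₁_EL (a : A) (z : A ⊗[ℂ] A) :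
    H.DL (H.S a) z = H.flipR₁ a (H.EL z) := by
  set s : A ⊗[ℂ] (A ⊗[ℂ] A) →ₗ[ℂ] A ⊗[ℂ] A :=
    (TensorProduct.lid ℂ (A ⊗[ℂ] A)).toLinearMap ∘ₗ H.ε.rTensor (A ⊗[ℂ] A) with hs
  have h := congrArg s (H.leg_R₁ (a ⊗ₜ z))
  rw [leg23_tmul, leg23_tmul] at h
  have h₁ : ∀ z, s (leg12 H.R₁ (a ⊗ₜ z)) = (𝓛 (H.S a)).rTensor A z := by
    intro z
    induction z with
    | zero => simp
    | add x y hx hy => simp only [map_add, TensorProduct.tmul_add, hx, hy]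
    | tmul b c =>
      rw [leg12_tmul, LinearMap.rTensor_tmul, LinearMap.mulLeft_apply, H.S_mul]
      generalize H.R₁ (a ⊗ₜ b) = t
      induction t with
      | zero => simp
      | add x y hx hy => simp only [map_add, TensorProduct.add_tmul, hx, hy]
      | tmul p q => simp [hs, TensorProduct.smul_tmul']
  have h₂ : ∀ w, s (leg23 H.T₁ w) = H.T₁ (s w) := fun w =>
    tensor_induction (f := s ∘ₗ leg23 H.T₁) (g := H.T₁ ∘ₗ s) (fun p q => by simp [hs]) w
  have h₃ : ∀ z, s (leg13 H.R₁ (leg12 H.R₁ (a ⊗ₜ z))) = H.flipR₁ a z := by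
    intro z
    induction z with
    | zero => simp
    | add x y hx hy => simp only [map_add, TensorProduct.tmul_add, hx, hy]
    | tmul b c =>
      rw [leg12_tmul, flipR₁_tmul]
      generalize H.R₁ (a ⊗ₜ b) = t
      induction t with
      | zero => simp
      | add x y hx hy => simp only [map_add, TensorProduct.add_tmul, hx, hy]
      | tmul p q =>
        simp only [TensorProduct.assoc_tmul, leg13_tmul, LinearMap.rTensor_tmul,
          TensorProduct.comm_tmul, LinearMap.lTensor_tmul, LinearMap.mulRight_apply,
          LinearEquiv.coe_coe, H.S_mul]
        generalize H.R₁ (p ⊗ₜ c) = t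
        induction t with
        | zero => simp
        | add x y hx hy => simp only [map_add, TensorProduct.tmul_add, hx, hy]
        | tmul r s => simp [hs]
  rw [h₂, h₁, ← H.DL_T₁, H.T₁_R₁, H.DL_EL, h₃] at h
  exact h

/-- The mirror image of `IsSource.EL_left`: `(S(x) ⊗ 1)E = (1 ⊗ x)E`. -/
theorem IsTarget.T₂_SM {x : Multiplier A} (hx : H.IsTarget x) (a c : A) :
    H.T₂ ((H.SM x).right c ⊗ₜ a) = x.left.lTensor A (H.T₂ (c ⊗ₜ a)) := by
  refine H.nondeg.eq_of_lTensor_mulLeft fun v => ?_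
  have h : H.ER ((H.SM x).right c ⊗ₜ v) = H.ER (c ⊗ₜ x.right v) := by
    apply (rev₂ A).injective
    rw [← op_EL_rev₂, ← op_EL_rev₂]
    exact (IsSource.EL_left H.op hx.op (MulOpposite.op v) (MulOpposite.op c)).symm
  rw [mulLeft_T₂, ← H.DR_ER, h, H.DR_ER, ← mulLeft_T₂, ← LinearMap.lTensor_comp_apply,
    Multiplier.mulLeft_right_apply]

theorem IsTarget.R₁_SM {x : Multiplier A} (hx : H.IsTarget x) (a b : A) :
    H.R₁ (a ⊗ₜ (H.SM x).left b) = (H.SM x).left.rTensor A (H.R₁ (a ⊗ₜ b)) := by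
  refine H.nondeg.eq_of_rTensor_mulLeft fun c => ?_
  rw [mulLeft_R₁, ← LinearMap.rTensor_comp_apply, ← Multiplier.mulLeft_right_apply, mulLeft_R₁,
    hx.T₂_SM, ← LinearMap.lTensor_comp_apply]
  congr 2
  ext u
  simp [← Multiplier.right_apply_mul]

theorem flipR₁_mulRight (a c : A) (z : A ⊗[ℂ] A) :
    H.flipR₁ a ((𝓡 c).lTensor A z) = (𝓡 c).lTensor A (H.flipR₁ a z) := by
  refine tensor_induction (f := H.flipR₁ a ∘ₗ (𝓡 c).lTensor A)
    (g := (𝓡 c).lTensor A ∘ₗ H.flipR₁ a) (fun u v => ?_) z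
  simp only [LinearMap.comp_apply, LinearMap.lTensor_tmul, flipR₁_tmul,
    ← LinearMap.lTensor_comp_apply]
  congr 2
  ext u
  simp [mul_assoc]

/-- `E(v ⊗ x)(1 ⊗ c) = ∑ ε_s(S⁻¹(x₁))v ⊗ x₂c`. In `flipR₁ a` the source element passes through `R₁`
and the outer `S` and reappears as `ε_t(x₁)` in front of `x₂c`, where it is absorbed by `∑ ε_t(x₁)x₂
= x`. -/
theorem flipR₁_EL (a : A) (z : A ⊗[ℂ] A) : H.flipR₁ a (H.EL z) = H.flipR₁ a z := by
  refine tensor_induction (f := H.flipR₁ a ∘ₗ H.EL) (fun v x => ?_) z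
  refine H.nondeg.eq_of_lTensor_mulRight fun c => ?_
  rw [LinearMap.comp_apply, ← flipR₁_mulRight, EL_eq_G₂, mulRight_G₂_S, ← flipR₁_mulRight,
    LinearMap.lTensor_tmul, LinearMap.mulRight_apply, ← LinearMap.mul'_apply (R := ℂ),
    ← H.mul'_et_T₁]
  refine tensor_induction
    (f := H.flipR₁ a ∘ₗ (Multiplier.leftAt v ∘ₗ H.es ∘ₗ H.S.symm.toLinearMap).rTensor A)
    (g := H.flipR₁ a ∘ₗ TensorProduct.mk ℂ A A v ∘ₗ LinearMap.mul' ℂ A ∘ₗ H.R₁) (fun p q => ?_) _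
  obtain ⟨p, rfl⟩ := H.S.surjective p
  obtain ⟨p, rfl⟩ := H.S.surjective p
  simp only [LinearMap.comp_apply, LinearMap.rTensor_tmul, LinearEquiv.coe_coe,
    LinearEquiv.symm_apply_apply, Multiplier.leftAt_apply, TensorProduct.mk_apply, ← et_left_eq,
    flipR₁_tmul]
  rw [es_S, IsTarget.R₁_SM H (H.isTarget_et p), ← es_S]
  generalize H.R₁ (a ⊗ₜ v) = t
  induction t with
  | zero => simp
  | add x y hx hy => simp only [map_add, hx, hy]
  | tmul r s => simp [et_S, ← Multiplier.right_apply_mul]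

/-- The antipode flips the coproduct. -/
theorem T₁_S (b p : A) : H.T₁ (H.S b ⊗ₜ H.S p)
    = TensorProduct.comm ℂ A A (TensorProduct.map H.S.toLinearMap H.S.toLinearMap
      (H.T₂ (p ⊗ₜ b))) := by
  refine H.nondeg.eq_of_rTensor_mulRight fun d => ?_
  rw [mulRight_T₁, DL_S_eq_flipR₁_EL, flipR₁_EL, flipR₁_tmul]
  have h₁ : ∀ z : A ⊗[ℂ] A, (𝓡 (H.S p)).lTensor A (TensorProduct.comm ℂ A A
      (H.S.toLinearMap.rTensor A z)) = TensorProduct.comm ℂ A A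
      (H.S.toLinearMap.rTensor A ((𝓛 p).rTensor A z)) := fun z =>
    tensor_induction (f := (𝓡 (H.S p)).lTensor A ∘ₗ (TensorProduct.comm ℂ A A).toLinearMap ∘ₗ
      H.S.toLinearMap.rTensor A) (g := (TensorProduct.comm ℂ A A).toLinearMap ∘ₗ
      H.S.toLinearMap.rTensor A ∘ₗ (𝓛 p).rTensor A) (fun u v => by simp [S_mul_rev]) z
  rw [h₁, mulLeft_R₁]
  refine tensor_induction (f := (TensorProduct.comm ℂ A A).toLinearMap ∘ₗ
      H.S.toLinearMap.rTensor A ∘ₗ (𝓡 d ∘ₗ H.S.toLinearMap).lTensor A)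
    (g := (𝓡 d).rTensor A ∘ₗ (TensorProduct.comm ℂ A A).toLinearMap ∘ₗ
      TensorProduct.map H.S.toLinearMap H.S.toLinearMap) (fun u v => ?_) _
  simp

theorem T₂_S (b p : A) : H.T₂ (H.S p ⊗ₜ H.S b)
    = TensorProduct.comm ℂ A A (TensorProduct.map H.S.toLinearMap H.S.toLinearMap
      (H.T₁ (b ⊗ₜ p))) := by
  apply (rev₂ A).injective
  rw [← op_T₁_rev₂]
  refine (H.op.T₁_S (MulOpposite.op b) (MulOpposite.op p)).trans ?_
  rw [← rev₂_tmul, op_T₂_rev₂]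
  refine tensor_induction (f := (TensorProduct.comm ℂ _ _).toLinearMap ∘ₗ
      TensorProduct.map H.op.S.toLinearMap H.op.S.toLinearMap ∘ₗ (rev₂ A).toLinearMap)
    (g := (rev₂ A).toLinearMap ∘ₗ (TensorProduct.comm ℂ A A).toLinearMap ∘ₗ
      TensorProduct.map H.S.toLinearMap H.S.toLinearMap) (fun u v => ?_) _
  rfl

end CanonicalMaps

/-! ### Strong left invariance -/

theorem sliceRight_rTensor (ω : A →ₗ[ℂ] ℂ) (f : A →ₗ[ℂ] A) (z : A ⊗[ℂ] A) :
    sliceRight ω (f.rTensor A z) = f (sliceRight ω z) :=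
  tensor_induction (f := sliceRight ω ∘ₗ f.rTensor A) (g := f ∘ₗ sliceRight ω)
    (fun a b => by simp) z

theorem sliceLeft_lTensor (ω : A →ₗ[ℂ] ℂ) (f : A →ₗ[ℂ] A) (z : A ⊗[ℂ] A) :
    sliceLeft ω (f.lTensor A z) = f (sliceLeft ω z) :=
  tensor_induction (f := sliceLeft ω ∘ₗ f.lTensor A) (g := f ∘ₗ sliceLeft ω)
    (fun a b => by simp) z

namespace CanonicalMaps

variable (H : CanonicalMaps A)

theorem T₂_mulLeft (c : A) (z : A ⊗[ℂ] A) :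
    H.T₂ ((𝓛 c).rTensor A z) = (𝓛 c).rTensor A (H.T₂ z) := by
  apply (rev₂ A).injective
  rw [rev₂_rTensor, ← op_T₁_rev₂, ← op_T₁_rev₂, rev₂_rTensor, conj_mulLeft]
  exact H.op.T₁_mulRight _ _

/-- `(d ⊗ 1)Δ(p)(e ⊗ 1)`, in two ways. -/
theorem mulLeft_T₃ (d e p : A) :
    (𝓛 d).rTensor A (H.T₃ (e ⊗ₜ p)) = (𝓡 e).rTensor A (H.T₂ (d ⊗ₜ p)) := by
  refine H.nondeg.eq_of_lTensor_mulRight fun c => ?_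
  rw [← rTensor_lTensor_comm, mulRight_T₃, ← mulRight_T₁, ← rTensor_lTensor_comm, ← mulLeft_T₁,
    ← LinearMap.rTensor_comp_apply, ← LinearMap.rTensor_comp_apply]
  congr 2
  ext u
  simp [mul_assoc]

/-- `Δ⁽²⁾(p)(z ⊗ c)`, in two ways. -/
theorem mulRight_leg_T₃ (z : A ⊗[ℂ] A) (p c : A) :
    ((𝓡 c).lTensor A).lTensor A (leg23 H.T₃ (leg13 H.T₃ (TensorProduct.assoc ℂ A A A (z ⊗ₜ p))))
      = TensorProduct.assoc ℂ A A A ((H.DL.flip z).rTensor A (H.T₁ (p ⊗ₜ c))) := by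
  induction z with
  | zero => simp
  | add x y hx hy => simp only [map_add, TensorProduct.add_tmul, hx, hy, LinearMap.rTensor_add,
      LinearMap.add_apply]
  | tmul e y =>
    rw [TensorProduct.assoc_tmul, leg13_tmul]
    refine H.nondeg.eq_of_rTensor_mulLeft fun d => ?_
    have h := congrArg (TensorProduct.map (𝓡 e) ((𝓡 y).rTensor A)) (H.coassoc (d ⊗ₜ (p ⊗ₜ c)))
    rw [leg23_tmul, leg12_tmul] at h
    have h₁ : ∀ w : A ⊗[ℂ] A, TensorProduct.map (𝓡 e) ((𝓡 y).rTensor A) (leg12 H.T₂ (d ⊗ₜ w))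
        = (𝓛 d).rTensor (A ⊗[ℂ] A) (TensorProduct.assoc ℂ A A A
          ((H.DL.flip (e ⊗ₜ y)).rTensor A w)) := by
      intro w
      induction w with
      | zero => simp
      | add x y hx hy => simp only [map_add, TensorProduct.tmul_add, hx, hy]
      | tmul s t =>
        rw [leg12_tmul, LinearMap.rTensor_tmul, rTensor_assoc, LinearMap.flip_apply, ← H.T₂_mul,
          mul_tmul_eq]
        generalize H.T₂ (d ⊗ₜ s) = t'
        induction t' with
        | zero => simp
        | add x y hx hy => simp only [map_add, TensorProduct.add_tmul, hx, hy]
        | tmul u v => simp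
    rw [← h₁, h]
    have h₂ : ∀ t : A ⊗[ℂ] A, (𝓛 d).rTensor (A ⊗[ℂ] A) (((𝓡 c).lTensor A).lTensor A
        (leg23 H.T₃ (TensorProduct.leftComm ℂ A A A (y ⊗ₜ t))))
        = (H.DL.flip (y ⊗ₜ c)).lTensor A ((𝓛 d).rTensor A t) := by
      intro t
      induction t with
      | zero => simp
      | add x y hx hy => simp only [map_add, TensorProduct.tmul_add, hx, hy]
      | tmul u v => simp [mulRight_T₃]
    rw [h₂, mulLeft_T₃]
    generalize H.T₂ (d ⊗ₜ p) = t
    induction t with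
    | zero => simp
    | add x y hx hy => simp only [map_add, TensorProduct.add_tmul, hx, hy]
    | tmul u v => simp [mulRight_T₁]

/-- The twofold coproduct of `p` absorbs `E ⊗ 1` on its right, because `Δ(s)E = Δ(s)`. -/
theorem T₃_leg_EL (z : A ⊗[ℂ] A) (p : A) :
    leg23 H.T₃ (leg13 H.T₃ (TensorProduct.assoc ℂ A A A (H.EL z ⊗ₜ p)))
      = leg23 H.T₃ (leg13 H.T₃ (TensorProduct.assoc ℂ A A A (z ⊗ₜ p))) := by
  refine eq_of_lTensor (fun c : A => (𝓡 c).lTensor A) (fun m hm =>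
    H.nondeg.eq_of_lTensor_mulRight fun c => (hm c).trans (map_zero _).symm) fun c => ?_
  rw [mulRight_leg_T₃, mulRight_leg_T₃]
  congr 3
  ext s
  exact H.DL_EL s z

/-- Multiplicativity of `Δ ⊗ ι`: the twofold coproduct of `p` times `Δ(s) ⊗ 1` is `Δ ⊗ ι` applied to
`Δ(p)(s ⊗ 1)`. -/
theorem T₃_leg_T₁ (s t p : A) :
    leg23 H.T₃ (leg13 H.T₃ (TensorProduct.assoc ℂ A A A (H.T₁ (s ⊗ₜ t) ⊗ₜ p)))
      = leg12 H.T₁ (leg13 H.T₃ (s ⊗ₜ (t ⊗ₜ p))) := by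
  refine eq_of_lTensor (fun c : A => (𝓡 c).lTensor A) (fun m hm =>
    H.nondeg.eq_of_lTensor_mulRight fun c => (hm c).trans (map_zero _).symm) fun c => ?_
  rw [mulRight_leg_T₃, leg13_tmul]
  have h : ∀ w : A ⊗[ℂ] A, ((𝓡 c).lTensor A).lTensor A
      (leg12 H.T₁ (TensorProduct.leftComm ℂ A A A (t ⊗ₜ w)))
      = leg12 H.T₁ (TensorProduct.leftComm ℂ A A A (t ⊗ₜ (𝓡 c).lTensor A w)) := by
    intro w
    induction w with
    | zero => simp
    | add x y hx hy => simp only [map_add, TensorProduct.tmul_add, hx, hy]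
    | tmul u v =>
      simp only [TensorProduct.leftComm_tmul, LinearMap.lTensor_tmul, leg12_tmul]
      generalize H.T₁ (u ⊗ₜ t) = t'
      induction t' with
      | zero => simp
      | add x y hx hy => simp only [map_add, TensorProduct.add_tmul, hx, hy]
      | tmul u v => simp
  rw [h, mulRight_T₃, ← mulRight_T₁]
  generalize H.T₁ (p ⊗ₜ c) = w
  induction w with
  | zero => simp
  | add x y hx hy => simp only [map_add, TensorProduct.tmul_add, hx, hy]
  | tmul u v => simp [leg12_tmul, DL_T₁]

/-- The slices `(ι ⊗ φ)Δ(a)` are multipliers of the target algebra. -/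
def IsLeftInvariant (φ : A →ₗ[ℂ] ℂ) : Prop :=
  ∀ a, ∃ x : Multiplier A, H.IsTarget x ∧ (∀ b, x.right b = sliceRight φ (H.T₂ (b ⊗ₜ a))) ∧
    ∀ b, x.left b = sliceRight φ (H.T₃ (b ⊗ₜ a))

section LeftInvariant

variable {H} {φ : A →ₗ[ℂ] ℂ} (hφ : H.IsLeftInvariant φ)
include hφ

/-- This is `Δ(x) = (x ⊗ 1)E` for `x = (ι ⊗ φ)Δ(p)`, applied to `e ⊗ y`. Inserting `E` replaces `e ⊗
y` by values of `T₁`, and there `Δ(xs) = (x ⊗ 1)Δ(s)` applies. -/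
theorem IsLeftInvariant.lTensor_T₃ (p e y : A) {x : Multiplier A} (hx : H.IsTarget x)
    (hxp : ∀ b, x.left b = sliceRight φ (H.T₃ (b ⊗ₜ p))) :
    (sliceRight φ ∘ₗ H.T₃ ∘ₗ TensorProduct.mk ℂ A A y).lTensor A (H.T₃ (e ⊗ₜ p))
      = x.left.rTensor A (H.EL (e ⊗ₜ y)) := by
  have h₁ : (sliceRight φ).lTensor A (leg23 H.T₃ (leg13 H.T₃
      (TensorProduct.assoc ℂ A A A ((e ⊗ₜ y) ⊗ₜ p))))
      = (sliceRight φ ∘ₗ H.T₃ ∘ₗ TensorProduct.mk ℂ A A y).lTensor A (H.T₃ (e ⊗ₜ p)) := by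
    rw [TensorProduct.assoc_tmul, leg13_tmul]
    generalize H.T₃ (e ⊗ₜ p) = t
    induction t with
    | zero => simp
    | add x y hx hy => simp only [map_add, TensorProduct.tmul_add, hx, hy]
    | tmul u v => simp
  have h₂ : ∀ w, (sliceRight φ).lTensor A (leg23 H.T₃ (leg13 H.T₃
      (TensorProduct.assoc ℂ A A A (H.T₁ w ⊗ₜ p)))) = x.left.rTensor A (H.T₁ w) := by
    intro w
    induction w with
    | zero => simp
    | add x y hx hy => simp only [map_add, TensorProduct.add_tmul, hx, hy]
    | tmul s t =>
      rw [T₃_leg_T₁, leg13_tmul, ← hx.T₁_left, hxp]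
      generalize H.T₃ (s ⊗ₜ p) = w
      induction w with
      | zero => simp
      | add x y hx hy => simp only [map_add, TensorProduct.add_tmul, TensorProduct.tmul_add, hx, hy]
      | tmul u v =>
        rw [TensorProduct.leftComm_tmul, leg12_tmul, lTensor_sliceRight_assoc, sliceRight_tmul,
          ← TensorProduct.smul_tmul', map_smul]
  rw [← h₁, ← T₃_leg_EL, ← H.T₁_R₁, h₂]

/-- On `Ez = Δ(p)(e ⊗ 1) = ∑ u ⊗ v` the left side, times `y`, is `∑ S(u)((ι ⊗ φ)Δ(v))y`. By
`lTensor_T₃` it comes from `E(xe ⊗ y)`, on which `mul'_S_EL` returns `S(xe)y`. -/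
theorem IsLeftInvariant.sliceRight_T₂_S (z : A ⊗[ℂ] A) :
    sliceRight φ (H.T₂ (H.S.toLinearMap.rTensor A (H.EL z))) = H.S (sliceRight φ (H.EL z)) := by
  obtain ⟨w, hw⟩ := H.exists_T₃ z
  rw [← hw]
  refine tensor_induction (f := sliceRight φ ∘ₗ H.T₂ ∘ₗ H.S.toLinearMap.rTensor A ∘ₗ H.T₃)
    (g := H.S.toLinearMap ∘ₗ sliceRight φ ∘ₗ H.T₃) (fun e p => ?_) w
  simp only [LinearMap.comp_apply, LinearEquiv.coe_coe]
  refine H.nondeg.eq_of_mul_right fun y => ?_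
  obtain ⟨x, hx, -, hxp⟩ := hφ p
  have h₁ : ∀ t, LinearMap.mul' ℂ A (H.S.toLinearMap.rTensor A
      ((sliceRight φ ∘ₗ H.T₃ ∘ₗ TensorProduct.mk ℂ A A y).lTensor A t))
      = sliceRight φ (H.T₂ (H.S.toLinearMap.rTensor A t)) * y := fun t => by
    refine tensor_induction (f := LinearMap.mul' ℂ A ∘ₗ H.S.toLinearMap.rTensor A ∘ₗ
      (sliceRight φ ∘ₗ H.T₃ ∘ₗ TensorProduct.mk ℂ A A y).lTensor A)
      (g := 𝓡 y ∘ₗ sliceRight φ ∘ₗ H.T₂ ∘ₗ H.S.toLinearMap.rTensor A) (fun u v => ?_) t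
    obtain ⟨x, -, h, h'⟩ := hφ v
    simp [← h, ← h', x.right_apply_mul]
  rw [← h₁, hφ.lTensor_T₃ p e y hx hxp, ← hx.EL_rTensor_left, LinearMap.rTensor_tmul, mul'_S_EL,
    hxp]

/-- `(ι ⊗ φ)((c ⊗ a)Δ(b)) = c S((ι ⊗ φ)(Δ(a)(1 ⊗ b)))`. -/
theorem IsLeftInvariant.sliceRight_mulLeft_T₂ (a b c : A) :
    sliceRight φ ((𝓛 a).lTensor A (H.T₂ (c ⊗ₜ b))) = c * H.S (sliceRight φ (H.T₁ (a ⊗ₜ b))) := by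
  -- `(c ⊗ a)Δ(b) = (c ⊗ a)EΔ(b) = T₂(R₂(c ⊗ a)(1 ⊗ b))`, and `R₂(c ⊗ a)(1 ⊗ b) = ∑ cS(a₁) ⊗ a₂b` is
  -- `T₁(a ⊗ b)` with `cS(·)` applied to its first leg.
  rw [← H.EL_T₁, ← hφ.sliceRight_T₂_S, H.EL_T₁, ← LinearMap.mulLeft_apply (R := ℂ),
    ← sliceRight_rTensor, ← T₂_mulLeft, ← LinearMap.rTensor_comp_apply, ← mulRight_R₂, ← H.DR_T₂,
    H.T₂_R₂, H.DR_ER, mulLeft_T₂]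

end LeftInvariant

end CanonicalMaps

/-! ### The modular automorphism -/

/-- A faithful functional `φ` with `φ(A ·) = φ(· A)` has a modular automorphism. -/
theorem IsFaithful.exists_modular_automorphism {φ : A →ₗ[ℂ] ℂ} (hφ : IsFaithful φ)
    (hA : Idempotent A) (h₁ : ∀ a, ∃ a', ∀ b, φ (a * b) = φ (b * a'))
    (h₂ : ∀ a', ∃ a, ∀ b, φ (a * b) = φ (b * a')) :
    ∃ σ : A →ₙₐ[ℂ] A, Function.Bijective σ ∧
      (∀ a b : A, φ (a * b) = φ (b * σ a)) ∧ (∀ a : A, φ (σ a) = φ a) := by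
  choose σ hσ using h₁
  have huniq : ∀ {x y : A}, (∀ b, φ (b * x) = φ (b * y)) → x = y := fun {x y} h =>
    sub_eq_zero.1 <| hφ.2 _ fun b => by rw [mul_sub, map_sub, h, sub_self]
  have hinj : Function.Injective σ := fun x y h =>
    sub_eq_zero.1 <| hφ.1 _ fun b => by rw [sub_mul, map_sub, hσ x, hσ y, h, sub_self]
  have hsurj : Function.Surjective σ := fun a' => by
    obtain ⟨a, ha⟩ := h₂ a'
    exact ⟨a, huniq fun b => by rw [← hσ, ha]⟩
  let s : A →ₗ[ℂ] A :=
    { toFun := σ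
      map_add' := fun x y => huniq fun b => by
        rw [← hσ, add_mul, mul_add, map_add, map_add, hσ x, hσ y]
      map_smul' := fun r x => huniq fun b => by
        rw [← hσ, RingHom.id_apply, smul_mul_assoc, mul_smul_comm, map_smul, map_smul, hσ] }
  have hmul : ∀ x y, σ (x * y) = σ x * σ y := fun x y => huniq fun b => by
    rw [← hσ, mul_assoc, hσ, mul_assoc, hσ, mul_assoc]
  refine ⟨{ s with map_mul' := hmul, map_zero' := s.map_zero }, ⟨hinj, hsurj⟩, hσ, fun a => ?_⟩
  change φ (s a) = φ a
  obtain ⟨z, rfl⟩ := LinearMap.range_eq_top.1 hA.range_mul' a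
  refine tensor_induction (f := φ ∘ₗ s ∘ₗ LinearMap.mul' ℂ A) (g := φ ∘ₗ LinearMap.mul' ℂ A)
    (fun x y => ?_) z
  change φ (σ (x * y)) = φ (x * y)
  rw [hmul, ← hσ, ← hσ]

theorem range_eq_top_of_dual {M N : Type*} [AddCommGroup M] [Module ℂ M] [AddCommGroup N]
    [Module ℂ N] {f : M →ₗ[ℂ] N} (h : ∀ g : N →ₗ[ℂ] ℂ, g ∘ₗ f = 0 → g = 0) :
    Function.Surjective f := by
  by_contra hf
  rw [← LinearMap.range_eq_top] at hf
  obtain ⟨g, hg, hg'⟩ := Submodule.exists_le_ker_of_lt_top _ (lt_top_iff_ne_top.2 hf)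
  exact hg (h g (LinearMap.ext fun x => hg' ⟨x, rfl⟩))

/-- Both sides evaluate `ω ⊗ g` on `z`; this exchange of slices lets one number be computed through
either invariance. -/
theorem apply_sliceLeft (g ω : A →ₗ[ℂ] ℂ) (z : A ⊗[ℂ] A) :
    g (sliceLeft ω z) = ω (sliceRight g z) :=
  tensor_induction (f := g ∘ₗ sliceLeft ω) (g := ω ∘ₗ sliceRight g)
    (fun a b => by simp [mul_comm]) z

namespace CanonicalMaps

variable (H : CanonicalMaps A)

theorem full_sliceLeft {g : A →ₗ[ℂ] ℂ} (h : ∀ a b, sliceLeft g (H.T₁ (a ⊗ₜ b)) = 0) : g = 0 := by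
  refine H.full₁ g fun z => (TensorProduct.lid ℂ A).injective ?_
  rw [map_zero]
  exact tensor_induction (f := sliceLeft g ∘ₗ H.T₁) (g := 0) h z

theorem full_sliceRight {g : A →ₗ[ℂ] ℂ} (h : ∀ a b, sliceRight g (H.T₂ (a ⊗ₜ b)) = 0) :
    g = 0 := by
  refine H.full₂ g fun z => (TensorProduct.rid ℂ A).injective ?_
  rw [map_zero]
  exact tensor_induction (f := sliceRight g ∘ₗ H.T₂) (g := 0) h z

theorem T₃_mulRight (b : A) (z : A ⊗[ℂ] A) :
    H.T₃ ((𝓡 b).rTensor A z) = (𝓡 b).rTensor A (H.T₃ z) := by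
  refine tensor_induction (f := H.T₃ ∘ₗ (𝓡 b).rTensor A) (g := (𝓡 b).rTensor A ∘ₗ H.T₃)
    (fun e a => H.nondeg.eq_of_lTensor_mulRight fun c => ?_) z
  simp only [LinearMap.comp_apply, LinearMap.rTensor_tmul]
  rw [mulRight_T₃, ← rTensor_lTensor_comm, mulRight_T₃, ← H.DL_mulRight₁, LinearMap.rTensor_tmul]

/-- `T₄(a ⊗ c) = (1 ⊗ c)Δ(a)`. -/
def T₄ : A ⊗[ℂ] A →ₗ[ℂ] A ⊗[ℂ] A :=
  (rev₂ A).symm.toLinearMap ∘ₗ H.op.T₃ ∘ₗ (rev₂ A).toLinearMap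

theorem rev₂_T₄ (z : A ⊗[ℂ] A) : rev₂ A (H.T₄ z) = H.op.T₃ (rev₂ A z) := by simp [T₄]

theorem mulRight_T₄ (d s p : A) :
    (𝓡 d).lTensor A (H.T₄ (p ⊗ₜ s)) = (𝓛 s).lTensor A (H.T₁ (p ⊗ₜ d)) := by
  apply (rev₂ A).injective
  rw [rev₂_lTensor, rev₂_lTensor, rev₂_T₄, conj_mulRight, conj_mulLeft, ← op_T₂_rev₂]
  exact H.op.mulLeft_T₃ _ _ _

theorem T₄_mulLeft (b : A) (z : A ⊗[ℂ] A) :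
    H.T₄ ((𝓛 b).lTensor A z) = (𝓛 b).lTensor A (H.T₄ z) := by
  apply (rev₂ A).injective
  rw [rev₂_lTensor, rev₂_T₄, rev₂_T₄, rev₂_lTensor, conj_mulLeft]
  exact H.op.T₃_mulRight _ _

section Spans

variable {ω : A →ₗ[ℂ] ℂ}

/-- If `g` kills all slices, then `ω` kills `(ι ⊗ g)T₃(z)`. Replacing `z` by `z(b ⊗ 1)` and using
faithfulness gives `(ι ⊗ g)T₃ = 0`, and fullness forces `g = 0`. The other two surjectivity lemmas
use the same scheme. -/
theorem surjective_sliceLeft_T₃ (hω : ∀ a, (∀ b, ω (a * b) = 0) → a = 0) :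
    Function.Surjective (sliceLeft ω ∘ₗ H.T₃) := by
  refine range_eq_top_of_dual fun g hg => H.full_sliceRight fun c a => ?_
  have h₁ : ∀ z, ω (sliceRight g (H.T₃ z)) = 0 := fun z => by
    rw [← apply_sliceLeft]
    exact LinearMap.congr_fun hg z
  have h₂ : ∀ z, sliceRight g (H.T₃ z) = 0 := fun z => hω _ fun b => by
    rw [← LinearMap.mulRight_apply (R := ℂ), ← sliceRight_rTensor, ← T₃_mulRight, h₁]
  refine H.nondeg.eq_of_mul_right fun p => ?_
  rw [← LinearMap.mulRight_apply (R := ℂ), ← sliceRight_rTensor, ← mulLeft_T₃, sliceRight_rTensor,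
    h₂, map_zero, zero_mul]

theorem surjective_sliceRight_T₁ (hω : ∀ a, (∀ b, ω (a * b) = 0) → a = 0) :
    Function.Surjective (sliceRight ω ∘ₗ H.T₁) := by
  refine range_eq_top_of_dual fun g hg => H.full_sliceLeft fun a b => hω _ fun b' => ?_
  rw [← LinearMap.mulRight_apply (R := ℂ), ← sliceLeft_lTensor, ← T₁_mulRight, apply_sliceLeft]
  exact LinearMap.congr_fun hg _

theorem surjective_sliceRight_T₄ (hω : ∀ a, (∀ b, ω (b * a) = 0) → a = 0) :
    Function.Surjective (sliceRight ω ∘ₗ H.T₄) := by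
  refine range_eq_top_of_dual fun g hg => H.full_sliceLeft fun a b => ?_
  have h₂ : ∀ z, sliceLeft g (H.T₄ z) = 0 := fun z => hω _ fun b => by
    rw [← LinearMap.mulLeft_apply (R := ℂ), ← sliceLeft_lTensor, ← T₄_mulLeft, apply_sliceLeft]
    exact LinearMap.congr_fun hg _
  refine H.nondeg.eq_of_mul_left fun s => ?_
  rw [← LinearMap.mulLeft_apply (R := ℂ), ← sliceLeft_lTensor, ← mulRight_T₄, sliceLeft_lTensor,
    h₂, map_zero, mul_zero]

end Spans

section LeftInvariant

variable {H} {φ : A →ₗ[ℂ] ℂ} (hφ : H.IsLeftInvariant φ)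
include hφ

/-- The functional `φ ∘ S` is right invariant:
`(ψ ⊗ ι)(Δ(p)(b ⊗ d)) = S((ψ ⊗ ι)((p ⊗ 1)Δ(b))) d`. -/
theorem IsLeftInvariant.sliceLeft_mulRight_T₁ (p b d : A) :
    sliceLeft (φ ∘ₗ H.S.toLinearMap) ((𝓡 b).rTensor A (H.T₁ (p ⊗ₜ d)))
      = H.S (sliceLeft (φ ∘ₗ H.S.toLinearMap) (H.T₂ (p ⊗ₜ b))) * d := by
  -- Strong left invariance at antipode images; `S` flips both coproducts and exchanges the legs,
  -- which turns `φ` into `φ ∘ S`.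
  have h := hφ.sliceRight_mulLeft_T₂ (H.S b) (H.S p) (H.S d)
  rw [T₂_S, T₁_S] at h
  have h₁ : ∀ z : A ⊗[ℂ] A, sliceRight φ ((𝓛 (H.S b)).lTensor A (TensorProduct.comm ℂ A A
      (TensorProduct.map H.S.toLinearMap H.S.toLinearMap z)))
      = H.S (sliceLeft (φ ∘ₗ H.S.toLinearMap) ((𝓡 b).rTensor A z)) := fun z =>
    tensor_induction (f := sliceRight φ ∘ₗ (𝓛 (H.S b)).lTensor A ∘ₗ
      (TensorProduct.comm ℂ A A).toLinearMap ∘ₗ TensorProduct.map H.S.toLinearMap H.S.toLinearMap)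
      (g := H.S.toLinearMap ∘ₗ sliceLeft (φ ∘ₗ H.S.toLinearMap) ∘ₗ (𝓡 b).rTensor A)
      (fun u v => by simp [S_mul_rev]) z
  have h₂ : ∀ z : A ⊗[ℂ] A, sliceRight φ (TensorProduct.comm ℂ A A
      (TensorProduct.map H.S.toLinearMap H.S.toLinearMap z))
      = H.S (sliceLeft (φ ∘ₗ H.S.toLinearMap) z) := fun z =>
    tensor_induction (f := sliceRight φ ∘ₗ (TensorProduct.comm ℂ A A).toLinearMap ∘ₗ
      TensorProduct.map H.S.toLinearMap H.S.toLinearMap)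
      (g := H.S.toLinearMap ∘ₗ sliceLeft (φ ∘ₗ H.S.toLinearMap)) (fun u v => by simp) z
  rw [h₁, h₂, ← S_mul_rev] at h
  exact H.S.injective h

/-- For `z = p ⊗ a` both sides are `(ψ ⊗ φ)((S(p) ⊗ a)Δ(b))` with `ψ = φ ∘ S`. Slicing by `φ` first
uses left invariance and gives the left side; slicing by `ψ` first uses right invariance and gives
the right side. -/
theorem IsLeftInvariant.apply_mul_eq (z : A ⊗[ℂ] A) (b : A) :
    φ (sliceLeft (φ ∘ₗ H.S.toLinearMap ∘ₗ H.S.toLinearMap) (H.T₃ z) * b)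
      = φ (H.S (sliceRight (φ ∘ₗ H.S.symm.toLinearMap)
        (H.T₁ (TensorProduct.map H.S.toLinearMap H.S.toLinearMap z)) * b)) := by
  refine tensor_induction
    (f := φ ∘ₗ 𝓡 b ∘ₗ sliceLeft (φ ∘ₗ H.S.toLinearMap ∘ₗ H.S.toLinearMap) ∘ₗ H.T₃)
    (g := φ ∘ₗ H.S.toLinearMap ∘ₗ 𝓡 b ∘ₗ sliceRight (φ ∘ₗ H.S.symm.toLinearMap) ∘ₗ H.T₁ ∘ₗ
      TensorProduct.map H.S.toLinearMap H.S.toLinearMap) (fun p a => ?_) z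
  simp only [LinearMap.comp_apply, TensorProduct.map_tmul, LinearEquiv.coe_coe]
  have h := congrArg (φ ∘ₗ H.S.toLinearMap) (hφ.sliceRight_mulLeft_T₂ a b (H.S p))
  rw [← apply_sliceLeft, sliceLeft_lTensor, ← S_mul_rev] at h
  have h₁ : φ ((𝓛 a) (sliceLeft (φ ∘ₗ H.S.toLinearMap) (H.T₂ (H.S p ⊗ₜ b))))
      = φ (H.S.symm (H.S (sliceLeft (φ ∘ₗ H.S.toLinearMap) (H.T₂ (H.S p ⊗ₜ b))) * H.S a)) := by
    simp [← S_mul_rev]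
  rw [h₁, ← hφ.sliceLeft_mulRight_T₁] at h
  rw [← sliceRight_rTensor, ← sliceLeft_lTensor, mulRight_T₃, ← mulRight_T₁]
  refine Eq.trans ?_ (h.symm.trans ?_)
  · rw [apply_sliceLeft, sliceRight_rTensor]
    rfl
  · exact apply_sliceLeft (φ ∘ₗ H.S.symm.toLinearMap) (φ ∘ₗ H.S.toLinearMap) _

/-- For `z = p ⊗ q` both sides are `(ψ ⊗ φ)((p ⊗ 1)Δ(b)(1 ⊗ q))` with `ψ = φ ∘ S`, again computed
through either invariance. -/
theorem IsLeftInvariant.mul_apply_eq (z : A ⊗[ℂ] A) (b : A) :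
    φ (b * sliceLeft φ (H.T₃ (H.S.toLinearMap.rTensor A z)))
      = φ (H.S (sliceRight (φ ∘ₗ H.S.symm.toLinearMap)
        (H.T₄ (H.S.toLinearMap.lTensor A z)) * b)) := by
  refine tensor_induction
    (f := φ ∘ₗ 𝓛 b ∘ₗ sliceLeft φ ∘ₗ H.T₃ ∘ₗ H.S.toLinearMap.rTensor A)
    (g := φ ∘ₗ H.S.toLinearMap ∘ₗ 𝓡 b ∘ₗ sliceRight (φ ∘ₗ H.S.symm.toLinearMap) ∘ₗ H.T₄ ∘ₗ
      H.S.toLinearMap.lTensor A) (fun p q => ?_) z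
  simp only [LinearMap.comp_apply, LinearMap.rTensor_tmul, LinearMap.lTensor_tmul,
    LinearEquiv.coe_coe]
  set w := sliceLeft (φ ∘ₗ H.S.toLinearMap) (H.T₂ (p ⊗ₜ b)) with hw
  have h₁ : sliceLeft (φ ∘ₗ H.S.toLinearMap) ((𝓡 b).rTensor A (H.T₄ (p ⊗ₜ H.S q)))
      = H.S q * H.S w := by
    refine H.nondeg.eq_of_mul_right fun d => ?_
    rw [← LinearMap.mulRight_apply (R := ℂ), ← sliceLeft_lTensor, ← rTensor_lTensor_comm,
      mulRight_T₄, rTensor_lTensor_comm, sliceLeft_lTensor, hφ.sliceLeft_mulRight_T₁, mul_assoc]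
    rfl
  have h₂ : sliceRight φ ((𝓛 b).lTensor A (H.T₃ (H.S p ⊗ₜ q)))
      = H.S (p * sliceRight φ (H.T₁ (b ⊗ₜ q))) := by
    refine H.nondeg.eq_of_mul_left fun c => ?_
    rw [← LinearMap.mulLeft_apply (R := ℂ), ← sliceRight_rTensor, rTensor_lTensor_comm,
      mulLeft_T₃, ← rTensor_lTensor_comm, sliceRight_rTensor, hφ.sliceRight_mulLeft_T₂, S_mul_rev,
      ← mul_assoc]
    rfl
  have h₃ : φ (H.S.symm (H.S q * H.S w)) = φ (w * q) := by simp [← S_mul_rev]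
  have h₄ := congrArg (φ ∘ₗ H.S.symm.toLinearMap) h₁
  rw [apply_sliceLeft, sliceRight_rTensor] at h₄
  have h₅ := congrArg φ h₂
  rw [← apply_sliceLeft, sliceLeft_lTensor] at h₅
  refine h₅.trans (Eq.trans ?_ (h₃.symm.trans h₄.symm))
  have h₆ : φ (w * q) = (φ ∘ₗ H.S.toLinearMap)
      (sliceRight φ ((𝓡 q).lTensor A (H.T₂ (p ⊗ₜ b)))) := by
    rw [← apply_sliceLeft, sliceLeft_lTensor]
    rfl
  rw [h₆, ← mulLeft_T₁, sliceRight_rTensor]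
  rfl

theorem IsLeftInvariant.exists_modular_automorphism (hf : IsFaithful φ) :
    ∃ σ : A →ₙₐ[ℂ] A, Function.Bijective σ ∧
      (∀ a b : A, φ (a * b) = φ (b * σ a)) ∧ (∀ a : A, φ (σ a) = φ a) := by
  have hS := H.S.surjective
  have hS₁ : Function.Surjective (H.S.toLinearMap.rTensor A) := LinearMap.rTensor_surjective A hS
  have hS₂ : Function.Surjective (H.S.toLinearMap.lTensor A) := LinearMap.lTensor_surjective A hS
  have hS₃ : Function.Surjective (TensorProduct.map H.S.toLinearMap H.S.toLinearMap) :=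
    TensorProduct.map_surjective hS hS
  -- `S⁻¹` reverses products, so the two halves of faithfulness trade places; under `S ∘ S` in `hω₃`
  -- they do not.
  have hω₁ : ∀ a, (∀ b, (φ ∘ₗ H.S.symm.toLinearMap) (a * b) = 0) → a = 0 := fun a ha =>
    H.S.symm.map_eq_zero_iff.1 <| hf.2 _ fun b => by
      simpa [S_symm_mul_rev] using ha (H.S b)
  have hω₂ : ∀ a, (∀ b, (φ ∘ₗ H.S.symm.toLinearMap) (b * a) = 0) → a = 0 := fun a ha =>
    H.S.symm.map_eq_zero_iff.1 <| hf.1 _ fun b => by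
      simpa [S_symm_mul_rev] using ha (H.S b)
  have hω₃ : ∀ a, (∀ b, (φ ∘ₗ H.S.toLinearMap ∘ₗ H.S.toLinearMap) (a * b) = 0) → a = 0 :=
    fun a ha => H.S.map_eq_zero_iff.1 <| H.S.map_eq_zero_iff.1 <| hf.1 _ fun b => by
      simpa [S_mul_rev] using ha (H.S.symm (H.S.symm b))
  have hn := H.surjective_sliceLeft_T₃ hω₃
  have hk := (H.surjective_sliceRight_T₁ hω₁).comp hS₃
  have hn' := (H.surjective_sliceLeft_T₃ hf.1).comp hS₁
  have hk' := (H.surjective_sliceRight_T₄ hω₂).comp hS₂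
  refine hf.exists_modular_automorphism H.idem (fun a => ?_) fun a' => ?_
  · obtain ⟨z, rfl⟩ := hn a
    -- Write `φ(a ·) = ψ(k ·)` with `ψ = φ ∘ S`, then realize the same `k` as a slice of the second
    -- kind to get `φ(· a')`.
    obtain ⟨z', hz'⟩ := hk' (sliceRight (φ ∘ₗ H.S.symm.toLinearMap)
        (H.T₁ (TensorProduct.map H.S.toLinearMap H.S.toLinearMap z)))
    refine ⟨sliceLeft φ (H.T₃ (H.S.toLinearMap.rTensor A z')), fun b => ?_⟩
    refine (hφ.apply_mul_eq z b).trans (Eq.trans ?_ (hφ.mul_apply_eq z' b).symm)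
    rw [← hz']
    rfl
  · obtain ⟨z', rfl⟩ := hn' a'
    obtain ⟨z, hz⟩ := hk (sliceRight (φ ∘ₗ H.S.symm.toLinearMap)
        (H.T₄ (H.S.toLinearMap.lTensor A z')))
    refine ⟨_, fun b => (hφ.apply_mul_eq z b).trans (Eq.trans ?_ (hφ.mul_apply_eq z' b).symm)⟩
    rw [← hz]
    rfl

end LeftInvariant

end CanonicalMaps

/-! ### From the definition to the canonical maps -/

theorem Nondegenerate.tensor {B C : Type*}
    [NonUnitalRing B] [Module ℂ B] [IsScalarTower ℂ B B] [SMulCommClass ℂ B B]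
    [NonUnitalRing C] [Module ℂ C] [IsScalarTower ℂ C C] [SMulCommClass ℂ C C]
    (hB : Nondegenerate B) (hC : Nondegenerate C) : Nondegenerate (B ⊗[ℂ] C) := by
  constructor
  · intro z hz
    refine eq_zero_of_rTensor (fun b : B => 𝓡 b) (fun m hm => hB.1 m hm) _ fun b =>
      eq_zero_of_lTensor (fun c : C => 𝓡 c) (fun m hm => hC.1 m hm) _ fun c => ?_
    rw [← hz (b ⊗ₜ c)]
    exact tensor_induction (f := (𝓡 c).lTensor B ∘ₗ (𝓡 b).rTensor C) (g := 𝓡 (b ⊗ₜ c))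
      (fun p q => by simp) z
  · intro z hz
    refine eq_zero_of_rTensor (fun b : B => 𝓛 b) (fun m hm => hB.2 m hm) _ fun b =>
      eq_zero_of_lTensor (fun c : C => 𝓛 c) (fun m hm => hC.2 m hm) _ fun c => ?_
    rw [← hz (b ⊗ₜ c)]
    exact tensor_induction (f := (𝓛 c).lTensor B ∘ₗ (𝓛 b).rTensor C) (g := 𝓛 (b ⊗ₜ c))
      (fun p q => by simp) z

namespace Multiplier

variable {B : Type*} [NonUnitalRing B] [Module ℂ B] [IsScalarTower ℂ B B] [SMulCommClass ℂ B B]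

variable (B) in
/-- The left action of multipliers, as a linear map. -/
def leftHom : Multiplier B →ₗ[ℂ] (B →ₗ[ℂ] B) where
  toFun m := m.left
  map_add' _ _ := rfl
  map_smul' _ _ := rfl

variable (B) in
/-- The right action of multipliers, as a linear map. -/
def rightHom : Multiplier B →ₗ[ℂ] (B →ₗ[ℂ] B) where
  toFun m := m.right
  map_add' _ _ := rfl
  map_smul' _ _ := rfl

end Multiplier

namespace Coproduct

variable (D : Coproduct A)

theorem T₁_mul (a b : A) (y : A ⊗[ℂ] A) :
    D.T₁ (a ⊗ₜ b) * y = (D.Δ a).left ((𝓛 b).lTensor A y) :=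
  congrArg (fun m => m.left y) (D.T₁_spec a b)

theorem mul_T₁ (a b : A) (y : A ⊗[ℂ] A) :
    y * D.T₁ (a ⊗ₜ b) = (𝓡 b).lTensor A ((D.Δ a).right y) :=
  congrArg (fun m => m.right y) (D.T₁_spec a b)

theorem T₂_mul (a b : A) (y : A ⊗[ℂ] A) :
    D.T₂ (b ⊗ₜ a) * y = (𝓛 b).rTensor A ((D.Δ a).left y) :=
  congrArg (fun m => m.left y) (D.T₂_spec b a)

theorem mul_T₂ (a b : A) (y : A ⊗[ℂ] A) :
    y * D.T₂ (b ⊗ₜ a) = (D.Δ a).right ((𝓡 b).rTensor A y) :=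
  congrArg (fun m => m.right y) (D.T₂_spec b a)

theorem ΔI_tmul_left (p q : A) (w : A ⊗[ℂ] (A ⊗[ℂ] A)) : (D.ΔI (p ⊗ₜ q)).left w
    = TensorProduct.assoc ℂ A A A (TensorProduct.map (D.Δ p).left (𝓛 q)
      ((TensorProduct.assoc ℂ A A A).symm w)) := rfl

theorem ΔI_tmul_right (p q : A) (w : A ⊗[ℂ] (A ⊗[ℂ] A)) : (D.ΔI (p ⊗ₜ q)).right w
    = TensorProduct.assoc ℂ A A A (TensorProduct.map (D.Δ p).right (𝓡 q)
      ((TensorProduct.assoc ℂ A A A).symm w)) := rfl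

theorem IΔ_tmul_left (p q : A) (w : A ⊗[ℂ] (A ⊗[ℂ] A)) : (D.IΔ (p ⊗ₜ q)).left w
    = TensorProduct.map (𝓛 p) (D.Δ q).left w := rfl

theorem IΔ_tmul_right (p q : A) (w : A ⊗[ℂ] (A ⊗[ℂ] A)) : (D.IΔ (p ⊗ₜ q)).right w
    = TensorProduct.map (𝓡 p) (D.Δ q).right w := rfl

theorem leg12_T₂_mul (c : A) (z : A ⊗[ℂ] A) (w : A ⊗[ℂ] (A ⊗[ℂ] A)) :
    leg12 D.T₂ (c ⊗ₜ z) * w = (𝓛 c).rTensor (A ⊗[ℂ] A) ((D.ΔI z).left w) := by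
  obtain ⟨w, rfl⟩ := (TensorProduct.assoc ℂ A A A).surjective w
  induction z with
  | zero => simp
  | add x y hx hy => simp only [map_add, TensorProduct.tmul_add, add_mul, hx, hy,
      Multiplier.left_add, LinearMap.add_apply]
  | tmul p q =>
    rw [leg12_tmul, ← assoc_mul, ΔI_tmul_left, LinearEquiv.symm_apply_apply]
    induction w with
    | zero => simp
    | add x y hx hy => simp only [map_add, mul_add, hx, hy]
    | tmul x r => rw [Algebra.TensorProduct.tmul_mul_tmul, D.T₂_mul, ← rTensor_assoc]; rfl

theorem mul_leg12_T₂ (c : A) (z : A ⊗[ℂ] A) (w : A ⊗[ℂ] (A ⊗[ℂ] A)) :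
    w * leg12 D.T₂ (c ⊗ₜ z) = (D.ΔI z).right ((𝓡 c).rTensor (A ⊗[ℂ] A) w) := by
  obtain ⟨w, rfl⟩ := (TensorProduct.assoc ℂ A A A).surjective w
  induction z with
  | zero => simp
  | add x y hx hy => simp only [map_add, TensorProduct.tmul_add, mul_add, hx, hy,
      Multiplier.right_add, LinearMap.add_apply]
  | tmul p q =>
    rw [leg12_tmul, ← assoc_mul, ΔI_tmul_right]
    induction w with
    | zero => simp
    | add x y hx hy => simp only [map_add, add_mul, hx, hy]
    | tmul x r =>
      rw [Algebra.TensorProduct.tmul_mul_tmul, D.mul_T₂, rTensor_assoc,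
        LinearEquiv.symm_apply_apply]
      rfl

theorem leg23_T₁_mul (c : A) (z : A ⊗[ℂ] A) (w : A ⊗[ℂ] (A ⊗[ℂ] A)) :
    leg23 D.T₁ (TensorProduct.assoc ℂ A A A (z ⊗ₜ c)) * w
      = (D.IΔ z).left (((𝓛 c).lTensor A).lTensor A w) := by
  induction z with
  | zero => simp
  | add x y hx hy => simp only [map_add, TensorProduct.add_tmul, add_mul, hx, hy,
      Multiplier.left_add, LinearMap.add_apply]
  | tmul p q =>
    rw [TensorProduct.assoc_tmul, leg23_tmul, IΔ_tmul_left]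
    induction w with
    | zero => simp
    | add x y hx hy => simp only [map_add, mul_add, hx, hy]
    | tmul r x =>
      rw [Algebra.TensorProduct.tmul_mul_tmul, D.T₁_mul]
      rfl

theorem mul_leg23_T₁ (c : A) (z : A ⊗[ℂ] A) (w : A ⊗[ℂ] (A ⊗[ℂ] A)) :
    w * leg23 D.T₁ (TensorProduct.assoc ℂ A A A (z ⊗ₜ c))
      = ((𝓡 c).lTensor A).lTensor A ((D.IΔ z).right w) := by
  induction z with
  | zero => simp
  | add x y hx hy => simp only [map_add, TensorProduct.add_tmul, mul_add, hx, hy,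
      Multiplier.right_add, LinearMap.add_apply]
  | tmul p q =>
    rw [TensorProduct.assoc_tmul, leg23_tmul, IΔ_tmul_right]
    induction w with
    | zero => simp
    | add x y hx hy => simp only [map_add, add_mul, hx, hy]
    | tmul r x =>
      rw [Algebra.TensorProduct.tmul_mul_tmul, D.mul_T₁]
      rfl

end Coproduct

theorem left_tensorOne (E : Multiplier (A ⊗[ℂ] A)) : (tensorOne E).left = leg12 E.left := rfl

theorem right_tensorOne (E : Multiplier (A ⊗[ℂ] A)) : (tensorOne E).right = leg12 E.right := rfl

theorem left_oneTensor (E : Multiplier (A ⊗[ℂ] A)) : (oneTensor E).left = leg23 E.left := rfl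

theorem right_oneTensor (E : Multiplier (A ⊗[ℂ] A)) : (oneTensor E).right = leg23 E.right := rfl

namespace WeakMultiplierHopfAlgebra

variable (H : WeakMultiplierHopfAlgebra A)

include H in
theorem nondegenerate₂ : Nondegenerate (A ⊗[ℂ] A) := H.nondegenerate.tensor H.nondegenerate

include H in
theorem nondegenerate₃ : Nondegenerate (A ⊗[ℂ] (A ⊗[ℂ] A)) :=
  H.nondegenerate.tensor H.nondegenerate₂

theorem E_T₁ (z : A ⊗[ℂ] A) : H.E.left (H.T₁ z) = H.T₁ z := by
  obtain ⟨w, hw⟩ : H.T₁ z ∈ LinearMap.range H.E.left := H.range_T₁ ▸ ⟨z, rfl⟩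
  rw [← hw]
  exact congrArg (fun m => m.left w) H.E_idem

theorem E_T₂ (z : A ⊗[ℂ] A) : H.E.right (H.T₂ z) = H.T₂ z := by
  obtain ⟨w, hw⟩ : H.T₂ z ∈ LinearMap.range H.E.right := H.range_T₂ ▸ ⟨z, rfl⟩
  rw [← hw]
  exact congrArg (fun m => m.right w) H.E_idem

theorem E_mul_Δ (a : A) : H.E * H.Δ a = H.Δ a := by
  refine Multiplier.ext_right H.nondegenerate₂ fun w => ?_
  refine H.nondegenerate.eq_of_lTensor_mulRight fun b => ?_
  rw [← H.mul_T₁, Multiplier.right_mul, LinearMap.comp_apply, ← H.mul_T₁,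
    Multiplier.right_apply_mul, H.E_T₁]

theorem Δ_mul_E (a : A) : H.Δ a * H.E = H.Δ a := by
  refine Multiplier.ext_left H.nondegenerate₂ fun w => ?_
  refine H.nondegenerate.eq_of_rTensor_mulLeft fun b => ?_
  rw [← H.T₂_mul, Multiplier.left_mul, LinearMap.comp_apply, ← H.T₂_mul,
    ← Multiplier.right_apply_mul, H.E_T₂]

theorem tensorOne_mul_ΔI (z : A ⊗[ℂ] A) : tensorOne H.E * H.ΔI z = H.ΔI z := by
  refine LinearMap.congr_fun (f := LinearMap.mulLeft ℂ (tensorOne H.E) ∘ₗ H.ΔI)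
    (TensorProduct.ext' fun p q => ?_) z
  refine Multiplier.ext_left H.nondegenerate₃ fun w => ?_
  obtain ⟨w, rfl⟩ := (TensorProduct.assoc ℂ A A A).surjective w
  change leg12 H.E.left ((H.ΔI (p ⊗ₜ q)).left _) = _
  rw [H.ΔI_tmul_left, LinearEquiv.symm_apply_apply]
  induction w with
  | zero => simp
  | add x y hx hy => simp only [map_add, hx, hy]
  | tmul x r =>
    conv_rhs => rw [← H.E_mul_Δ]
    simp [leg12]

theorem ΔI_mul_tensorOne (z : A ⊗[ℂ] A) : H.ΔI z * tensorOne H.E = H.ΔI z := by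
  refine LinearMap.congr_fun (f := LinearMap.mulRight ℂ (tensorOne H.E) ∘ₗ H.ΔI)
    (TensorProduct.ext' fun p q => ?_) z
  refine Multiplier.ext_right H.nondegenerate₃ fun w => ?_
  obtain ⟨w, rfl⟩ := (TensorProduct.assoc ℂ A A A).surjective w
  change leg12 H.E.right ((H.ΔI (p ⊗ₜ q)).right _) = _
  rw [H.ΔI_tmul_right, LinearEquiv.symm_apply_apply]
  induction w with
  | zero => simp
  | add x y hx hy => simp only [map_add, hx, hy]
  | tmul x r =>
    conv_rhs => rw [← H.Δ_mul_E]
    simp [leg12]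

theorem oneTensor_mul_IΔ (z : A ⊗[ℂ] A) : oneTensor H.E * H.IΔ z = H.IΔ z := by
  refine LinearMap.congr_fun (f := LinearMap.mulLeft ℂ (oneTensor H.E) ∘ₗ H.IΔ)
    (TensorProduct.ext' fun p q => ?_) z
  refine Multiplier.ext_left H.nondegenerate₃ fun w => ?_
  change leg23 H.E.left ((H.IΔ (p ⊗ₜ q)).left _) = _
  rw [H.IΔ_tmul_left]
  induction w with
  | zero => simp
  | add x y hx hy => simp only [map_add, hx, hy]
  | tmul x r =>
    conv_rhs => rw [← H.E_mul_Δ]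
    simp

theorem IΔ_mul_oneTensor (z : A ⊗[ℂ] A) : H.IΔ z * oneTensor H.E = H.IΔ z := by
  refine LinearMap.congr_fun (f := LinearMap.mulRight ℂ (oneTensor H.E) ∘ₗ H.IΔ)
    (TensorProduct.ext' fun p q => ?_) z
  refine Multiplier.ext_right H.nondegenerate₃ fun w => ?_
  change leg23 H.E.right ((H.IΔ (p ⊗ₜ q)).right _) = _
  rw [H.IΔ_tmul_right]
  induction w with
  | zero => simp
  | add x y hx hy => simp only [map_add, hx, hy]
  | tmul x r =>
    conv_rhs => rw [← H.Δ_mul_E]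
    simp

/-- The extension of `Δ ⊗ ι` sends `E` to `(E ⊗ 1)(1 ⊗ E)`; the factor `E ⊗ 1` disappears because it
is absorbed by every value of `Δ ⊗ ι`. -/
theorem oneTensor_mul_ΔI (z : A ⊗[ℂ] A) : oneTensor H.E * H.ΔI z = H.ΔI (H.E.left z) := by
  rw [← H.ΔI_E.2.2.1, H.E_comm, mul_assoc, tensorOne_mul_ΔI]

theorem ΔI_mul_oneTensor (z : A ⊗[ℂ] A) : H.ΔI z * oneTensor H.E = H.ΔI (H.E.right z) := by
  rw [← H.ΔI_E.2.2.2, ← mul_assoc, ΔI_mul_tensorOne]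

theorem tensorOne_mul_IΔ (z : A ⊗[ℂ] A) : tensorOne H.E * H.IΔ z = H.IΔ (H.E.left z) := by
  rw [← H.IΔ_E.2.2.1, mul_assoc, oneTensor_mul_IΔ]

theorem IΔ_mul_tensorOne (z : A ⊗[ℂ] A) : H.IΔ z * tensorOne H.E = H.IΔ (H.E.right z) := by
  rw [← H.IΔ_E.2.2.2, H.E_comm, ← mul_assoc, IΔ_mul_oneTensor]

theorem leg23_E_left_leg12_T₂ (c : A) (z : A ⊗[ℂ] A) :
    leg23 H.E.left (leg12 H.T₂ (c ⊗ₜ z)) = leg12 H.T₂ (c ⊗ₜ H.E.left z) := by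
  refine H.nondegenerate₃.eq_of_mul_right fun w => ?_
  rw [← left_oneTensor, ← Multiplier.left_apply_mul H.nondegenerate₃, H.leg12_T₂_mul,
    H.leg12_T₂_mul, ← oneTensor_mul_ΔI, left_oneTensor, leg23, ← rTensor_lTensor_comm]
  rfl

theorem leg23_E_right_leg12_T₂ (c : A) (z : A ⊗[ℂ] A) :
    leg23 H.E.right (leg12 H.T₂ (c ⊗ₜ z)) = leg12 H.T₂ (c ⊗ₜ H.E.right z) := by
  refine H.nondegenerate₃.eq_of_mul_left fun w => ?_
  rw [← right_oneTensor, ← Multiplier.right_mul_apply H.nondegenerate₃, H.mul_leg12_T₂,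
    H.mul_leg12_T₂, ← ΔI_mul_oneTensor]
  rfl

theorem leg12_E_left_leg23_T₁ (c : A) (z : A ⊗[ℂ] A) :
    leg12 H.E.left (leg23 H.T₁ (TensorProduct.assoc ℂ A A A (z ⊗ₜ c)))
      = leg23 H.T₁ (TensorProduct.assoc ℂ A A A (H.E.left z ⊗ₜ c)) := by
  refine H.nondegenerate₃.eq_of_mul_right fun w => ?_
  rw [← left_tensorOne, ← Multiplier.left_apply_mul H.nondegenerate₃, H.leg23_T₁_mul,
    H.leg23_T₁_mul, ← tensorOne_mul_IΔ]
  rfl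

theorem leg12_E_right_leg23_T₁ (c : A) (z : A ⊗[ℂ] A) :
    leg12 H.E.right (leg23 H.T₁ (TensorProduct.assoc ℂ A A A (z ⊗ₜ c)))
      = leg23 H.T₁ (TensorProduct.assoc ℂ A A A (H.E.right z ⊗ₜ c)) := by
  refine H.nondegenerate₃.eq_of_mul_left fun w => ?_
  rw [← right_tensorOne, ← Multiplier.right_mul_apply H.nondegenerate₃, H.mul_leg23_T₁,
    H.mul_leg23_T₁, ← IΔ_mul_tensorOne]
  refine LinearMap.congr_fun (f := leg12 H.E.right ∘ₗ ((𝓡 c).lTensor A).lTensor A)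
    (g := ((𝓡 c).lTensor A).lTensor A ∘ₗ leg12 H.E.right) (triple_ext fun p q r => ?_) _
  simp only [LinearMap.comp_apply, LinearMap.lTensor_tmul, leg12_tmul]
  generalize H.E.right (p ⊗ₜ q) = t
  induction t with
  | zero => simp
  | add x y hx hy => simp only [map_add, TensorProduct.add_tmul, hx, hy]
  | tmul u v => simp

end WeakMultiplierHopfAlgebra

namespace RegularWeakMultiplierHopfAlgebra

variable (H : RegularWeakMultiplierHopfAlgebra A)

/-- The canonical maps of a regular weak multiplier Hopf algebra. -/
def canonicalMaps : CanonicalMaps A where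
  T₁ := H.T₁
  T₂ := H.T₂
  EL := H.E.left
  ER := H.E.right
  G₁ := H.G₁
  G₂ := H.G₂
  R₁ := H.antipode.choose
  R₂ := H.antipode.choose_spec.choose
  DL := Multiplier.leftHom _ ∘ₗ (H.Δ : A →ₗ[ℂ] Multiplier (A ⊗[ℂ] A))
  DR := Multiplier.rightHom _ ∘ₗ (H.Δ : A →ₗ[ℂ] Multiplier (A ⊗[ℂ] A))
  ε := H.ε
  S := H.S
  nondeg := H.nondegenerate
  idem := H.idempotent
  coassoc w := by
    refine LinearMap.congr_fun (f := leg12 H.T₂ ∘ₗ leg23 H.T₁) (g := leg23 H.T₁ ∘ₗ leg12 H.T₂)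
      (triple_ext fun c a b => ?_) w
    rw [LinearMap.comp_apply, LinearMap.comp_apply, leg23_tmul, leg12_tmul, H.coassoc]
  full₁ h hz := by
    -- By flatness the kernel of `h ⊗ ι` is `ker h ⊗ A`, so fullness applies to `V = ker h`.
    have hV := H.full.1 (LinearMap.ker h) fun a b =>
      (Module.Flat.rTensor_exact A (LinearMap.exact_subtype_ker_map h) _).1 (hz _)
    exact LinearMap.ker_eq_top.1 hV
  full₂ h hz := by
    have hV := H.full.2 (LinearMap.ker h) fun a b =>
      (Module.Flat.lTensor_exact A (LinearMap.exact_subtype_ker_map h) _).1 (hz _)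
    exact LinearMap.ker_eq_top.1 hV
  counit₁ := H.counit.1
  counit₂ := H.counit.2
  T₁_mul := H.T₁_mul
  mul_T₂ := H.mul_T₂
  mul_T₁ := H.mul_T₁
  T₂_mul := H.T₂_mul
  DL_mul a b z := congrArg (fun m => m.left z) (map_mul H.Δ a b)
  DR_mul a b z := congrArg (fun m => m.right z) (map_mul H.Δ a b)
  DR_mul_eq a := (H.Δ a).right_apply_mul
  ER_mul_eq := H.E.right_apply_mul
  EL_EL z := congrArg (fun m => m.left z) H.E_idem
  ER_ER z := congrArg (fun m => m.right z) H.E_idem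
  EL_T₁ := H.E_T₁
  ER_T₂ := H.E_T₂
  EL_comm w := congrArg (fun m => m.left w) H.E_comm
  ER_comm w := (congrArg (fun m => m.right w) H.E_comm).symm
  EL_leg_T₂ w := LinearMap.congr_fun (f := leg23 H.E.left ∘ₗ leg12 H.T₂)
    (g := leg12 H.T₂ ∘ₗ leg23 H.E.left)
    (TensorProduct.ext' fun c z => H.leg23_E_left_leg12_T₂ c z) w
  ER_leg_T₁ w := by
    obtain ⟨w, rfl⟩ := (TensorProduct.assoc ℂ A A A).surjective w
    refine tensor_induction (f := leg12 H.E.right ∘ₗ leg23 H.T₁ ∘ₗ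
      (TensorProduct.assoc ℂ A A A).toLinearMap) (g := leg23 H.T₁ ∘ₗ leg12 H.E.right ∘ₗ
      (TensorProduct.assoc ℂ A A A).toLinearMap) (fun z c => ?_) w
    refine (H.leg12_E_right_leg23_T₁ c z).trans ?_
    simp [leg12]
  EL_leg_T₁ w := by
    obtain ⟨w, rfl⟩ := (TensorProduct.assoc ℂ A A A).surjective w
    refine tensor_induction (f := leg12 H.E.left ∘ₗ leg23 H.T₁ ∘ₗ
      (TensorProduct.assoc ℂ A A A).toLinearMap) (g := leg23 H.T₁ ∘ₗ leg12 H.E.left ∘ₗ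
      (TensorProduct.assoc ℂ A A A).toLinearMap) (fun z c => ?_) w
    refine (H.leg12_E_left_leg23_T₁ c z).trans ?_
    simp [leg12]
  ER_leg_T₂ w := LinearMap.congr_fun (f := leg23 H.E.right ∘ₗ leg12 H.T₂)
    (g := leg12 H.T₂ ∘ₗ leg23 H.E.right)
    (TensorProduct.ext' fun c z => H.leg23_E_right_leg12_T₂ c z) w
  G₁_spec w := LinearMap.congr_fun (f := leg12 H.G₁ ∘ₗ leg13 H.T₁)
    (g := leg13 H.T₁ ∘ₗ leg23 H.E.left) (triple_ext fun a b c => H.G₁_spec a b c) w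
  G₂_spec w := LinearMap.congr_fun (f := leg23 H.G₂ ∘ₗ leg13 H.T₂)
    (g := leg13 H.T₂ ∘ₗ leg12 H.E.right) (triple_ext fun a b c => H.G₂_spec a b c) w
  T₁_R₁ := LinearMap.congr_fun H.antipode.choose_spec.choose_spec.1.1
  T₂_R₂ := LinearMap.congr_fun H.antipode.choose_spec.choose_spec.2.1.1
  R₁_T₁ := LinearMap.congr_fun H.antipode.choose_spec.choose_spec.1.2.1
  R₂_T₂ := LinearMap.congr_fun H.antipode.choose_spec.choose_spec.2.1.2.1
  R₁_T₁_R₁ := LinearMap.congr_fun H.antipode.choose_spec.choose_spec.1.2.2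
  R₂_T₂_R₂ := LinearMap.congr_fun H.antipode.choose_spec.choose_spec.2.1.2.2
  S_mul a b := (H.antipode.choose_spec.choose_spec.2.2 a b).1
  mul_S a b := (H.antipode.choose_spec.choose_spec.2.2 a b).2

theorem mem_targetImage {x : Multiplier A} :
    x ∈ H.targetImage ↔ ∃ a, H.canonicalMaps.et a = x := by
  refine exists_congr fun a => ⟨fun h => ?_, fun h c => ?_⟩
  · refine Multiplier.ext_right H.nondegenerate fun c => ?_
    rw [h, CanonicalMaps.et_right_eq]
    rfl
  · rw [← h, CanonicalMaps.et_right_eq]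
    rfl

/-- The rules for `Δ(xb)` and `Δ(bx)` hold when `b` has the form `ε_t(a)c`, respectively `cε_t(a)`,
since `xε_t(a)` and `ε_t(a)x` are again values of `ε_t`. Such elements span `A`. -/
theorem isTarget_of_mem_targetMultipliers {x : Multiplier A} (hx : x ∈ H.targetMultipliers) :
    H.canonicalMaps.IsTarget x := by
  have hx' : ∀ a, (∃ a', H.canonicalMaps.et a' = x * H.canonicalMaps.et a) ∧
      ∃ a', H.canonicalMaps.et a' = H.canonicalMaps.et a * x := fun a => by
    have h := hx _ (H.mem_targetImage.2 ⟨a, rfl⟩)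
    exact ⟨H.mem_targetImage.1 h.1, H.mem_targetImage.1 h.2⟩
  constructor
  · intro b z
    refine LinearMap.congr_fun (H.canonicalMaps.ext_et_left
      (f := H.canonicalMaps.DL.flip z ∘ₗ x.left)
      (g := x.left.rTensor A ∘ₗ H.canonicalMaps.DL.flip z) fun c a => ?_) b
    obtain ⟨a', ha'⟩ := (hx' a).1
    have h : x.left ((H.canonicalMaps.et a).left c) = (H.canonicalMaps.et a').left c := by
      rw [ha', Multiplier.left_mul, LinearMap.comp_apply]
    simp only [LinearMap.comp_apply, LinearMap.flip_apply]
    rw [h, (H.canonicalMaps.isTarget_et a').DL_left, (H.canonicalMaps.isTarget_et a).DL_left, ha',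
      Multiplier.left_mul, LinearMap.rTensor_comp_apply]
  · intro b z
    refine LinearMap.congr_fun (H.canonicalMaps.ext_et_right
      (f := H.canonicalMaps.DL.flip z ∘ₗ x.right)
      (g := H.canonicalMaps.DL.flip (x.left.rTensor A z)) fun c a => ?_) b
    obtain ⟨a', ha'⟩ := (hx' a).2
    have h : x.right ((H.canonicalMaps.et a).right c) = (H.canonicalMaps.et a').right c := by
      rw [ha', Multiplier.right_mul, LinearMap.comp_apply]
    simp only [LinearMap.comp_apply, LinearMap.flip_apply]
    rw [h, (H.canonicalMaps.isTarget_et a').DL_right, (H.canonicalMaps.isTarget_et a).DL_right,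
      ha', Multiplier.left_mul, LinearMap.rTensor_comp_apply]

theorem eq_T₃ {a b : A} {z : A ⊗[ℂ] A} (hz : Multiplier.of (A ⊗[ℂ] A) z
      = H.Δ a * Multiplier.tmul A A (Multiplier.of A b) 1) :
    z = H.canonicalMaps.T₃ (b ⊗ₜ a) := by
  refine H.nondegenerate.eq_of_lTensor_mulRight fun c => ?_
  refine H.nondegenerate.eq_of_rTensor_mulRight fun d => ?_
  rw [CanonicalMaps.mulRight_T₃, ← CanonicalMaps.DL_mulRight₁]
  have h : (𝓡 d).rTensor A ((𝓡 c).lTensor A z) = z * (d ⊗ₜ c) := (mul_tmul_eq _ _ _).symm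
  exact h.trans (congrArg (fun m => m.left (d ⊗ₜ c)) hz)

theorem IsLeftInvariant.canonicalMaps {H : RegularWeakMultiplierHopfAlgebra A} {φ : A →ₗ[ℂ] ℂ}
    (hφ : H.IsLeftInvariant φ) : H.canonicalMaps.IsLeftInvariant φ := fun a => by
  obtain ⟨x, hx, hxa⟩ := hφ a
  refine ⟨x, H.isTarget_of_mem_targetMultipliers hx, fun b => (hxa b).1, fun b => ?_⟩
  obtain ⟨z, hz, hzb⟩ := (hxa b).2
  rw [hzb, H.eq_T₃ hz]

end RegularWeakMultiplierHopfAlgebra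

end WMHA

end

theorem mainTheorem7 {A : Type*} [NonUnitalRing A] [Module ℂ A] [IsScalarTower ℂ A A]
    [SMulCommClass ℂ A A] (H : WMHA.RegularWeakMultiplierHopfAlgebra A) (φ : A →ₗ[ℂ] ℂ)
    (hφ : H.IsLeftIntegral φ) (hfaithful : WMHA.IsFaithful φ) :
    ∃ σ : A →ₙₐ[ℂ] A, Function.Bijective σ ∧
      (∀ a b : A, φ (a * b) = φ (b * σ a)) ∧ (∀ a : A, φ (σ a) = φ a) :=
  hφ.2.canonicalMaps.exists_modular_automorphism hfaithful
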